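/- Let $A$ be a finite ordered set of $n\ge 1$ agents and let $G=(A,E)$ be a directed graph without loops; $(x,y)\in E$ means that $x$ confirms $y$. The agents vote one after another, openly, in the given order. In plurality voting each agent votes for at most one other agent; in approval voting each agent votes for any set of other agents; abstention is allowed in both. The agent with the most votes is elected, ties being broken in favour of the agent who comes first in the order. If $y$ is elected, agent $x$ receives $\mathcal U_x(y)+\mathcal B_x$, where $\mathcal U_x(y)=1$ if $y=x$, $\mathcal U_x(y)=\tfrac12$ if $(x,y)\in E$, and $\mathcal U_x(y)=0$ otherwise, and $\mathcal B_x=\varepsilon^2 f(x)-\varepsilon g(x)$, where $f(x)$ (resp. $g(x)$) is the number of agents that $x$ votes for and confirms (resp. does not confirm), and $0<\varepsilon<\frac1{2n}$. An agent is achievable if he is elected in some subgame perfect equilibrium (SPE); $W$ is the set of achievable agents. Let $d(a)$ be the in-degree (popularity) of $a$, and $\Delta_{in}(G)$, $\Delta_{out}(G)$ the maximum in- and out-degree. For $w\in W$ let $\mathcal D(w)=\Delta_{in}(G_{-E_w})-d(w)$, where $G_{-E_w}$ is $G$ without the out-edges of $w$, and let $\mathcal D(G)=\min_{w\in W}\mathcal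 D(w)$. Then, for plurality voting and for approval voting alike, the additive gap $\mathcal D=\sup_G\mathcal D(G)$ over the class of graphs with maximum out-degree two is unbounded, i.e. $\mathcal D=\infty$ (whatever admissible $\varepsilon=\varepsilon_n$ is used for graphs on $n$ agents). More precisely, for each of the two voting rules and for every integer $k\ge2$ there is a graph $G$ with $\Delta_{out}(G)=2$ and an agent $w$ of popularity $d(w)=\Delta_{in}(G)-k$ such that, for every $0<\varepsilon<\frac1{2n}$, $w$ is the unique achievable agent and $\mathcal D(G)=k$. -/

import Mathlib

namespace SeqVoting

/-- A confirmation network on `n` agents. The agents are `0, 1, …, n - 1`; their order is both the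
voting order and the tie-breaking order. `out x` is the set of agents that `x` confirms
(the out-neighbours of `x`); agents only confirm other agents. -/
structure Network (n : ℕ) where
  out : Fin n → Finset (Fin n)
  not_mem_self : ∀ x, x ∉ out x

inductive VotingRule where
  | plurality
  | approval

/-- A ballot is the set of agents voted for; the empty set is abstention. -/
abbrev Ballot (n : ℕ) := Finset (Fin n)

/-- The ballots that agent `x` may cast: in plurality voting at most one other agent,
in approval voting any set of other agents. -/
def VotingRule.Legal {n : ℕ} : VotingRule → Fin n → Ballot n → Prop
  | .plurality, x, S => x ∉ S ∧ S.card ≤ 1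
  | .approval, x, S => x ∉ S

/-- A list of ballots, the `i`-th being the ballot of agent `i`, is a legal history if the agents
`0, …, h.length - 1` have voted so far and each has cast a legal ballot. -/
def VotingRule.LegalHistory {n : ℕ} (rule : VotingRule) (h : List (Ballot n)) : Prop :=
  h.length ≤ n ∧ ∀ (i : Fin n) (hi : (i : ℕ) < h.length), rule.Legal i h[i]

/-- A strategy profile: after a history `h` with `h.length < n`, the agent whose turn it is
(the agent number `h.length`) casts the ballot `σ h`. Its values at the histories of length `i`
form the strategy of agent `i`. -/
abbrev Profile (n : ℕ) := List (Ballot n) → Ballot n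

def VotingRule.LegalProfile {n : ℕ} (rule : VotingRule) (σ : Profile n) : Prop :=
  ∀ (h : List (Ballot n)) (hh : h.length < n), rule.LegalHistory h → rule.Legal ⟨h.length, hh⟩ (σ h)

/-- The history reached from `h` when the next `m` agents follow `σ`. -/
def Profile.steps {n : ℕ} (σ : Profile n) : ℕ → List (Ballot n) → List (Ballot n)
  | 0, h => h
  | m + 1, h => Profile.steps σ m (h ++ [σ h])

/-- The complete list of ballots when all the agents after `h` follow `σ`. -/
def Profile.complete {n : ℕ} (σ : Profile n) (h : List (Ballot n)) : List (Ballot n) :=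
  σ.steps (n - h.length) h

/-- The number of votes that `a` receives. -/
def score {n : ℕ} (L : List (Ballot n)) (a : Fin n) : ℕ :=
  L.countP (fun S => a ∈ S)

/-- `w` has the most votes, and comes first among those who have the most votes. -/
def IsWinner {n : ℕ} (L : List (Ballot n)) (w : Fin n) : Prop :=
  (∀ a, score L a ≤ score L w) ∧ ∀ a, score L a = score L w → w ≤ a

theorem existsUnique_isWinner {n : ℕ} (hn : 0 < n) (L : List (Ballot n)) : ∃! w, IsWinner L w := by
  classical
  have : Nonempty (Fin n) := ⟨⟨0, hn⟩⟩
  obtain ⟨m, hm⟩ := Finite.exists_max (score L)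
  let M := Finset.univ.filter (fun w => score L w = score L m)
  have hM : M.Nonempty := ⟨m, by simp [M]⟩
  have h1 : score L (M.min' hM) = score L m := by
    have := M.min'_mem hM
    simpa [M] using this
  refine ⟨M.min' hM, ⟨fun a => h1 ▸ hm a, fun a ha => M.min'_le a ?_⟩, fun w hw => ?_⟩
  · simp [M, ha, h1]
  · have h2 : score L w = score L m := le_antisymm (hm w) (hw.1 m)
    refine le_antisymm (hw.2 _ (h1.trans h2.symm)) (M.min'_le w ?_)
    simp [M, h2]

namespace Network

variable {n : ℕ}

/-- The utility of agent `x` when `y` is elected. -/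
noncomputable def utility (G : Network n) (x y : Fin n) : ℝ :=
  if y = x then 1 else if y ∈ G.out x then 1 / 2 else 0

/-- The truth-bias bonus of agent `x` for casting the ballot `S`. -/
noncomputable def bonus (G : Network n) (ε : ℝ) (x : Fin n) (S : Ballot n) : ℝ :=
  ε ^ 2 * ((S ∩ G.out x).card : ℝ) - ε * ((S \ G.out x).card : ℝ)

open Classical in
/-- The payoff of agent `x` when `L` is the complete list of ballots. The sum has exactly one
term, for the elected agent. -/
noncomputable def payoff (G : Network n) (ε : ℝ) (x : Fin n) (L : List (Ballot n)) : ℝ :=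
  (∑ y with IsWinner L y, G.utility x y) + G.bonus ε x (L.getD x ∅)

/-- Subgame perfect equilibrium: after every legal history, no agent can gain by changing only
his own strategy. -/
def IsSPE (G : Network n) (rule : VotingRule) (ε : ℝ) (σ : Profile n) : Prop :=
  rule.LegalProfile σ ∧
    ∀ h : List (Ballot n), rule.LegalHistory h →
      ∀ (x : Fin n) (τ : Profile n), rule.LegalProfile τ →
        (∀ h' : List (Ballot n), h'.length ≠ x → τ h' = σ h') →
          G.payoff ε x (τ.complete h) ≤ G.payoff ε x (σ.complete h)

/-- The set `W` of achievable agents: those elected in some subgame perfect equilibrium. -/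
def achievable (G : Network n) (rule : VotingRule) (ε : ℝ) : Set (Fin n) :=
  {w | ∃ σ : Profile n, G.IsSPE rule ε σ ∧ IsWinner (σ.complete []) w}

/-- The popularity (in-degree) of `a`. -/
def popularity (G : Network n) (a : Fin n) : ℕ :=
  (Finset.univ.filter (fun b => a ∈ G.out b)).card

/-- The maximum in-degree. -/
def maxIn (G : Network n) : ℕ := Finset.univ.sup G.popularity

/-- The maximum out-degree. -/
def maxOut (G : Network n) : ℕ := Finset.univ.sup (fun a => (G.out a).card)

/-- The network with all out-edges of `w` removed. -/
def removeOut (G : Network n) (w : Fin n) : Network n where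
  out x := if x = w then ∅ else G.out x
  not_mem_self x := by
    split_ifs
    · simp
    · exact G.not_mem_self x

/-- The additive gap of the agent `w`. -/
def agentGap (G : Network n) (w : Fin n) : ℤ :=
  ((G.removeOut w).maxIn : ℤ) - (G.popularity w : ℤ)

/-- The additive gap of the network: the least gap of an achievable agent. -/
noncomputable def additiveGap (G : Network n) (rule : VotingRule) (ε : ℝ) : ℤ :=
  sInf (G.agentGap '' G.achievable rule ε)

end Network

/-- The supremum of the additive gaps of the networks of a class `C`, where `ε n` is the
truth-bias parameter used for networks on `n` agents. -/
noncomputable def supAdditiveGap (rule : VotingRule) (ε : ℕ → ℝ)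
    (C : ∀ n : ℕ, Set (Network n)) : EReal :=
  ⨆ (n : ℕ) (G : Network n) (_ : G ∈ C n), (((G.additiveGap rule (ε n) : ℤ) : ℝ) : EReal)

end SeqVoting

set_option linter.unusedSimpArgs false
set_option linter.unnecessarySeqFocus false

namespace SeqVoting

variable {n : ℕ}

/-! ### Histories, scores and the elected agent -/

/-- The elected agent. -/
noncomputable def winner [NeZero n] (L : List (Ballot n)) : Fin n :=
  (existsUnique_isWinner (Nat.pos_of_ne_zero (NeZero.ne n)) L).choose

theorem isWinner_winner [NeZero n] (L : List (Ballot n)) : IsWinner L (winner L) :=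
  (existsUnique_isWinner (Nat.pos_of_ne_zero (NeZero.ne n)) L).choose_spec.1

theorem isWinner_iff [NeZero n] {L : List (Ballot n)} {w : Fin n} :
    IsWinner L w ↔ winner L = w :=
  ⟨fun h => (existsUnique_isWinner (Nat.pos_of_ne_zero (NeZero.ne n)) L).unique
    (isWinner_winner L) h, fun h => h ▸ isWinner_winner L⟩

theorem score_append (h : List (Ballot n)) (B : Ballot n) (a : Fin n) :
    score (h ++ [B]) a = score h a + if a ∈ B then 1 else 0 := by
  simp [score, List.countP_append, List.countP_cons]

theorem score_le_length (h : List (Ballot n)) (a : Fin n) : score h a ≤ h.length :=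
  List.countP_le_length

@[simp] theorem score_nil (a : Fin n) : score ([] : List (Ballot n)) a = 0 := rfl

namespace Profile

theorem length_steps (σ : Profile n) (m : ℕ) (h : List (Ballot n)) :
    (σ.steps m h).length = h.length + m := by
  induction m generalizing h with
  | zero => rfl
  | succ m ih => rw [Profile.steps, ih]; simp; omega

theorem steps_add (σ : Profile n) (a b : ℕ) (h : List (Ballot n)) :
    σ.steps (a + b) h = σ.steps b (σ.steps a h) := by
  induction a generalizing h with
  | zero => simp [Profile.steps]
  | succ a ih => rw [Nat.succ_add]; simp only [Profile.steps]; exact ih _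

theorem steps_getElem? (σ : Profile n) (m : ℕ) (h : List (Ballot n)) {i : ℕ} (hi : i < h.length) :
    (σ.steps m h)[i]? = h[i]? := by
  induction m generalizing h with
  | zero => rfl
  | succ m ih =>
    rw [Profile.steps, ih _ (by simp; omega), List.getElem?_append_left hi]

/-- Two profiles that agree on the histories not shorter than `h` lead from `h` to the same
ballots. -/
theorem steps_congr {σ τ : Profile n} {m : ℕ} {h : List (Ballot n)}
    (hst : ∀ h', h.length ≤ h'.length → h'.length < h.length + m → τ h' = σ h') :
    τ.steps m h = σ.steps m h := by
  induction m generalizing h with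
  | zero => rfl
  | succ m ih =>
    rw [Profile.steps, Profile.steps, hst h le_rfl (by omega)]
    exact ih fun h' h1 h2 => hst h' (by simp at h1; omega) (by simp at h2; omega)

theorem complete_of_length_eq (σ : Profile n) {h : List (Ballot n)} (hh : h.length = n) :
    σ.complete h = h := by
  simp [Profile.complete, hh, Profile.steps]

theorem complete_eq (σ : Profile n) {h : List (Ballot n)} (hh : h.length < n) :
    σ.complete h = σ.complete (h ++ [σ h]) := by
  have : n - h.length = (n - (h ++ [σ h]).length) + 1 := by simp; omega
  rw [Profile.complete, this, Profile.steps, Profile.complete]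

theorem complete_steps (σ : Profile n) {h : List (Ballot n)} {m : ℕ} (hm : h.length + m ≤ n) :
    σ.complete (σ.steps m h) = σ.complete h := by
  rw [Profile.complete, Profile.complete, ← steps_add, length_steps]
  congr 1; omega

theorem complete_getD (σ : Profile n) (h : List (Ballot n)) (B : Ballot n) :
    (σ.complete (h ++ [B])).getD h.length ∅ = B := by
  rw [List.getD_eq_getElem?_getD, Profile.complete, steps_getElem? _ _ _ (by simp)]
  simp

end Profile

namespace VotingRule

variable {rule : VotingRule}

theorem legal_empty (rule : VotingRule) (x : Fin n) : rule.Legal x ∅ := by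
  cases rule <;> simp [Legal]

theorem Legal.not_mem {x : Fin n} {B : Ballot n} (hB : rule.Legal x B) : x ∉ B := by
  cases rule
  · exact hB.1
  · exact hB

theorem legalHistory_nil (rule : VotingRule) : rule.LegalHistory ([] : List (Ballot n)) :=
  ⟨by simp, by simp⟩

theorem LegalHistory.append {h : List (Ballot n)} (hl : rule.LegalHistory h) (hh : h.length < n)
    {B : Ballot n} (hB : rule.Legal ⟨h.length, hh⟩ B) : rule.LegalHistory (h ++ [B]) := by
  refine ⟨by simp; omega, fun i hi => ?_⟩
  simp only [List.length_append, List.length_singleton] at hi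
  rcases Nat.lt_succ_iff_lt_or_eq.mp hi with hlt | heq
  · have e : (h ++ [B])[i] = h[i] := List.getElem_append_left hlt
    rw [e]; exact hl.2 i hlt
  · have : i = ⟨h.length, hh⟩ := Fin.ext heq
    subst this
    simpa using hB

theorem LegalHistory.append_of_eq {h : List (Ballot n)} (hl : rule.LegalHistory h) {x : Fin n}
    (hx : h.length = x) {B : Ballot n} (hB : rule.Legal x B) : rule.LegalHistory (h ++ [B]) := by
  have hh : h.length < n := hx ▸ x.2
  obtain rfl : x = ⟨h.length, hh⟩ := Fin.ext hx.symm
  exact hl.append hh hB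

theorem LegalHistory.steps {σ : Profile n} (hσ : rule.LegalProfile σ) {h : List (Ballot n)}
    (hl : rule.LegalHistory h) {m : ℕ} (hm : h.length + m ≤ n) :
    rule.LegalHistory (σ.steps m h) := by
  induction m generalizing h with
  | zero => exact hl
  | succ m ih =>
    exact ih (hl.append (by omega) (hσ h (by omega) hl)) (by simp; omega)

end VotingRule

namespace Network

/-! ### Utilities and bonuses -/

theorem payoff_eq [NeZero n] (G : Network n) (ε : ℝ) (x : Fin n) (L : List (Ballot n)) :
    G.payoff ε x L = G.utility x (winner L) + G.bonus ε x (L.getD x ∅) := by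
  classical
  have : (Finset.univ.filter fun y => IsWinner L y) = {winner L} := by
    ext y; simp [isWinner_iff, eq_comm]
  simp [payoff, this]

theorem utility_self (G : Network n) (x : Fin n) : G.utility x x = 1 := by simp [utility]

theorem utility_of_mem (G : Network n) {x y : Fin n} (h : y ∈ G.out x) :
    G.utility x y = 1 / 2 := by
  have : y ≠ x := fun e => G.not_mem_self x (e ▸ h)
  simp [utility, this, h]

theorem utility_of_not_mem (G : Network n) {x y : Fin n} (h : y ∉ G.out x) (hne : y ≠ x) :
    G.utility x y = 0 := by simp [utility, hne, h]

theorem utility_nonneg (G : Network n) (x y : Fin n) : 0 ≤ G.utility x y := by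
  unfold utility; split_ifs <;> norm_num

theorem utility_cases (G : Network n) (x y : Fin n) :
    (y = x ∧ G.utility x y = 1) ∨ (y ∈ G.out x ∧ G.utility x y = 1 / 2) ∨
      (y ≠ x ∧ y ∉ G.out x ∧ G.utility x y = 0) := by
  by_cases h : y = x
  · left; subst h; exact ⟨rfl, G.utility_self y⟩
  · by_cases h' : y ∈ G.out x
    · right; left; exact ⟨h', G.utility_of_mem h'⟩
    · right; right; exact ⟨h, h', G.utility_of_not_mem h' h⟩

theorem bonus_out (G : Network n) (ε : ℝ) (x : Fin n) :
    G.bonus ε x (G.out x) = ε ^ 2 * ((G.out x).card : ℝ) := by simp [bonus]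

theorem bonus_le (G : Network n) {ε : ℝ} (hε : 0 < ε) (x : Fin n) (B : Ballot n) :
    G.bonus ε x B ≤ ε ^ 2 * ((G.out x).card : ℝ) := by
  have h1 : (((B ∩ G.out x).card : ℕ) : ℝ) ≤ (G.out x).card := by
    exact_mod_cast Finset.card_le_card Finset.inter_subset_right
  have h2 : (0 : ℝ) ≤ ((B \ G.out x).card : ℝ) := by positivity
  unfold bonus
  nlinarith [mul_le_mul_of_nonneg_left h1 (sq_nonneg ε), mul_nonneg hε.le h2]

theorem eq_out_of_bonus_le (G : Network n) {ε : ℝ} (hε : 0 < ε) {x : Fin n} {B : Ballot n}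
    (h : G.bonus ε x (G.out x) ≤ G.bonus ε x B) : B = G.out x := by
  rw [bonus_out] at h
  unfold bonus at h
  have h1 : (((B ∩ G.out x).card : ℕ) : ℝ) ≤ (G.out x).card := by
    exact_mod_cast Finset.card_le_card Finset.inter_subset_right
  have h2 : (0 : ℝ) ≤ ((B \ G.out x).card : ℝ) := by positivity
  have h3 := mul_le_mul_of_nonneg_left h1 (sq_nonneg ε)
  have h4 : ((B \ G.out x).card : ℝ) = 0 := by nlinarith
  have h5 : ((G.out x).card : ℝ) ≤ ((B ∩ G.out x).card : ℝ) := by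
    rw [h4, mul_zero, sub_zero] at h
    exact le_of_mul_le_mul_left h (by positivity)
  have h6 : B ⊆ G.out x := by
    rw [← Finset.sdiff_eq_empty_iff_subset, ← Finset.card_eq_zero]; exact_mod_cast h4
  rw [Finset.inter_eq_left.mpr h6] at h5
  exact Finset.eq_of_subset_of_card_le h6 (by exact_mod_cast h5)

theorem subset_out_of_bonus_le (G : Network n) {ε : ℝ} (hε : 0 < ε) (hε' : ε < 1 / 2) {x : Fin n}
    {B : Ballot n} (hx : (G.out x).card ≤ 2) (h : ε ^ 2 ≤ G.bonus ε x B) :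
    B ⊆ G.out x ∧ B.Nonempty := by
  unfold bonus at h
  have h1 : (((B ∩ G.out x).card : ℕ) : ℝ) ≤ 2 := by
    exact_mod_cast (Finset.card_le_card Finset.inter_subset_right).trans hx
  have h4 : (B \ G.out x).card = 0 := by
    by_contra h0
    have h2 : (1 : ℝ) ≤ ((B \ G.out x).card : ℝ) := by
      exact_mod_cast Nat.one_le_iff_ne_zero.mpr h0
    nlinarith [mul_le_mul_of_nonneg_left h1 (sq_nonneg ε), mul_le_mul_of_nonneg_left h2 hε.le]
  refine ⟨?_, ?_⟩
  · rwa [← Finset.sdiff_eq_empty_iff_subset, ← Finset.card_eq_zero]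
  · by_contra hB
    rw [Finset.not_nonempty_iff_eq_empty] at hB
    simp [hB] at h
    nlinarith [pow_pos hε 2]

theorem _root_.SeqVoting.lt_half_of_lt [NeZero n] {ε : ℝ} (hn : ε < 1 / (2 * (n : ℝ))) :
    ε < 1 / 2 := by
  have h2 : (1 : ℝ) ≤ n := by exact_mod_cast Nat.one_le_iff_ne_zero.mpr (NeZero.ne n)
  refine hn.trans_le ?_
  gcongr
  linarith

theorem bonus_sub_lt (G : Network n) {ε : ℝ} (hε : 0 < ε) (hn : ε < 1 / (2 * (n : ℝ))) {x : Fin n}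
    {B B' : Ballot n} (hB : x ∉ B) : G.bonus ε x B' - G.bonus ε x B < 1 / 2 := by
  have hn0 : 0 < n := x.pos
  have hnr : (1 : ℝ) ≤ n := by exact_mod_cast hn0
  have hεn : ε * n < 1 / 2 := by
    rw [lt_div_iff₀ (by positivity)] at hn
    linarith
  have hε1 : ε < 1 := by nlinarith
  have h1 := G.bonus_le hε x B'
  have h2 : (B \ G.out x).card + (G.out x).card + 1 ≤ n := by
    have hd : Disjoint (B \ G.out x) (G.out x) := Finset.sdiff_disjoint
    have hx : x ∉ (B \ G.out x) ∪ G.out x := by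
      simp [hB, G.not_mem_self x]
    calc _ = (insert x ((B \ G.out x) ∪ G.out x)).card := by
          rw [Finset.card_insert_of_notMem hx, Finset.card_union_of_disjoint hd]
      _ ≤ n := by simpa using Finset.card_le_univ (insert x ((B \ G.out x) ∪ G.out x))
  have h2' : ((B \ G.out x).card : ℝ) + (G.out x).card + 1 ≤ n := by exact_mod_cast h2
  have h3 : -(ε * ((B \ G.out x).card : ℝ)) ≤ G.bonus ε x B := by
    unfold bonus
    have : (0 : ℝ) ≤ ε ^ 2 * ((B ∩ G.out x).card : ℝ) := by positivity
    linarith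
  have h4 : ε ^ 2 * ((G.out x).card : ℝ) ≤ ε * (G.out x).card := by
    have : (0 : ℝ) ≤ (G.out x).card := by positivity
    nlinarith [mul_nonneg hε.le this]
  nlinarith

/-! ### Numbers of supporters -/

/-- The number of agents from `t` on that confirm `a`. -/
def likersFrom (G : Network n) (t : ℕ) (a : Fin n) : ℕ :=
  (Finset.univ.filter fun x : Fin n => t ≤ x ∧ a ∈ G.out x).card

/-- The number of agents from `t` on that confirm `a` and have no interest in the election
of `v`. -/
def loyalFrom (G : Network n) (v : Fin n) (t : ℕ) (a : Fin n) : ℕ :=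
  (Finset.univ.filter fun x : Fin n => t ≤ x ∧ a ∈ G.out x ∧ x ≠ v ∧ v ∉ G.out x).card

/-- The number of agents from `t` on that confirm `a` only and are distinct from `v`. -/
def devotedFrom (G : Network n) (v : Fin n) (t : ℕ) (a : Fin n) : ℕ :=
  (Finset.univ.filter fun x : Fin n => t ≤ x ∧ G.out x = {a} ∧ x ≠ v).card

theorem card_filter_from (p : Fin n → Prop) [DecidablePred p] (t : Fin n) :
    (Finset.univ.filter fun x : Fin n => (t : ℕ) ≤ x ∧ p x).card =
      (Finset.univ.filter fun x : Fin n => (t : ℕ) + 1 ≤ x ∧ p x).card + if p t then 1 else 0 := by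
  split_ifs with hp
  · have : (Finset.univ.filter fun x : Fin n => (t : ℕ) ≤ x ∧ p x) =
        insert t (Finset.univ.filter fun x : Fin n => (t : ℕ) + 1 ≤ x ∧ p x) := by
      ext x
      simp only [Finset.mem_filter, Finset.mem_univ, true_and, Finset.mem_insert]
      constructor
      · rintro ⟨h1, h2⟩
        rcases h1.eq_or_lt with e | e
        · exact Or.inl (Fin.ext e.symm)
        · exact Or.inr ⟨e, h2⟩
      · rintro (rfl | ⟨h1, h2⟩)
        · exact ⟨le_rfl, hp⟩
        · exact ⟨by omega, h2⟩
    rw [this, Finset.card_insert_of_notMem (by simp)]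
  · rw [add_zero]
    congr 1
    ext x
    simp only [Finset.mem_filter, Finset.mem_univ, true_and]
    constructor
    · rintro ⟨h1, h2⟩
      refine ⟨?_, h2⟩
      rcases h1.eq_or_lt with e | e
      · exact absurd (Fin.ext e ▸ h2) hp
      · exact e
    · rintro ⟨h1, h2⟩
      exact ⟨by omega, h2⟩

theorem likersFrom_eq (G : Network n) (x a : Fin n) :
    G.likersFrom x a = G.likersFrom (x + 1) a + if a ∈ G.out x then 1 else 0 :=
  card_filter_from (fun y => a ∈ G.out y) x

theorem loyalFrom_eq (G : Network n) (v x a : Fin n) :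
    G.loyalFrom v x a = G.loyalFrom v (x + 1) a +
      if a ∈ G.out x ∧ x ≠ v ∧ v ∉ G.out x then 1 else 0 :=
  card_filter_from (fun y => a ∈ G.out y ∧ y ≠ v ∧ v ∉ G.out y) x

theorem devotedFrom_eq (G : Network n) (v x a : Fin n) :
    G.devotedFrom v x a = G.devotedFrom v (x + 1) a +
      if G.out x = {a} ∧ x ≠ v then 1 else 0 :=
  card_filter_from (fun y => G.out y = {a} ∧ y ≠ v) x

theorem loyalFrom_anti (G : Network n) (v a : Fin n) {s t : ℕ} (hst : s ≤ t) :
    G.loyalFrom v t a ≤ G.loyalFrom v s a :=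
  Finset.card_le_card fun x hx => by
    simp only [Finset.mem_filter] at hx ⊢
    exact ⟨hx.1, hst.trans hx.2.1, hx.2.2⟩

theorem devotedFrom_anti (G : Network n) (v a : Fin n) {s t : ℕ} (hst : s ≤ t) :
    G.devotedFrom v t a ≤ G.devotedFrom v s a :=
  Finset.card_le_card fun x hx => by
    simp only [Finset.mem_filter] at hx ⊢
    exact ⟨hx.1, hst.trans hx.2.1, hx.2.2⟩

theorem likersFrom_of_le (G : Network n) (a : Fin n) {t : ℕ} (ht : n ≤ t) :
    G.likersFrom t a = 0 := by
  rw [likersFrom, Finset.card_eq_zero, Finset.filter_eq_empty_iff]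
  intro x _ hx
  omega

theorem loyalFrom_of_le (G : Network n) (v a : Fin n) {t : ℕ} (ht : n ≤ t) :
    G.loyalFrom v t a = 0 := by
  rw [loyalFrom, Finset.card_eq_zero, Finset.filter_eq_empty_iff]
  intro x _ hx
  omega

theorem devotedFrom_of_le (G : Network n) (v a : Fin n) {t : ℕ} (ht : n ≤ t) :
    G.devotedFrom v t a = 0 := by
  rw [devotedFrom, Finset.card_eq_zero, Finset.filter_eq_empty_iff]
  intro x _ hx
  omega

/-- The number of votes that `a` gets if the agents after `h` vote for those they confirm. -/
def potential (G : Network n) (h : List (Ballot n)) (a : Fin n) : ℕ :=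
  score h a + G.likersFrom h.length a

theorem potential_append (G : Network n) {h : List (Ballot n)} {x : Fin n} (hx : h.length = x)
    (B : Ballot n) (a : Fin n) :
    G.potential (h ++ [B]) a + (if a ∈ G.out x then 1 else 0) =
      G.potential h a + if a ∈ B then 1 else 0 := by
  have := G.likersFrom_eq x a
  rw [potential, potential, score_append, List.length_append, List.length_singleton, hx]
  omega

theorem potential_append_out (G : Network n) {h : List (Ballot n)} {x : Fin n}
    (hx : h.length = x) (a : Fin n) :
    G.potential (h ++ [G.out x]) a = G.potential h a := by
  have := G.potential_append hx (G.out x) a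
  omega

theorem likersFrom_le_loyalFrom (G : Network n) {a v : Fin n} {t : ℕ} (s : Finset (Fin n))
    (hs : ∀ x : Fin n, t ≤ x → a ∈ G.out x → x ∉ s → x ≠ v ∧ v ∉ G.out x) :
    G.likersFrom t a ≤ G.loyalFrom v t a + s.card := by
  rw [likersFrom, loyalFrom]
  refine (Finset.card_le_card ?_).trans (Finset.card_union_le _ s)
  intro x hx
  simp only [Finset.mem_filter, Finset.mem_union, Finset.mem_univ, true_and] at hx ⊢
  by_cases h : x ∈ s
  · exact Or.inr h
  · exact Or.inl ⟨hx.1, hx.2, hs x hx.1 hx.2 h⟩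

theorem likersFrom_le_devotedFrom (G : Network n) {a v : Fin n} {t : ℕ} (s : Finset (Fin n))
    (hs : ∀ x : Fin n, t ≤ x → a ∈ G.out x → x ∉ s → G.out x = {a} ∧ x ≠ v) :
    G.likersFrom t a ≤ G.devotedFrom v t a + s.card := by
  rw [likersFrom, devotedFrom]
  refine (Finset.card_le_card ?_).trans (Finset.card_union_le _ s)
  intro x hx
  simp only [Finset.mem_filter, Finset.mem_union, Finset.mem_univ, true_and] at hx ⊢
  by_cases h : x ∈ s
  · exact Or.inr h
  · exact Or.inl ⟨hx.1, hs x hx.1 hx.2 h⟩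

theorem card_filter_of_iff {p : Fin n → Prop} [DecidablePred p] {lo hi : ℕ} (hn : hi ≤ n)
    (hp : ∀ x : Fin n, p x ↔ lo ≤ x ∧ x < hi) : (Finset.univ.filter p).card = hi - lo := by
  have : Finset.univ.filter p = (Finset.Ico lo hi).attachFin fun i hi' => by
      simp at hi'; omega := by
    ext x; simp [hp]
  rw [this, Finset.card_attachFin, Nat.card_Ico]

theorem likersFrom_zero (G : Network n) (a : Fin n) : G.likersFrom 0 a = G.popularity a := by
  simp [likersFrom, popularity]

/-! ### Subgame perfect equilibria -/

theorem legal_out_approval (G : Network n) (x : Fin n) :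
    VotingRule.approval.Legal x (G.out x) := G.not_mem_self x

section SPE

variable [NeZero n] {G : Network n} {rule : VotingRule} {ε : ℝ} {σ : Profile n}
  {h : List (Ballot n)}

/-- The agent elected when the profile is followed after `h`. -/
noncomputable def _root_.SeqVoting.Profile.outcome (σ : Profile n) (h : List (Ballot n)) : Fin n :=
  winner (σ.complete h)

theorem outcome_step (σ : Profile n) (hh : h.length < n) :
    σ.outcome (h ++ [σ h]) = σ.outcome h := by
  rw [Profile.outcome, ← σ.complete_eq hh, Profile.outcome]

theorem outcome_steps (σ : Profile n) {m : ℕ} (hm : h.length + m ≤ n) :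
    σ.outcome (σ.steps m h) = σ.outcome h := by
  rw [Profile.outcome, σ.complete_steps hm, Profile.outcome]

theorem IsSPE.payoff_le (hσ : G.IsSPE rule ε σ) (hl : rule.LegalHistory h) (hh : h.length < n)
    {B : Ballot n} (hB : rule.Legal ⟨h.length, hh⟩ B) :
    G.utility ⟨h.length, hh⟩ (σ.outcome (h ++ [B])) + G.bonus ε ⟨h.length, hh⟩ B ≤
      G.utility ⟨h.length, hh⟩ (σ.outcome h) + G.bonus ε ⟨h.length, hh⟩ (σ h) := by
  classical
  let τ : Profile n := fun h' => if h' = h then B else σ h'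
  have hτ : rule.LegalProfile τ := by
    intro h' hh' hl'
    by_cases e : h' = h
    · subst e; simpa [τ] using hB
    · simpa [τ, e] using hσ.1 h' hh' hl'
  have key := hσ.2 h hl ⟨h.length, hh⟩ τ hτ (by
    intro h' hne
    have : h' ≠ h := fun e => hne (by simp [e])
    simp [τ, this])
  have e1 : τ.complete h = σ.complete (h ++ [B]) := by
    rw [τ.complete_eq hh]
    have : τ h = B := by simp [τ]
    rw [this, Profile.complete, Profile.complete]
    refine Profile.steps_congr fun h' h1 _ => ?_
    have : h' ≠ h := fun e => by simp [e] at h1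
    simp [τ, this]
  rw [e1, payoff_eq, payoff_eq] at key
  have e2 : (σ.complete h).getD h.length ∅ = σ h := by
    rw [σ.complete_eq hh, σ.complete_getD]
  simp only [σ.complete_getD, e2] at key
  exact key

/-- No ballot of the agent whose turn it is improves the utility he gets from the outcome. -/
theorem IsSPE.utility_le (hσ : G.IsSPE rule ε σ) (hε : 0 < ε) (hn : ε < 1 / (2 * (n : ℝ)))
    (hl : rule.LegalHistory h) (hh : h.length < n)
    {B : Ballot n} (hB : rule.Legal ⟨h.length, hh⟩ B) :
    G.utility ⟨h.length, hh⟩ (σ.outcome (h ++ [B])) ≤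
      G.utility ⟨h.length, hh⟩ (σ.outcome h) := by
  have h1 := hσ.payoff_le hl hh hB
  have h2 := G.bonus_sub_lt hε hn (B' := σ h) hB.not_mem
  rcases G.utility_cases ⟨h.length, hh⟩ (σ.outcome (h ++ [B])) with ⟨_, e⟩ | ⟨_, e⟩ | ⟨_, _, e⟩ <;>
  rcases G.utility_cases ⟨h.length, hh⟩ (σ.outcome h) with ⟨_, e'⟩ | ⟨_, e'⟩ | ⟨_, _, e'⟩ <;>
  linarith

theorem IsSPE.outcome_eq_self (hσ : G.IsSPE rule ε σ) (hε : 0 < ε) (hn : ε < 1 / (2 * (n : ℝ)))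
    (hl : rule.LegalHistory h) {x : Fin n} (hx : h.length = x)
    {B : Ballot n} (hB : rule.Legal x B) (ho : σ.outcome (h ++ [B]) = x) :
    σ.outcome h = x := by
  have hh : h.length < n := hx ▸ x.2
  obtain rfl : x = ⟨h.length, hh⟩ := Fin.ext hx.symm
  have h1 := hσ.utility_le hε hn hl hh hB
  rw [ho, utility_self] at h1
  rcases G.utility_cases ⟨h.length, hh⟩ (σ.outcome h) with ⟨e, _⟩ | ⟨_, e'⟩ | ⟨_, _, e'⟩
  · exact e
  · rw [e'] at h1; norm_num at h1
  · rw [e'] at h1; norm_num at h1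

theorem IsSPE.outcome_mem (hσ : G.IsSPE rule ε σ) (hε : 0 < ε) (hn : ε < 1 / (2 * (n : ℝ)))
    (hl : rule.LegalHistory h) {x : Fin n} (hx : h.length = x)
    {B : Ballot n} (hB : rule.Legal x B) (ho : σ.outcome (h ++ [B]) ∈ G.out x) :
    σ.outcome h = x ∨ σ.outcome h ∈ G.out x := by
  have hh : h.length < n := hx ▸ x.2
  obtain rfl : x = ⟨h.length, hh⟩ := Fin.ext hx.symm
  have h1 := hσ.utility_le hε hn hl hh hB
  rw [utility_of_mem _ ho] at h1
  rcases G.utility_cases ⟨h.length, hh⟩ (σ.outcome h) with ⟨e, _⟩ | ⟨e, _⟩ | ⟨_, _, e'⟩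
  · exact Or.inl e
  · exact Or.inr e
  · rw [e'] at h1; norm_num at h1

/-- In approval voting, an agent to whom the outcome is worthless approves exactly the agents
he confirms. -/
theorem IsSPE.eq_out_of_not_mem (hσ : G.IsSPE .approval ε σ) (hε : 0 < ε)
    (hl : VotingRule.approval.LegalHistory h) {x : Fin n} (hx : h.length = x)
    (h1 : σ.outcome h ≠ x) (h2 : σ.outcome h ∉ G.out x) : σ h = G.out x := by
  have hh : h.length < n := hx ▸ x.2
  obtain rfl : x = ⟨h.length, hh⟩ := Fin.ext hx.symm
  have h3 := hσ.payoff_le hl hh (G.legal_out_approval _)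
  rw [utility_of_not_mem _ h2 h1] at h3
  have := G.utility_nonneg ⟨h.length, hh⟩ (σ.outcome (h ++ [G.out ⟨h.length, hh⟩]))
  exact G.eq_out_of_bonus_le hε (by linarith)

theorem IsSPE.ne_of_sincere (hσ : G.IsSPE .approval ε σ) (hε : 0 < ε)
    (hl : VotingRule.approval.LegalHistory h) {x : Fin n} (hx : h.length = x) {v : Fin n}
    (h1 : v ≠ x) (h2 : v ∉ G.out x) (h3 : σ.outcome (h ++ [G.out x]) ≠ v) : σ.outcome h ≠ v := by
  intro e
  have := hσ.eq_out_of_not_mem hε hl hx (e ▸ h1) (e ▸ h2)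
  rw [← this, outcome_step σ (hx ▸ x.2)] at h3
  exact h3 e

/-- In approval voting, an agent who likes the outcome of his sincere ballot casts it, unless he
can be elected himself. -/
theorem IsSPE.outcome_eq_sincere (hσ : G.IsSPE .approval ε σ) (hε : 0 < ε)
    (hn : ε < 1 / (2 * (n : ℝ)))
    (hl : VotingRule.approval.LegalHistory h) {x : Fin n} (hx : h.length = x)
    (h1 : σ.outcome h ≠ x) (h2 : σ.outcome (h ++ [G.out x]) ∈ G.out x) :
    σ.outcome h = σ.outcome (h ++ [G.out x]) := by
  have h3 := (hσ.outcome_mem hε hn hl hx (G.legal_out_approval x) h2).resolve_left h1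
  have hh : h.length < n := hx ▸ x.2
  obtain rfl : x = ⟨h.length, hh⟩ := Fin.ext hx.symm
  have h4 := hσ.payoff_le hl hh (G.legal_out_approval _)
  rw [utility_of_mem _ h2, utility_of_mem _ h3] at h4
  have := G.eq_out_of_bonus_le hε (by linarith : _ ≤ G.bonus ε _ (σ h))
  rw [← this, outcome_step σ hh]

theorem outcome_ne_of_forall (hσ : G.IsSPE rule ε σ) (hl : rule.LegalHistory h) {x : Fin n}
    (hx : h.length = x) {v : Fin n}
    (h1 : ∀ B, rule.Legal x B → σ.outcome (h ++ [B]) ≠ v) : σ.outcome h ≠ v := by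
  have hh : h.length < n := hx ▸ x.2
  obtain rfl : x = ⟨h.length, hh⟩ := Fin.ext hx.symm
  rw [← outcome_step σ hh]
  exact h1 _ (hσ.1 h hh hl)

/-- A voter who confirms `w` and `b` supports only `w` if this elects `w` whereas supporting `b`
elects neither of the two. -/
theorem IsSPE.outcome_eq_of_cooperate (hσ : G.IsSPE rule ε σ) (hε : 0 < ε)
    (hn : ε < 1 / (2 * (n : ℝ))) (hε2 : ε < 1 / 2) (hl : rule.LegalHistory h) {x w b : Fin n}
    (hx : h.length = x) (hout : G.out x = {w, b}) (hself : σ.outcome h ≠ x)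
    (h1 : σ.outcome (h ++ [{w}]) = w)
    (h2 : ∀ B : Ballot n, rule.Legal x B → b ∈ B → B ⊆ {w, b} →
      σ.outcome (h ++ [B]) ≠ w ∧ σ.outcome (h ++ [B]) ≠ b) : σ.outcome h = w := by
  have hw : w ∈ G.out x := by simp [hout]
  have hB : rule.Legal x {w} := by
    have : x ≠ w := fun e => G.not_mem_self x (by simp [hout, ← e])
    cases rule <;> simp [VotingRule.Legal, this]
  have h3 := (hσ.outcome_mem hε hn hl hx hB (h1.symm ▸ hw)).resolve_left hself
  have hh : h.length < n := hx ▸ x.2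
  obtain rfl : x = ⟨h.length, hh⟩ := Fin.ext hx.symm
  have h4 := hσ.payoff_le hl hh hB
  rw [h1, utility_of_mem _ h3, utility_of_mem _ hw] at h4
  have hb : G.bonus ε ⟨h.length, hh⟩ {w} = ε ^ 2 := by
    simp [bonus, hw]
  have hcard : (G.out ⟨h.length, hh⟩).card ≤ 2 := by
    rw [hout]; exact Finset.card_le_two
  obtain ⟨h5, h6⟩ := G.subset_out_of_bonus_le hε hε2 (B := σ h) hcard (by linarith)
  rw [hout] at h5 h3
  by_cases hbm : b ∈ σ h
  · have := h2 (σ h) (hσ.1 h hh hl) hbm h5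
    rw [outcome_step σ hh] at this
    simp at h3
    tauto
  · have : σ h = {w} := by
      refine Finset.eq_singleton_iff_nonempty_unique_mem.mpr ⟨h6, fun y hy => ?_⟩
      have := h5 hy
      simp at this
      rcases this with rfl | rfl
      · rfl
      · exact absurd hy hbm
    rw [← outcome_step σ hh, this, h1]

/-- In plurality voting, an agent to whom the outcome is worthless votes only for agents he
confirms. -/
theorem IsSPE.subset_out_of_not_mem (hσ : G.IsSPE .plurality ε σ) (hε : 0 < ε)
    (hε2 : ε < 1 / 2) (hl : VotingRule.plurality.LegalHistory h) {x : Fin n} (hx : h.length = x)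
    (hcard : (G.out x).card ≤ 2)
    (h1 : σ.outcome h ≠ x) (h2 : σ.outcome h ∉ G.out x) :
    σ h ⊆ G.out x ∧ ((G.out x).Nonempty → (σ h).Nonempty) := by
  have hh : h.length < n := hx ▸ x.2
  obtain rfl : x = ⟨h.length, hh⟩ := Fin.ext hx.symm
  rcases (G.out ⟨h.length, hh⟩).eq_empty_or_nonempty with he | ⟨a, ha⟩
  · have h3 := hσ.payoff_le hl hh (VotingRule.legal_empty _ _)
    rw [utility_of_not_mem _ h2 h1] at h3
    have := G.utility_nonneg ⟨h.length, hh⟩ (σ.outcome (h ++ [∅]))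
    have := G.eq_out_of_bonus_le hε (B := σ h) (by rw [he]; linarith)
    rw [this, he]; simp
  · have hax : ⟨h.length, hh⟩ ≠ a := fun e => G.not_mem_self _ (by rw [← e] at ha; exact ha)
    have h3 := hσ.payoff_le hl hh (B := {a}) (by simp [VotingRule.Legal, hax])
    rw [utility_of_not_mem _ h2 h1] at h3
    have := G.utility_nonneg ⟨h.length, hh⟩ (σ.outcome (h ++ [{a}]))
    have hb : G.bonus ε ⟨h.length, hh⟩ {a} = ε ^ 2 := by
      simp [bonus, ha]
    obtain ⟨h5, h6⟩ := G.subset_out_of_bonus_le hε hε2 (B := σ h) hcard (by linarith)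
    exact ⟨h5, fun _ => h6⟩

theorem score_outcome_of_length_eq (σ : Profile n) (hh : h.length = n) (a : Fin n) :
    score h a + (if a < σ.outcome h then 1 else 0) ≤ score h (σ.outcome h) := by
  have hw : IsWinner h (σ.outcome h) := by
    rw [Profile.outcome, σ.complete_of_length_eq hh]; exact isWinner_winner h
  have h1 := hw.1 a
  split_ifs with hlt
  · rcases h1.eq_or_lt with e | e
    · exact absurd (hw.2 a e) (not_le.mpr hlt)
    · exact e
  · simpa using h1

/-- If `v` is going to be elected in approval voting, then no `a` supported by enough agents
without interest in `v` can be ahead of `v`. -/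
theorem IsSPE.dominance_approval (hσ : G.IsSPE .approval ε σ) (hε : 0 < ε)
    (hl : VotingRule.approval.LegalHistory h) {a v : Fin n} (hv : σ.outcome h = v) :
    score h a + G.loyalFrom v h.length a + (if a < v then 1 else 0) ≤
      score h v + G.likersFrom h.length v := by
  obtain ⟨m, hm⟩ := Nat.exists_eq_add_of_le hl.1
  induction m generalizing h with
  | zero =>
    have := score_outcome_of_length_eq σ (h := h) (by omega) a
    rw [loyalFrom_of_le _ _ _ (by omega), likersFrom_of_le _ _ (by omega)]
    rw [hv] at this
    exact this
  | succ m ih =>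
    have hh : h.length < n := by omega
    have key := ih (hl.append hh (hσ.1 h hh hl)) ((outcome_step σ hh).trans hv) (by simp; omega)
    rw [score_append, score_append, List.length_append, List.length_singleton] at key
    have e1 := G.likersFrom_eq ⟨h.length, hh⟩ v
    have e2 := G.loyalFrom_eq v ⟨h.length, hh⟩ a
    simp only at e1 e2
    rw [e1, e2]
    have hleg := (hσ.1 h hh hl).not_mem
    by_cases hx : (⟨h.length, hh⟩ : Fin n) = v
    · have : v ∉ σ h := hx ▸ hleg
      simp only [hx, this] at key ⊢
      simp
      simp at key
      omega
    · by_cases hvx : v ∈ G.out ⟨h.length, hh⟩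
      · simp only [hvx] at key ⊢
        simp only [not_true, and_false, if_true, if_false]
        split_ifs at key ⊢ <;> omega
      · have := hσ.eq_out_of_not_mem hε hl (x := ⟨h.length, hh⟩) rfl (hv ▸ Ne.symm hx)
          (hv.symm ▸ hvx)
        rw [this] at key
        simp only [hvx, hx, ne_eq, not_false_eq_true, and_true, if_false] at key ⊢
        omega

/-- If `v` is going to be elected in plurality voting, then no `a` supported by enough agents
who confirm nobody else can be ahead of `v`. -/
theorem IsSPE.dominance_plurality (hσ : G.IsSPE .plurality ε σ) (hε : 0 < ε) (hε2 : ε < 1 / 2)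
    (hcard : ∀ x, (G.out x).card ≤ 2)
    (hl : VotingRule.plurality.LegalHistory h) {a v : Fin n} (hv : σ.outcome h = v)
    (hne : a ≠ v) :
    score h a + G.devotedFrom v h.length a + (if a < v then 1 else 0) ≤
      score h v + G.likersFrom h.length v := by
  obtain ⟨m, hm⟩ := Nat.exists_eq_add_of_le hl.1
  induction m generalizing h with
  | zero =>
    have := score_outcome_of_length_eq σ (h := h) (by omega) a
    rw [devotedFrom_of_le _ _ _ (by omega), likersFrom_of_le _ _ (by omega)]
    rw [hv] at this
    exact this
  | succ m ih =>
    have hh : h.length < n := by omega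
    have key := ih (hl.append hh (hσ.1 h hh hl)) ((outcome_step σ hh).trans hv) (by simp; omega)
    rw [score_append, score_append, List.length_append, List.length_singleton] at key
    have e1 := G.likersFrom_eq ⟨h.length, hh⟩ v
    have e2 := G.devotedFrom_eq v ⟨h.length, hh⟩ a
    simp only at e1 e2
    rw [e1, e2]
    have hleg := (hσ.1 h hh hl).not_mem
    by_cases hx : (⟨h.length, hh⟩ : Fin n) = v
    · have : v ∉ σ h := hx ▸ hleg
      simp only [hx, this] at key ⊢
      simp
      simp at key
      omega
    · by_cases hvx : v ∈ G.out ⟨h.length, hh⟩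
      · have : G.out ⟨h.length, hh⟩ ≠ {a} := fun e => by
          rw [e] at hvx; simp at hvx; exact hne hvx.symm
        simp only [hvx, this] at key ⊢
        simp only [false_and, if_true, if_false]
        split_ifs at key ⊢ <;> omega
      · obtain ⟨h1, h2⟩ := hσ.subset_out_of_not_mem hε hε2 hl (x := ⟨h.length, hh⟩) rfl (hcard _)
          (hv ▸ Ne.symm hx) (hv.symm ▸ hvx)
        have h3 : v ∉ σ h := fun hm => hvx (h1 hm)
        simp only [hvx, h3, hx, ne_eq, not_false_eq_true, and_true, if_false] at key ⊢
        by_cases ha : G.out ⟨h.length, hh⟩ = {a}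
        · rw [ha] at h1 h2
          have : σ h = {a} := (Finset.subset_singleton_iff.mp h1).resolve_left
            (h2 (by simp)).ne_empty
          simp only [this, ha, Finset.mem_singleton, if_true] at key ⊢
          omega
        · simp only [ha, if_false] at key ⊢
          omega

theorem IsSPE.score_add_le_approval (hσ : G.IsSPE .approval ε σ) (hε : 0 < ε)
    (hl : VotingRule.approval.LegalHistory h) {a v : Fin n} (hv : σ.outcome h = v)
    {t : ℕ} (ht : h.length ≤ t) (s : Finset (Fin n))
    (hs : ∀ x : Fin n, t ≤ x → a ∈ G.out x → x ∉ s → x ≠ v ∧ v ∉ G.out x) :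
    score h a + G.likersFrom t a + (if a < v then 1 else 0) ≤ G.potential h v + s.card := by
  have h1 := hσ.dominance_approval hε hl hv (a := a)
  have h2 := G.likersFrom_le_loyalFrom s hs
  have h3 := G.loyalFrom_anti v a ht
  rw [potential]
  omega

theorem IsSPE.score_add_le_plurality (hσ : G.IsSPE .plurality ε σ) (hε : 0 < ε)
    (hε2 : ε < 1 / 2) (hcard : ∀ x, (G.out x).card ≤ 2)
    (hl : VotingRule.plurality.LegalHistory h) {a v : Fin n} (hv : σ.outcome h = v) (hne : a ≠ v)
    {t : ℕ} (ht : h.length ≤ t) (s : Finset (Fin n))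
    (hs : ∀ x : Fin n, t ≤ x → a ∈ G.out x → x ∉ s → G.out x = {a} ∧ x ≠ v) :
    score h a + G.likersFrom t a + (if a < v then 1 else 0) ≤ G.potential h v + s.card := by
  have h1 := hσ.dominance_plurality hε hε2 hcard hl hv hne
  have h2 := G.likersFrom_le_devotedFrom s hs
  have h3 := G.devotedFrom_anti v a ht
  rw [potential]
  omega

end SPE

/-! ### Existence of subgame perfect equilibria -/

section Existence

variable (G : Network n) (rule : VotingRule) (ε : ℝ)

theorem exists_best_ballot (x : Fin n) (f : Ballot n → ℝ) :
    ∃ B, rule.Legal x B ∧ ∀ B', rule.Legal x B' → f B' ≤ f B := by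
  classical
  obtain ⟨B, hB, hmax⟩ := Finset.exists_max_image (Finset.univ.filter fun B => rule.Legal x B) f
    ⟨∅, by simp [VotingRule.legal_empty]⟩
  exact ⟨B, by simpa using hB, fun B' hB' => hmax B' (by simpa using hB')⟩

open Classical in
/-- The ballots cast after `h` when the `m` remaining agents play optimally. -/
noncomputable def optimalPlay : ℕ → List (Ballot n) → List (Ballot n)
  | 0, h => h
  | m + 1, h => optimalPlay m (h ++ [if hh : h.length < n then
      (exists_best_ballot rule ⟨h.length, hh⟩ fun B =>
        G.payoff ε ⟨h.length, hh⟩ (optimalPlay m (h ++ [B]))).choose else ∅])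

open Classical in
/-- The profile obtained by backward induction. -/
noncomputable def optimalProfile : Profile n := fun h =>
  if hh : h.length < n then
    (exists_best_ballot rule ⟨h.length, hh⟩ fun B =>
      G.payoff ε ⟨h.length, hh⟩ (optimalPlay G rule ε (n - h.length - 1) (h ++ [B]))).choose
  else ∅

theorem steps_optimalProfile (m : ℕ) (h : List (Ballot n)) (hm : h.length + m = n) :
    (optimalProfile G rule ε).steps m h = optimalPlay G rule ε m h := by
  induction m generalizing h with
  | zero => rfl
  | succ m ih =>
    rw [Profile.steps, ih _ (by simp; omega), optimalPlay]
    have : n - h.length - 1 = m := by omega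
    simp only [optimalProfile, this]

theorem optimalProfile_spec {h : List (Ballot n)} (hh : h.length < n) :
    rule.Legal ⟨h.length, hh⟩ (optimalProfile G rule ε h) ∧
    ∀ B, rule.Legal ⟨h.length, hh⟩ B →
      G.payoff ε ⟨h.length, hh⟩ ((optimalProfile G rule ε).complete (h ++ [B])) ≤
      G.payoff ε ⟨h.length, hh⟩ ((optimalProfile G rule ε).complete h) := by
  have hc : ∀ B, (optimalProfile G rule ε).complete (h ++ [B]) =
      optimalPlay G rule ε (n - h.length - 1) (h ++ [B]) := fun B => by
    rw [Profile.complete]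
    have : n - (h ++ [B]).length = n - h.length - 1 := by simp; omega
    rw [this, steps_optimalProfile _ _ _ _ _ (by simp; omega)]
  have hs := (exists_best_ballot rule ⟨h.length, hh⟩ fun B =>
      G.payoff ε ⟨h.length, hh⟩ (optimalPlay G rule ε (n - h.length - 1) (h ++ [B]))).choose_spec
  have he : optimalProfile G rule ε h = (exists_best_ballot rule ⟨h.length, hh⟩ fun B =>
      G.payoff ε ⟨h.length, hh⟩
        (optimalPlay G rule ε (n - h.length - 1) (h ++ [B]))).choose := by
    simp only [optimalProfile, hh, dif_pos]
  rw [Profile.complete_eq _ hh]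
  simp only [hc]
  rw [he]
  exact hs

theorem isSPE_optimalProfile : G.IsSPE rule ε (optimalProfile G rule ε) := by
  have hleg : rule.LegalProfile (optimalProfile G rule ε) := fun h hh _ =>
    (optimalProfile_spec G rule ε hh).1
  refine ⟨hleg, fun h hl x τ hτ hne => ?_⟩
  set σ := optimalProfile G rule ε
  rcases lt_or_ge (x : ℕ) h.length with hx | hx
  · have : τ.complete h = σ.complete h :=
      Profile.steps_congr fun h' h1 _ => hne h' (by omega)
    rw [this]
  · obtain ⟨m, hm⟩ := Nat.exists_eq_add_of_le hx
    have hxn := x.2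
    have e1 : τ.steps m h = σ.steps m h :=
      Profile.steps_congr fun h' _ h2 => hne h' (by omega)
    rw [← σ.complete_steps (m := m) (by omega), ← τ.complete_steps (m := m) (by omega), e1]
    have hlen : (σ.steps m h).length = x := by rw [Profile.length_steps, hm]
    have hl' := hl.steps hleg (m := m) (by omega)
    generalize σ.steps m h = g at hlen hl' ⊢
    have hg : g.length < n := by omega
    obtain rfl : x = ⟨g.length, hg⟩ := Fin.ext hlen.symm
    have e2 : τ.complete g = σ.complete (g ++ [τ g]) := by
      rw [τ.complete_eq hg]
      exact Profile.steps_congr fun h' h1 _ => hne h' (by simp at h1 ⊢; omega)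
    rw [e2]
    exact (optimalProfile_spec G rule ε hg).2 _ (hτ g hg hl')

theorem achievable_eq_singleton [NeZero n] {w : Fin n}
    (hw : ∀ σ, G.IsSPE rule ε σ → σ.outcome [] = w) : G.achievable rule ε = {w} := by
  ext v
  simp only [achievable, Set.mem_ofPred_eq, isWinner_iff, Set.mem_singleton_iff]
  constructor
  · rintro ⟨σ, h1, rfl⟩; exact hw σ h1
  · rintro rfl
    exact ⟨_, G.isSPE_optimalProfile rule ε, hw _ (G.isSPE_optimalProfile rule ε)⟩

theorem additiveGap_of_achievable {w : Fin n} (hw : G.achievable rule ε = {w}) :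
    G.additiveGap rule ε = G.agentGap w := by
  simp [additiveGap, hw]

end Existence

end Network

/-! ### The network for approval voting -/

namespace ApprovalNet

/-- Agent `x` confirms agent `a`. The agents before `2 * k` confirm `2 * k` and, alternately,
`2 * k + 1` and `2 * k + 4`; from `2 * k + 6` on the agents confirm one agent each and are confirmed
by nobody. -/
def Likes (k x a : ℕ) : Prop :=
  if x < 2 * k then a = 2 * k ∨ a = if x % 2 = 0 then 2 * k + 1 else 2 * k + 4
  else if x = 2 * k then False
  else if x = 2 * k + 1 then a = 2 * k + 4
  else if x < 2 * k + 4 then a = 2 * k + 1 ∨ a = 2 * k + 4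
  else if x = 2 * k + 4 then a = 2 * k + 5
  else if x = 2 * k + 5 then a = 2 * k + 1
  else if x < 2 * k + 18 then a = 2 * k
  else if x < 4 * k + 27 then a = 2 * k + 1
  else if x < 6 * k + 35 then a = 2 * k + 4
  else a = 2 * k + 5

instance (k x a : ℕ) : Decidable (Likes k x a) := by unfold Likes; infer_instance

theorem likes_even {k x a : ℕ} (hx : x < 2 * k) (h2 : x % 2 = 0) :
    Likes k x a ↔ a = 2 * k ∨ a = 2 * k + 1 := by
  rw [Likes, if_pos hx, if_pos h2]

theorem likes_odd {k x a : ℕ} (hx : x < 2 * k) (h2 : x % 2 = 1) :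
    Likes k x a ↔ a = 2 * k ∨ a = 2 * k + 4 := by
  rw [Likes, if_pos hx, if_neg (by omega)]

theorem likes_mid {k x a : ℕ} (hx : 2 * k + 2 ≤ x) (hx' : x < 2 * k + 4) :
    Likes k x a ↔ a = 2 * k + 1 ∨ a = 2 * k + 4 := by
  rw [Likes, if_neg (by omega), if_neg (by omega), if_neg (by omega), if_pos (by omega)]

theorem likes_dummy_ww {k x a : ℕ} (hx : 2 * k + 6 ≤ x) (hx' : x < 2 * k + 18) :
    Likes k x a ↔ a = 2 * k := by
  rw [Likes, if_neg (by omega), if_neg (by omega), if_neg (by omega), if_neg (by omega),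
    if_neg (by omega), if_neg (by omega), if_pos (by omega)]

theorem likes_dummy_v₁ {k x a : ℕ} (hx : 2 * k + 18 ≤ x) (hx' : x < 4 * k + 27) :
    Likes k x a ↔ a = 2 * k + 1 := by
  rw [Likes, if_neg (by omega), if_neg (by omega), if_neg (by omega), if_neg (by omega),
    if_neg (by omega), if_neg (by omega), if_neg (by omega), if_pos (by omega)]

theorem likes_dummy_v₂ {k x a : ℕ} (hx : 4 * k + 27 ≤ x) (hx' : x < 6 * k + 35) :
    Likes k x a ↔ a = 2 * k + 4 := by
  rw [Likes, if_neg (by omega), if_neg (by omega), if_neg (by omega), if_neg (by omega),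
    if_neg (by omega), if_neg (by omega), if_neg (by omega), if_neg (by omega), if_pos (by omega)]

theorem likes_dummy_v₃ {k x a : ℕ} (hx : 6 * k + 35 ≤ x) :
    Likes k x a ↔ a = 2 * k + 5 := by
  rw [Likes, if_neg (by omega), if_neg (by omega), if_neg (by omega), if_neg (by omega),
    if_neg (by omega), if_neg (by omega), if_neg (by omega), if_neg (by omega), if_neg (by omega)]

theorem not_likes_ww {k a : ℕ} : ¬ Likes k (2 * k) a := by
  rw [Likes, if_neg (by omega), if_pos rfl]
  exact id

theorem likes_v₁ {k a : ℕ} : Likes k (2 * k + 1) a ↔ a = 2 * k + 4 := by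
  rw [Likes, if_neg (by omega), if_neg (by omega), if_pos rfl]

theorem likes_v₂ {k a : ℕ} : Likes k (2 * k + 4) a ↔ a = 2 * k + 5 := by
  rw [Likes, if_neg (by omega), if_neg (by omega), if_neg (by omega), if_neg (by omega),
    if_pos rfl]

theorem likes_v₃ {k a : ℕ} : Likes k (2 * k + 5) a ↔ a = 2 * k + 1 := by
  rw [Likes, if_neg (by omega), if_neg (by omega), if_neg (by omega), if_neg (by omega),
    if_neg (by omega), if_pos rfl]

/-- The network in which the cooperation of `k` pairs of voters elects an unpopular agent. -/
def net (k : ℕ) : Network (8 * k + 46) where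
  out x := Finset.univ.filter fun a => Likes k x a
  not_mem_self x := by
    intro hx
    have h := (Finset.mem_filter.mp hx).2
    generalize (x : ℕ) = x at h
    unfold Likes at h
    split_ifs at h <;> omega

theorem mem_out {k : ℕ} {x a : Fin (8 * k + 46)} : a ∈ (net k).out x ↔ Likes k x a := by
  simp [net]

/-- The agent that is going to be elected. -/
def ww (k : ℕ) : Fin (8 * k + 46) := ⟨2 * k, by omega⟩
/-- The most popular agent. -/
def v₁ (k : ℕ) : Fin (8 * k + 46) := ⟨2 * k + 1, by omega⟩
/-- The second most popular agent. -/
def v₂ (k : ℕ) : Fin (8 * k + 46) := ⟨2 * k + 4, by omega⟩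
/-- The agent who can be elected only through the support of `v₂`. -/
def v₃ (k : ℕ) : Fin (8 * k + 46) := ⟨2 * k + 5, by omega⟩

theorem vals (k : ℕ) : (ww k : ℕ) = 2 * k ∧ (v₁ k : ℕ) = 2 * k + 1 ∧ (v₂ k : ℕ) = 2 * k + 4 ∧
    (v₃ k : ℕ) = 2 * k + 5 := ⟨rfl, rfl, rfl, rfl⟩

theorem ne_cands (k : ℕ) : ww k ≠ v₁ k ∧ ww k ≠ v₂ k ∧ ww k ≠ v₃ k ∧ v₁ k ≠ v₂ k ∧ v₁ k ≠ v₃ k ∧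
    v₂ k ≠ v₃ k := by
  simp only [ww, v₁, v₂, v₃, ne_eq, Fin.mk.injEq]
  omega

variable {k : ℕ} {x : Fin (8 * k + 46)}

theorem out_even (hx : (x : ℕ) < 2 * k) (h2 : (x : ℕ) % 2 = 0) : (net k).out x = {ww k, v₁ k} := by
  ext a
  rw [mem_out, likes_even hx h2]
  simp [ww, v₁, Fin.ext_iff]

theorem out_odd (hx : (x : ℕ) < 2 * k) (h2 : (x : ℕ) % 2 = 1) : (net k).out x = {ww k, v₂ k} := by
  ext a
  rw [mem_out, likes_odd hx h2]
  simp [ww, v₂, Fin.ext_iff]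

theorem out_mid (hx : 2 * k + 2 ≤ (x : ℕ)) (hx' : (x : ℕ) < 2 * k + 4) :
    (net k).out x = {v₁ k, v₂ k} := by
  ext a
  rw [mem_out, likes_mid hx hx']
  simp [v₁, v₂, Fin.ext_iff]

theorem out_ww (k : ℕ) : (net k).out (ww k) = ∅ := by
  ext a
  rw [mem_out, (vals k).1]
  simp [not_likes_ww]

theorem out_v₁ (k : ℕ) : (net k).out (v₁ k) = {v₂ k} := by
  ext a
  rw [mem_out, (vals k).2.1, likes_v₁]
  simp [v₂, Fin.ext_iff]

theorem out_v₂ (k : ℕ) : (net k).out (v₂ k) = {v₃ k} := by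
  ext a
  rw [mem_out, (vals k).2.2.1, likes_v₂]
  simp [v₃, Fin.ext_iff]

theorem out_v₃ (k : ℕ) : (net k).out (v₃ k) = {v₁ k} := by
  ext a
  rw [mem_out, (vals k).2.2.2, likes_v₃]
  simp [v₁, Fin.ext_iff]

theorem out_dummy (hx : 2 * k + 6 ≤ (x : ℕ)) :
    ((x : ℕ) < 2 * k + 18 ∧ (net k).out x = {ww k}) ∨
    (2 * k + 18 ≤ (x : ℕ) ∧ (x : ℕ) < 4 * k + 27 ∧ (net k).out x = {v₁ k}) ∨
    (4 * k + 27 ≤ (x : ℕ) ∧ (x : ℕ) < 6 * k + 35 ∧ (net k).out x = {v₂ k}) ∨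
    (6 * k + 35 ≤ (x : ℕ) ∧ (net k).out x = {v₃ k}) := by
  rcases lt_or_ge (x : ℕ) (2 * k + 18) with h | h
  · refine Or.inl ⟨h, ?_⟩
    ext a; rw [mem_out, likes_dummy_ww hx h]; simp [ww, Fin.ext_iff]
  rcases lt_or_ge (x : ℕ) (4 * k + 27) with h' | h'
  · refine Or.inr (Or.inl ⟨h, h', ?_⟩)
    ext a; rw [mem_out, likes_dummy_v₁ h h']; simp [v₁, Fin.ext_iff]
  rcases lt_or_ge (x : ℕ) (6 * k + 35) with h3 | h3
  · refine Or.inr (Or.inr (Or.inl ⟨h', h3, ?_⟩))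
    ext a; rw [mem_out, likes_dummy_v₂ h' h3]; simp [v₂, Fin.ext_iff]
  · refine Or.inr (Or.inr (Or.inr ⟨h3, ?_⟩))
    ext a; rw [mem_out, likes_dummy_v₃ h3]; simp [v₃, Fin.ext_iff]

theorem out_cases (x : Fin (8 * k + 46)) :
    ((x : ℕ) < 2 * k ∧ (x : ℕ) % 2 = 0 ∧ (net k).out x = {ww k, v₁ k}) ∨
    ((x : ℕ) < 2 * k ∧ (x : ℕ) % 2 = 1 ∧ (net k).out x = {ww k, v₂ k}) ∨
    (x = ww k ∧ (net k).out x = ∅) ∨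
    (x = v₁ k ∧ (net k).out x = {v₂ k}) ∨
    (2 * k + 2 ≤ (x : ℕ) ∧ (x : ℕ) < 2 * k + 4 ∧ (net k).out x = {v₁ k, v₂ k}) ∨
    (x = v₂ k ∧ (net k).out x = {v₃ k}) ∨
    (x = v₃ k ∧ (net k).out x = {v₁ k}) ∨
    (2 * k + 6 ≤ (x : ℕ)) := by
  obtain ⟨w0, w1, w2, w3⟩ := vals k
  rcases lt_or_ge (x : ℕ) (2 * k) with h1 | h1
  · rcases Nat.mod_two_eq_zero_or_one x with h2 | h2
    · exact Or.inl ⟨h1, h2, out_even h1 h2⟩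
    · exact Or.inr (Or.inl ⟨h1, h2, out_odd h1 h2⟩)
  right; right
  by_cases e0 : x = ww k
  · exact Or.inl ⟨e0, e0 ▸ out_ww k⟩
  by_cases e1 : x = v₁ k
  · exact Or.inr (Or.inl ⟨e1, e1 ▸ out_v₁ k⟩)
  right; right
  rw [Fin.ext_iff] at e0 e1
  rcases lt_or_ge (x : ℕ) (2 * k + 4) with h4 | h4
  · exact Or.inl ⟨by omega, h4, out_mid (by omega) h4⟩
  by_cases e2 : x = v₂ k
  · exact Or.inr (Or.inl ⟨e2, e2 ▸ out_v₂ k⟩)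
  by_cases e3 : x = v₃ k
  · exact Or.inr (Or.inr (Or.inl ⟨e3, e3 ▸ out_v₃ k⟩))
  rw [Fin.ext_iff] at e2 e3
  omega

theorem likersFrom_dummies (k : ℕ) :
    (net k).likersFrom (2 * k + 6) (ww k) = 12 ∧
    (net k).likersFrom (2 * k + 6) (v₁ k) = 2 * k + 9 ∧
    (net k).likersFrom (2 * k + 6) (v₂ k) = 2 * k + 8 ∧
    (net k).likersFrom (2 * k + 6) (v₃ k) = 2 * k + 11 := by
  obtain ⟨n1, n2, n3, n4, n5, n6⟩ := ne_cands k
  have key : ∀ (a : Fin (8 * k + 46)) (lo hi : ℕ), hi ≤ 8 * k + 46 → 2 * k + 6 ≤ lo →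
      (∀ x : Fin (8 * k + 46), 2 * k + 6 ≤ (x : ℕ) → (a ∈ (net k).out x ↔ lo ≤ x ∧ x < hi)) →
      (net k).likersFrom (2 * k + 6) a = hi - lo := fun a lo hi h1 h2 h3 => by
    refine Network.card_filter_of_iff h1 fun x => ?_
    constructor
    · rintro ⟨h, h'⟩; exact (h3 x h).mp h'
    · intro h; exact ⟨by omega, (h3 x (by omega)).mpr h⟩
  refine ⟨?_, ?_, ?_, ?_⟩
  · rw [key _ (2 * k + 6) (2 * k + 18) (by omega) (by omega)]
    · omega
    · intro x hx
      rcases out_dummy hx with ⟨h, e⟩ | ⟨h, h', e⟩ | ⟨h, h', e⟩ | ⟨h, e⟩ <;> simp [e, *] <;> omega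
  · rw [key _ (2 * k + 18) (4 * k + 27) (by omega) (by omega)]
    · omega
    · intro x hx
      rcases out_dummy hx with ⟨h, e⟩ | ⟨h, h', e⟩ | ⟨h, h', e⟩ | ⟨h, e⟩ <;>
        simp [e, n1.symm, *] <;> omega
  · rw [key _ (4 * k + 27) (6 * k + 35) (by omega) (by omega)]
    · omega
    · intro x hx
      rcases out_dummy hx with ⟨h, e⟩ | ⟨h, h', e⟩ | ⟨h, h', e⟩ | ⟨h, e⟩ <;>
        simp [e, n2.symm, n4.symm, *] <;> omega
  · rw [key _ (6 * k + 35) (8 * k + 46) (by omega) (by omega)]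
    · omega
    · intro x hx
      rcases out_dummy hx with ⟨h, e⟩ | ⟨h, h', e⟩ | ⟨h, h', e⟩ | ⟨h, e⟩ <;>
        simp [e, n3.symm, n5.symm, n6.symm, *] <;> omega

theorem likersFrom_ww (k : ℕ) :
    (net k).likersFrom (2 * k) (ww k) = 12 ∧
    (net k).likersFrom (2 * k) (v₁ k) = 2 * k + 12 ∧
    (net k).likersFrom (2 * k) (v₂ k) = 2 * k + 11 ∧
    (net k).likersFrom (2 * k) (v₃ k) = 2 * k + 12 := by
  obtain ⟨h0, h1, h2, h3⟩ := likersFrom_dummies k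
  obtain ⟨n1, n2, n3, n4, n5, n6⟩ := ne_cands k
  have a1 (a) := (net k).likersFrom_eq (ww k) a
  have a2 (a) := (net k).likersFrom_eq (v₁ k) a
  have a3 (a) := (net k).likersFrom_eq ⟨2 * k + 2, by omega⟩ a
  have a4 (a) := (net k).likersFrom_eq ⟨2 * k + 3, by omega⟩ a
  have a5 (a) := (net k).likersFrom_eq (v₂ k) a
  have a6 (a) := (net k).likersFrom_eq (v₃ k) a
  rw [out_mid (by simp) (by simp)] at a3 a4
  simp only [out_ww, out_v₁, out_v₂, out_v₃, vals, Nat.add_assoc, Nat.reduceAdd]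
    at a1 a2 a3 a4 a5 a6
  simp only [a1, a2, a3, a4, a5, a6, h0, h1, h2, h3, Finset.notMem_empty, Finset.mem_insert,
    Finset.mem_singleton, n1, n2, n3, n4, n5, n6, n1.symm, n2.symm, n3.symm, n4.symm, n5.symm,
    n6.symm]
  simp

theorem likersFrom_pairs {k j t : ℕ} (ht : t + 2 * j = 2 * k) :
    (net k).likersFrom t (ww k) = 2 * j + 12 ∧
    (net k).likersFrom t (v₁ k) = j + 2 * k + 12 ∧
    (net k).likersFrom t (v₂ k) = j + 2 * k + 11 ∧
    (net k).likersFrom t (v₃ k) = 2 * k + 12 := by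
  induction j generalizing t with
  | zero =>
    obtain rfl : t = 2 * k := by omega
    simpa using likersFrom_ww k
  | succ j ih =>
    obtain ⟨h0, h1, h2, h3⟩ := ih (t := t + 2) (by omega)
    obtain ⟨n1, n2, n3, n4, n5, n6⟩ := ne_cands k
    have a1 (a) := (net k).likersFrom_eq ⟨t, by omega⟩ a
    have a2 (a) := (net k).likersFrom_eq ⟨t + 1, by omega⟩ a
    rw [out_even (by simp; omega) (by simp; omega)] at a1
    rw [out_odd (by simp; omega) (by simp; omega)] at a2
    simp only [Nat.add_assoc, Nat.reduceAdd] at a1 a2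
    simp only [a1, a2, h0, h1, h2, h3, Finset.mem_insert, Finset.mem_singleton, n1, n2, n3, n4, n5,
      n6, n1.symm, n2.symm, n3.symm, n4.symm, n5.symm, n6.symm]
    simp
    omega

theorem popularity_eq (k : ℕ) :
    (net k).popularity (ww k) = 2 * k + 12 ∧ (net k).popularity (v₁ k) = 3 * k + 12 ∧
    (net k).popularity (v₂ k) = 3 * k + 11 ∧ (net k).popularity (v₃ k) = 2 * k + 12 := by
  have := likersFrom_pairs (k := k) (j := k) (t := 0) (by omega)
  simp only [Network.likersFrom_zero] at this
  omega

theorem popularity_of_ne {k : ℕ} {a : Fin (8 * k + 46)} (h0 : a ≠ ww k) (h1 : a ≠ v₁ k)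
    (h2 : a ≠ v₂ k) (h3 : a ≠ v₃ k) : (net k).popularity a = 0 := by
  rw [Network.popularity, Finset.card_eq_zero, Finset.filter_eq_empty_iff]
  intro x _
  rcases out_cases x with ⟨-, -, e⟩ | ⟨-, -, e⟩ | ⟨-, e⟩ | ⟨-, e⟩ | ⟨-, -, e⟩ | ⟨-, e⟩ | ⟨-, e⟩ | hx
  all_goals try simp [e, h0, h1, h2, h3]
  rcases out_dummy hx with ⟨-, e⟩ | ⟨-, -, e⟩ | ⟨-, -, e⟩ | ⟨-, e⟩ <;> simp [e, h0, h1, h2, h3]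

theorem maxIn_eq {k : ℕ} : (net k).maxIn = 3 * k + 12 := by
  obtain ⟨h0, h1, h2, h3⟩ := popularity_eq k
  refine le_antisymm (Finset.sup_le fun a _ => ?_) ?_
  · by_cases e0 : a = ww k
    · subst e0; omega
    by_cases e1 : a = v₁ k
    · subst e1; omega
    by_cases e2 : a = v₂ k
    · subst e2; omega
    by_cases e3 : a = v₃ k
    · subst e3; omega
    · rw [popularity_of_ne e0 e1 e2 e3]; omega
  · rw [← h1]; exact Finset.le_sup (f := (net k).popularity) (Finset.mem_univ (v₁ k))

theorem removeOut_ww (k : ℕ) : (net k).removeOut (ww k) = net k := by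
  have h : ((net k).removeOut (ww k)).out = (net k).out := by
    funext x
    simp only [Network.removeOut]
    split_ifs with hx
    · rw [hx, out_ww]
    · rfl
  generalize (net k).removeOut (ww k) = G at h
  generalize net k = G' at h
  cases G
  cases G'
  simp only at h
  subst h
  rfl

theorem agentGap_ww (k : ℕ) : (net k).agentGap (ww k) = k := by
  rw [Network.agentGap, removeOut_ww, maxIn_eq, (popularity_eq k).1]
  push_cast
  ring

theorem card_out_le {k : ℕ} (x : Fin (8 * k + 46)) : ((net k).out x).card ≤ 2 := by
  rcases out_cases x with ⟨-, -, e⟩ | ⟨-, -, e⟩ | ⟨-, e⟩ | ⟨-, e⟩ | ⟨-, -, e⟩ | ⟨-, e⟩ | ⟨-, e⟩ | hx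
  · rw [e]; exact Finset.card_le_two
  · rw [e]; exact Finset.card_le_two
  · simp [e]
  · simp [e]
  · rw [e]; exact Finset.card_le_two
  · simp [e]
  · simp [e]
  · rcases out_dummy hx with ⟨-, e⟩ | ⟨-, -, e⟩ | ⟨-, -, e⟩ | ⟨-, e⟩ <;> simp [e]

theorem maxOut_eq (k : ℕ) : (net k).maxOut = 2 := by
  refine le_antisymm (Finset.sup_le fun x _ => card_out_le x) ?_
  have h : (net k).out ⟨2 * k + 2, by omega⟩ = {v₁ k, v₂ k} := out_mid le_rfl (by simp)
  have hc : ((net k).out ⟨2 * k + 2, by omega⟩).card = 2 := by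
    rw [h, Finset.card_pair (ne_cands k).2.2.2.1]
  rw [← hc]
  exact Finset.le_sup (f := fun x => ((net k).out x).card) (Finset.mem_univ _)

end ApprovalNet

/-- The number of votes, zero or one, that a ballot gives to `a`. -/
def vote {n : ℕ} (B : Ballot n) (a : Fin n) : ℕ := if a ∈ B then 1 else 0

theorem vote_le_one {n : ℕ} (B : Ballot n) (a : Fin n) : vote B a ≤ 1 := by
  unfold vote; split_ifs <;> simp

theorem vote_of_mem {n : ℕ} {B : Ballot n} {a : Fin n} (h : a ∈ B) : vote B a = 1 := if_pos h

theorem vote_of_not_mem {n : ℕ} {B : Ballot n} {a : Fin n} (h : a ∉ B) : vote B a = 0 := if_neg h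

theorem score_append_vote {n : ℕ} (h : List (Ballot n)) (B : Ballot n) (a : Fin n) :
    score (h ++ [B]) a = score h a + vote B a := score_append h B a

namespace ApprovalNet

variable {k : ℕ} {h : List (Ballot (8 * k + 46))} {σ : Profile (8 * k + 46)} {ε : ℝ}

/-! #### The effect of a ballot on the potentials -/

theorem step_even (hx : h.length < 2 * k) (h2 : h.length % 2 = 0) (B : Ballot (8 * k + 46)) :
    (net k).potential (h ++ [B]) (ww k) + 1 = (net k).potential h (ww k) + vote B (ww k) ∧
    (net k).potential (h ++ [B]) (v₁ k) + 1 = (net k).potential h (v₁ k) + vote B (v₁ k) ∧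
    (net k).potential (h ++ [B]) (v₂ k) = (net k).potential h (v₂ k) + vote B (v₂ k) ∧
    (net k).potential (h ++ [B]) (v₃ k) = (net k).potential h (v₃ k) + vote B (v₃ k) := by
  obtain ⟨n1, n2, n3, n4, n5, n6⟩ := ne_cands k
  have key (a) := (net k).potential_append (h := h) (x := ⟨h.length, by omega⟩) rfl B a
  rw [out_even hx h2] at key
  have e0 := key (ww k)
  have e1 := key (v₁ k)
  have e2 := key (v₂ k)
  have e3 := key (v₃ k)
  simp [n1, n2, n3, n4, n5, n6, n1.symm, n2.symm, n3.symm, n4.symm, n5.symm, n6.symm]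
    at e0 e1 e2 e3
  exact ⟨e0, e1, e2, e3⟩

theorem step_odd (hx : h.length < 2 * k) (h2 : h.length % 2 = 1) (B : Ballot (8 * k + 46)) :
    (net k).potential (h ++ [B]) (ww k) + 1 = (net k).potential h (ww k) + vote B (ww k) ∧
    (net k).potential (h ++ [B]) (v₁ k) = (net k).potential h (v₁ k) + vote B (v₁ k) ∧
    (net k).potential (h ++ [B]) (v₂ k) + 1 = (net k).potential h (v₂ k) + vote B (v₂ k) ∧
    (net k).potential (h ++ [B]) (v₃ k) = (net k).potential h (v₃ k) + vote B (v₃ k) := by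
  obtain ⟨n1, n2, n3, n4, n5, n6⟩ := ne_cands k
  have key (a) := (net k).potential_append (h := h) (x := ⟨h.length, by omega⟩) rfl B a
  rw [out_odd hx h2] at key
  have e0 := key (ww k)
  have e1 := key (v₁ k)
  have e2 := key (v₂ k)
  have e3 := key (v₃ k)
  simp [n1, n2, n3, n4, n5, n6, n1.symm, n2.symm, n3.symm, n4.symm, n5.symm, n6.symm]
    at e0 e1 e2 e3
  exact ⟨e0, e1, e2, e3⟩

theorem step_v₁ (hx : h.length = v₁ k) (B : Ballot (8 * k + 46)) :
    (net k).potential (h ++ [B]) (ww k) = (net k).potential h (ww k) + vote B (ww k) ∧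
    (net k).potential (h ++ [B]) (v₁ k) = (net k).potential h (v₁ k) + vote B (v₁ k) ∧
    (net k).potential (h ++ [B]) (v₂ k) + 1 = (net k).potential h (v₂ k) + vote B (v₂ k) ∧
    (net k).potential (h ++ [B]) (v₃ k) = (net k).potential h (v₃ k) + vote B (v₃ k) := by
  obtain ⟨n1, n2, n3, n4, n5, n6⟩ := ne_cands k
  have key (a) := (net k).potential_append hx B a
  rw [out_v₁] at key
  have e0 := key (ww k)
  have e1 := key (v₁ k)
  have e2 := key (v₂ k)
  have e3 := key (v₃ k)
  simp [n1, n2, n3, n4, n5, n6, n1.symm, n2.symm, n3.symm, n4.symm, n5.symm, n6.symm]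
    at e0 e1 e2 e3
  exact ⟨e0, e1, e2, e3⟩

theorem step_mid (hx : 2 * k + 2 ≤ h.length) (hx' : h.length < 2 * k + 4)
    (B : Ballot (8 * k + 46)) :
    (net k).potential (h ++ [B]) (ww k) = (net k).potential h (ww k) + vote B (ww k) ∧
    (net k).potential (h ++ [B]) (v₁ k) + 1 = (net k).potential h (v₁ k) + vote B (v₁ k) ∧
    (net k).potential (h ++ [B]) (v₂ k) + 1 = (net k).potential h (v₂ k) + vote B (v₂ k) ∧
    (net k).potential (h ++ [B]) (v₃ k) = (net k).potential h (v₃ k) + vote B (v₃ k) := by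
  obtain ⟨n1, n2, n3, n4, n5, n6⟩ := ne_cands k
  have key (a) := (net k).potential_append (h := h) (x := ⟨h.length, by omega⟩) rfl B a
  rw [out_mid hx hx'] at key
  have e0 := key (ww k)
  have e1 := key (v₁ k)
  have e2 := key (v₂ k)
  have e3 := key (v₃ k)
  simp [n1, n2, n3, n4, n5, n6, n1.symm, n2.symm, n3.symm, n4.symm, n5.symm, n6.symm]
    at e0 e1 e2 e3
  exact ⟨e0, e1, e2, e3⟩

theorem step_v₂ (hx : h.length = v₂ k) (B : Ballot (8 * k + 46)) :
    (net k).potential (h ++ [B]) (v₁ k) = (net k).potential h (v₁ k) + vote B (v₁ k) ∧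
    (net k).potential (h ++ [B]) (v₂ k) = (net k).potential h (v₂ k) + vote B (v₂ k) := by
  obtain ⟨n1, n2, n3, n4, n5, n6⟩ := ne_cands k
  have key (a) := (net k).potential_append hx B a
  rw [out_v₂] at key
  have e1 := key (v₁ k)
  have e2 := key (v₂ k)
  simp [n5, n6] at e1 e2
  exact ⟨e1, e2⟩

theorem step_v₃ (hx : h.length = v₃ k) (B : Ballot (8 * k + 46)) :
    (net k).potential (h ++ [B]) (ww k) = (net k).potential h (ww k) + vote B (ww k) ∧
    (net k).potential (h ++ [B]) (v₁ k) + 1 = (net k).potential h (v₁ k) + vote B (v₁ k) ∧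
    (net k).potential (h ++ [B]) (v₂ k) = (net k).potential h (v₂ k) + vote B (v₂ k) ∧
    (net k).potential (h ++ [B]) (v₃ k) = (net k).potential h (v₃ k) + vote B (v₃ k) := by
  obtain ⟨n1, n2, n3, n4, n5, n6⟩ := ne_cands k
  have key (a) := (net k).potential_append hx B a
  rw [out_v₃] at key
  have e0 := key (ww k)
  have e1 := key (v₁ k)
  have e2 := key (v₂ k)
  have e3 := key (v₃ k)
  simp [n1, n2, n3, n4, n5, n6, n1.symm, n2.symm, n3.symm, n4.symm, n5.symm, n6.symm]
    at e0 e1 e2 e3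
  exact ⟨e0, e1, e2, e3⟩

/-! #### Agents who cannot be elected -/

theorem outcome_ne_v₃ (hσ : (net k).IsSPE .approval ε σ) (hε : 0 < ε)
    (hl : VotingRule.approval.LegalHistory h)
    (hp : (net k).potential h (v₃ k) ≤ (net k).potential h (v₂ k)) :
    σ.outcome h ≠ v₃ k := by
  intro hv
  obtain ⟨n1, n2, n3, n4, n5, n6⟩ := ne_cands k
  have h1 := hσ.score_add_le_approval hε hl hv (a := v₂ k) le_rfl ∅ (by
    intro x _ hx _
    rcases out_cases x with ⟨h1, -, e⟩ | ⟨h1, -, e⟩ | ⟨h1, e⟩ | ⟨h1, e⟩ | ⟨h1, h2, e⟩ | ⟨h1, e⟩ |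
      ⟨h1, e⟩ | h1
    all_goals try
      simp [e, n1, n2, n3, n4, n5, n6, n1.symm, n2.symm, n3.symm, n4.symm, n5.symm, n6.symm] at hx ⊢
    · rintro rfl; simp [v₃] at h1
    · rw [h1]; exact n5
    · rintro rfl; simp [v₃] at h2
    · refine ⟨by rintro rfl; simp [v₃] at h1, ?_⟩
      rcases out_dummy h1 with ⟨-, e⟩ | ⟨-, -, e⟩ | ⟨-, -, e⟩ | ⟨-, e⟩ <;> rw [e] at hx ⊢ <;>
      simp [n1, n2, n3, n4, n5, n6, n1.symm, n2.symm, n3.symm, n4.symm, n5.symm, n6.symm] at hx ⊢)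
  rw [if_pos (by simp [v₂, v₃])] at h1
  simp only [Finset.card_empty] at h1
  unfold Network.potential at *
  omega

theorem outcome_ne_v₂ (hσ : (net k).IsSPE .approval ε σ) (hε : 0 < ε)
    (hl : VotingRule.approval.LegalHistory h)
    (hp : (net k).potential h (v₂ k) + 2 ≤ (net k).potential h (v₁ k)) :
    σ.outcome h ≠ v₂ k := by
  intro hv
  obtain ⟨n1, n2, n3, n4, n5, n6⟩ := ne_cands k
  have h1 := hσ.score_add_le_approval hε hl hv (a := v₁ k) le_rfl
    {⟨2 * k + 2, by omega⟩, ⟨2 * k + 3, by omega⟩} (by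
    intro x _ hx hs
    rcases out_cases x with ⟨h1, -, e⟩ | ⟨h1, -, e⟩ | ⟨h1, e⟩ | ⟨h1, e⟩ | ⟨h1, h2, e⟩ | ⟨h1, e⟩ |
      ⟨h1, e⟩ | h1
    all_goals try
      simp [e, n1, n2, n3, n4, n5, n6, n1.symm, n2.symm, n3.symm, n4.symm, n5.symm, n6.symm] at hx ⊢
    · rintro rfl; simp [v₂] at h1
    · simp [Fin.ext_iff] at hs; omega
    · rw [h1]; exact n6.symm
    · refine ⟨by rintro rfl; simp [v₂] at h1, ?_⟩
      rcases out_dummy h1 with ⟨-, e⟩ | ⟨-, -, e⟩ | ⟨-, -, e⟩ | ⟨-, e⟩ <;> rw [e] at hx ⊢ <;>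
      simp [n1, n2, n3, n4, n5, n6, n1.symm, n2.symm, n3.symm, n4.symm, n5.symm, n6.symm] at hx ⊢)
  rw [if_pos (by simp [v₁, v₂])] at h1
  have := Finset.card_le_two (a := (⟨2 * k + 2, by omega⟩ : Fin (8 * k + 46)))
    (b := ⟨2 * k + 3, by omega⟩)
  unfold Network.potential at *
  omega

/-- If `ww` is elected, he is not behind an agent `v₁` or `v₂`, where the supporters before `2 * k`
may be unreliable. -/
theorem score_add_le_of_outcome_eq_ww (hσ : (net k).IsSPE .approval ε σ) (hε : 0 < ε)
    (hl : VotingRule.approval.LegalHistory h) {t : ℕ} (hv : σ.outcome h = ww k) (ht : h.length ≤ t)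
    (ht' : 2 * k ≤ t) {a : Fin (8 * k + 46)} (ha : a ≠ ww k) :
    score h a + (net k).likersFrom t a ≤ (net k).potential h (ww k) := by
  have h1 := hσ.score_add_le_approval hε hl hv (a := a) ht ∅ (by
    intro x htx hx _
    rcases out_cases x with ⟨h1, -, e⟩ | ⟨h1, -, e⟩ | ⟨h1, e⟩ | ⟨h1, e⟩ | ⟨h1, h2, e⟩ | ⟨h1, e⟩ |
      ⟨h1, e⟩ | h1
    · omega
    · omega
    · simp [e] at hx
    · rw [e, h1]; simp [ne_cands k, (ne_cands k).1.symm]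
    · rw [e]; simp [ne_cands k]; rintro rfl; simp [ww] at h1
    · rw [e, h1]; simp [ne_cands k, (ne_cands k).2.1.symm]
    · rw [e, h1]; simp [ne_cands k, (ne_cands k).2.2.1.symm]
    · refine ⟨by rintro rfl; simp [ww] at h1, ?_⟩
      rcases out_dummy h1 with ⟨-, e⟩ | ⟨-, -, e⟩ | ⟨-, -, e⟩ | ⟨-, e⟩ <;> rw [e] at hx ⊢ <;>
      simp [ne_cands k] at hx ⊢
      exact ha hx)
  simp only [Finset.card_empty] at h1
  omega

theorem outcome_ne_ww_of_score (hσ : (net k).IsSPE .approval ε σ) (hε : 0 < ε)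
    (hl : VotingRule.approval.LegalHistory h) (ht : h.length ≤ 2 * k)
    (hp : (net k).potential h (ww k) < score h (v₁ k) + (2 * k + 12)) : σ.outcome h ≠ ww k := by
  intro hv
  have := score_add_le_of_outcome_eq_ww hσ hε hl hv ht le_rfl (ne_cands k).1.symm
  rw [(likersFrom_ww k).2.1] at this
  omega

theorem outcome_ne_ww (hσ : (net k).IsSPE .approval ε σ) (hε : 0 < ε)
    (hl : VotingRule.approval.LegalHistory h) (ht : 2 * k ≤ h.length) {a : Fin (8 * k + 46)}
    (hp : (net k).potential h (ww k) < (net k).potential h a) : σ.outcome h ≠ ww k := by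
  intro hv
  have := score_add_le_of_outcome_eq_ww hσ hε hl hv le_rfl ht (a := a)
    (by rintro rfl; exact lt_irrefl _ hp)
  unfold Network.potential at hp this
  omega

theorem outcome_ne_of_le_ww (hσ : (net k).IsSPE .approval ε σ) (hε : 0 < ε)
    (hl : VotingRule.approval.LegalHistory h)
    (ht : 2 * k ≤ h.length) {a : Fin (8 * k + 46)} (ha : ww k < a)
    (hp : (net k).potential h a ≤ (net k).potential h (ww k)) (ha' : (a : ℕ) < 2 * k + 6) :
    σ.outcome h ≠ a := by
  intro hv
  have h1 := hσ.score_add_le_approval hε hl hv (a := ww k) le_rfl ∅ (by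
    intro x htx hx _
    rcases out_cases x with ⟨h1, -, e⟩ | ⟨h1, -, e⟩ | ⟨h1, e⟩ | ⟨h1, e⟩ | ⟨h1, h2, e⟩ | ⟨h1, e⟩ |
      ⟨h1, e⟩ | h1
    · omega
    · omega
    all_goals try (simp [e, ne_cands k] at hx)
    refine ⟨by rintro rfl; omega, ?_⟩
    rcases out_dummy h1 with ⟨-, e⟩ | ⟨-, -, e⟩ | ⟨-, -, e⟩ | ⟨-, e⟩ <;> rw [e] at hx ⊢ <;>
    simp [ne_cands k] at hx ⊢
    exact ne_of_gt ha)
  rw [if_pos ha] at h1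
  simp only [Finset.card_empty] at h1
  unfold Network.potential at *
  omega

theorem outcome_cases (hσ : (net k).IsSPE .approval ε σ) (hε : 0 < ε)
    (hl : VotingRule.approval.LegalHistory h) (ht : h.length ≤ 2 * k + 6) :
    σ.outcome h = ww k ∨ σ.outcome h = v₁ k ∨ σ.outcome h = v₂ k ∨ σ.outcome h = v₃ k := by
  by_contra hc
  push Not at hc
  obtain ⟨c0, c1, c2, c3⟩ := hc
  have h1 := hσ.score_add_le_approval hε hl rfl (a := v₁ k) ht {σ.outcome h} (by
    intro x htx hx hs
    refine ⟨by simpa using hs, ?_⟩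
    rcases out_dummy htx with ⟨-, e⟩ | ⟨-, -, e⟩ | ⟨-, -, e⟩ | ⟨-, e⟩ <;> rw [e] <;> simpa)
  rw [(likersFrom_dummies k).2.1, Finset.card_singleton, Network.potential] at h1
  have h2 := score_le_length h (σ.outcome h)
  have h3 : (net k).likersFrom h.length (σ.outcome h) = 0 := by
    have := popularity_of_ne c0 c1 c2 c3
    rw [← Network.likersFrom_zero] at this
    refine Nat.eq_zero_of_le_zero (this ▸ Finset.card_le_card fun x hx => ?_)
    simp only [Finset.mem_filter] at hx ⊢
    exact ⟨hx.1, Nat.zero_le _, hx.2.2⟩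
  omega

theorem potential_le_of_dummies (hσ : (net k).IsSPE .approval ε σ) (hε : 0 < ε)
    (hl : VotingRule.approval.LegalHistory h) (ht : h.length = 2 * k + 6) {a v : Fin (8 * k + 46)}
    (hv : σ.outcome h = v) (hv' : (v : ℕ) < 2 * k + 6) (hav : a ≠ v) :
    (net k).potential h a + (if a < v then 1 else 0) ≤ (net k).potential h v := by
  have h1 := hσ.score_add_le_approval hε hl hv (a := a) le_rfl ∅ (by
    intro x htx hx _
    refine ⟨by rintro rfl; omega, ?_⟩
    rcases out_dummy (ht ▸ htx) with ⟨-, e⟩ | ⟨-, -, e⟩ | ⟨-, -, e⟩ | ⟨-, e⟩ <;> rw [e] at hx ⊢ <;>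
      rw [Finset.mem_singleton] at hx ⊢ <;> exact fun e' => hav (hx.trans e'.symm))
  simpa [Network.potential] using h1

/-! #### When `v₃` is not elected -/

theorem eq_v₂_at_v₂ (hσ : (net k).IsSPE .approval ε σ) (hε : 0 < ε)
    (hn : ε < 1 / (2 * ((8 * k + 46 : ℕ) : ℝ)))
    (hl : VotingRule.approval.LegalHistory h) (hx : h.length = v₂ k)
    (h1 : (net k).potential h (v₁ k) + 1 = (net k).potential h (v₂ k))
    (h3 : (net k).potential h (v₃ k) = (net k).potential h (v₂ k) + 1)
    (h0 : (net k).potential h (ww k) < (net k).potential h (v₂ k)) : σ.outcome h = v₂ k := by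
  obtain ⟨n1, n2, n3, n4, n5, n6⟩ := ne_cands k
  obtain ⟨w0, w1, w2, w3⟩ := vals k
  refine hσ.outcome_eq_self hε hn hl hx (VotingRule.legal_empty _ _) ?_
  have hl' := hl.append_of_eq hx (VotingRule.legal_empty _ _)
  have key (a) := (net k).potential_append hx ∅ a
  rw [out_v₂] at key
  have e0 := key (ww k)
  have e1 := key (v₁ k)
  have e2 := key (v₂ k)
  have e3 := key (v₃ k)
  simp [n3, n5, n6] at e0 e1 e2 e3
  have hlen : (h ++ [∅]).length = 2 * k + 5 := by simp [hx, w2]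
  rcases outcome_cases hσ hε hl' (by omega) with e | e | e | e
  · exact absurd e (outcome_ne_ww hσ hε hl' (by omega) (a := v₂ k) (by omega))
  · have hd := hσ.score_add_le_approval hε hl' e (a := v₂ k) le_rfl ∅ (by
      intro x htx hx _
      rw [hlen] at htx
      refine ⟨by rintro rfl; omega, ?_⟩
      rcases htx.eq_or_lt with hx5 | hx5
      · obtain rfl : x = v₃ k := Fin.ext (by omega)
        rw [out_v₃] at hx
        simp [n4.symm] at hx
      · rcases out_dummy hx5 with ⟨-, e⟩ | ⟨-, -, e⟩ | ⟨-, -, e⟩ | ⟨-, e⟩ <;> rw [e] at hx ⊢ <;>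
        simp [n1, n2, n3, n4, n5, n6, n1.symm, n2.symm, n3.symm, n4.symm, n5.symm, n6.symm]
          at hx ⊢)
    rw [Finset.card_empty] at hd
    unfold Network.potential at *
    omega
  · exact e
  · exact absurd e (outcome_ne_v₃ hσ hε hl' (by omega))

theorem outcome_mem_at_mid (hσ : (net k).IsSPE .approval ε σ) (hε : 0 < ε)
    (hn : ε < 1 / (2 * ((8 * k + 46 : ℕ) : ℝ)))
    (hl : VotingRule.approval.LegalHistory h) {j : ℕ} (hj : j ≤ 2)
    (hx : h.length + j = 2 * k + 4)
    (h1 : (net k).potential h (v₁ k) + 1 = (net k).potential h (v₂ k) + j)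
    (h3 : (net k).potential h (v₃ k) = (net k).potential h (v₂ k) + 1)
    (h0 : (net k).potential h (ww k) < (net k).potential h (v₂ k)) :
    σ.outcome h = v₁ k ∨ σ.outcome h = v₂ k := by
  obtain ⟨n1, n2, n3, n4, n5, n6⟩ := ne_cands k
  obtain ⟨w0, w1, w2, w3⟩ := vals k
  induction j generalizing h with
  | zero => exact Or.inr (eq_v₂_at_v₂ hσ hε hn hl hx (by omega) h3 h0)
  | succ j ih =>
    have ho := out_mid (x := ⟨h.length, by omega⟩) (k := k) (by simp; omega) (by simp; omega)
    have hB : VotingRule.approval.Legal ⟨h.length, by omega⟩ {v₂ k} := fun hm => by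
      simp [Fin.ext_iff] at hm; omega
    obtain ⟨e0, e1, e2, e3⟩ := step_mid (h := h) (k := k) (by omega) (by omega) {v₂ k}
    simp only [vote, Finset.mem_singleton, n2, n4, n6.symm, if_true, if_false] at e0 e1 e2 e3
    have key := ih (hl.append_of_eq rfl hB) (by omega) (by simp; omega) (by omega) (by omega)
      (by omega)
    rcases hσ.outcome_mem hε hn hl rfl hB
      (by rw [ho]; simpa only [Finset.mem_insert, Finset.mem_singleton] using key) with e | e
    · rcases outcome_cases hσ hε hl (by omega) with c | c | c | c <;> rw [c] at e <;>
      rw [Fin.ext_iff] at e <;> simp only at e <;> omega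
    · rw [ho] at e
      simpa only [Finset.mem_insert, Finset.mem_singleton] using e

theorem ne_v₃_at_ww (hσ : (net k).IsSPE .approval ε σ) (hε : 0 < ε)
    (hn : ε < 1 / (2 * ((8 * k + 46 : ℕ) : ℝ)))
    (hl : VotingRule.approval.LegalHistory h) (hx : h.length = ww k)
    (h1 : (net k).potential h (v₁ k) = (net k).potential h (v₂ k) + 1)
    (h3 : (net k).potential h (v₃ k) = (net k).potential h (v₂ k) + 1)
    (h0 : (net k).potential h (ww k) < (net k).potential h (v₂ k)) : σ.outcome h ≠ v₃ k := by
  obtain ⟨n1, n2, n3, n4, n5, n6⟩ := ne_cands k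
  obtain ⟨w0, w1, w2, w3⟩ := vals k
  refine hσ.ne_of_sincere hε hl hx n3.symm (by rw [out_ww]; simp) ?_
  have hl' := hl.append_of_eq hx (Network.legal_out_approval (net k) _)
  have hx' : (h ++ [(net k).out (ww k)]).length = v₁ k := by simp [hx, w0, w1]
  refine hσ.ne_of_sincere hε hl' hx' n5.symm (by rw [out_v₁]; simpa using n6.symm) ?_
  rcases outcome_mem_at_mid hσ hε hn (j := 2)
    (hl'.append_of_eq hx' (Network.legal_out_approval (net k) _)) le_rfl (by simp [hx, w0])
    (by simp only [Network.potential_append_out _ hx', Network.potential_append_out _ hx]; omega)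
    (by simp only [Network.potential_append_out _ hx', Network.potential_append_out _ hx]; omega)
    (by simp only [Network.potential_append_out _ hx', Network.potential_append_out _ hx]; omega)
    with e | e <;> rw [e]
  · exact n5
  · exact n6

/-! #### When `v₁` is not elected -/

theorem ne_v₁_at_v₃ (hσ : (net k).IsSPE .approval ε σ) (hε : 0 < ε)
    (hn : ε < 1 / (2 * ((8 * k + 46 : ℕ) : ℝ)))
    (hl : VotingRule.approval.LegalHistory h) (hx : h.length = v₃ k)
    (hp : ((net k).potential h (v₂ k) + 1 ≤ (net k).potential h (v₁ k) ∧
        (net k).potential h (v₁ k) ≤ (net k).potential h (v₃ k)) ∨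
      (net k).potential h (v₁ k) + 1 ≤ (net k).potential h (v₃ k)) :
    σ.outcome h ≠ v₁ k := by
  obtain ⟨n1, n2, n3, n4, n5, n6⟩ := ne_cands k
  have hlen : ∀ B : Ballot (8 * k + 46), (h ++ [B]).length = 2 * k + 6 := fun B => by
    simp [hx, v₃]
  obtain ⟨w0, w1, w2, w3⟩ := vals k
  rcases lt_or_ge ((net k).potential h (v₁ k)) ((net k).potential h (v₃ k)) with h1 | h1
  · refine Network.outcome_ne_of_forall hσ hl hx fun B hB hv => ?_
    have h2 := potential_le_of_dummies hσ hε (hl.append_of_eq hx hB) (hlen B) hv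
      (by omega) n5.symm
    obtain ⟨e0, e1, e2, e3⟩ := step_v₃ hx B
    have := vote_le_one B (v₁ k)
    omega
  · rcases lt_or_ge ((net k).potential h (ww k)) ((net k).potential h (v₁ k)) with h3 | h3
    · have hl' := hl.append_of_eq hx (VotingRule.legal_empty _ _)
      obtain ⟨e0, e1, e2, e3⟩ := step_v₃ hx ∅
      simp only [vote_of_not_mem (Finset.notMem_empty _)] at e0 e1 e2 e3
      have key : σ.outcome (h ++ [∅]) = v₃ k := by
        rcases outcome_cases hσ hε hl' (hlen _).le with e | e | e | e
        · have := potential_le_of_dummies hσ hε hl' (hlen _) e (by omega) n3.symm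
          omega
        · have := potential_le_of_dummies hσ hε hl' (hlen _) e (by omega) n5.symm
          omega
        · have := potential_le_of_dummies hσ hε hl' (hlen _) e (by omega) n6.symm
          omega
        · exact e
      rw [hσ.outcome_eq_self hε hn hl hx (VotingRule.legal_empty _ _) key]
      exact n5.symm
    · refine Network.outcome_ne_of_forall hσ hl hx fun B hB hv => ?_
      have h2 := potential_le_of_dummies hσ hε (hl.append_of_eq hx hB) (hlen B) hv
        (by omega) n1
      rw [if_pos (by rw [Fin.lt_def]; omega)] at h2
      obtain ⟨e0, e1, e2, e3⟩ := step_v₃ hx B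
      have := vote_le_one B (v₁ k)
      omega

theorem ne_v₁_at_v₂ (hσ : (net k).IsSPE .approval ε σ) (hε : 0 < ε)
    (hn : ε < 1 / (2 * ((8 * k + 46 : ℕ) : ℝ)))
    (hl : VotingRule.approval.LegalHistory h) (hx : h.length = v₂ k)
    (hp : ((net k).potential h (v₂ k) + 1 ≤ (net k).potential h (v₁ k) ∧
        (net k).potential h (v₁ k) ≤ (net k).potential h (v₃ k)) ∨
      (net k).potential h (v₁ k) + 1 ≤ (net k).potential h (v₃ k)) :
    σ.outcome h ≠ v₁ k := by
  obtain ⟨n1, n2, n3, n4, n5, n6⟩ := ne_cands k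
  refine hσ.ne_of_sincere hε hl hx n4 (by rw [out_v₂]; simpa using n5) ?_
  refine ne_v₁_at_v₃ hσ hε hn (hl.append_of_eq hx (Network.legal_out_approval _ _))
    (by simp [hx, v₂, v₃]) ?_
  simpa only [Network.potential_append_out _ hx] using hp

theorem ne_v₁_at_mid (hσ : (net k).IsSPE .approval ε σ) (hε : 0 < ε)
    (hn : ε < 1 / (2 * ((8 * k + 46 : ℕ) : ℝ)))
    (hl : VotingRule.approval.LegalHistory h) {j : ℕ} (hj : j ≤ 2)
    (hx : h.length + j = 2 * k + 4)
    (hp : ((net k).potential h (v₂ k) + 1 ≤ (net k).potential h (v₁ k) ∧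
        (net k).potential h (v₁ k) ≤ (net k).potential h (v₃ k)) ∨
      (net k).potential h (v₁ k) + 1 ≤ (net k).potential h (v₃ k)) :
    σ.outcome h ≠ v₁ k := by
  induction j generalizing h with
  | zero => exact ne_v₁_at_v₂ hσ hε hn hl hx hp
  | succ j ih =>
    refine Network.outcome_ne_of_forall hσ hl (x := ⟨h.length, by omega⟩) rfl fun B hB => ?_
    obtain ⟨e0, e1, e2, e3⟩ := step_mid (h := h) (by omega) (by omega) B
    have := vote_le_one B (v₁ k)
    have := vote_le_one B (v₂ k)
    exact ih (hl.append_of_eq rfl hB) (by omega) (by simp; omega) (by omega)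

theorem ne_v₁_at_v₁ (hσ : (net k).IsSPE .approval ε σ) (hε : 0 < ε)
    (hn : ε < 1 / (2 * ((8 * k + 46 : ℕ) : ℝ)))
    (hl : VotingRule.approval.LegalHistory h) (hx : h.length = v₁ k)
    (hp : ((net k).potential h (v₂ k) + 1 ≤ (net k).potential h (v₁ k) ∧
        (net k).potential h (v₁ k) ≤ (net k).potential h (v₃ k)) ∨
      (net k).potential h (v₁ k) + 1 ≤ (net k).potential h (v₃ k)) :
    σ.outcome h ≠ v₁ k := by
  refine Network.outcome_ne_of_forall hσ hl hx fun B hB => ?_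
  obtain ⟨e0, e1, e2, e3⟩ := step_v₁ hx B
  have := vote_of_not_mem hB.not_mem
  have := vote_le_one B (v₂ k)
  exact ne_v₁_at_mid hσ hε hn (hl.append_of_eq hx hB) (j := 2) le_rfl
    (by simp [hx, v₁]) (by omega)

theorem ne_v₁_at_ww (hσ : (net k).IsSPE .approval ε σ) (hε : 0 < ε)
    (hn : ε < 1 / (2 * ((8 * k + 46 : ℕ) : ℝ)))
    (hl : VotingRule.approval.LegalHistory h) (hx : h.length = ww k)
    (hp : ((net k).potential h (v₂ k) + 1 ≤ (net k).potential h (v₁ k) ∧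
        (net k).potential h (v₁ k) ≤ (net k).potential h (v₃ k)) ∨
      (net k).potential h (v₁ k) + 1 ≤ (net k).potential h (v₃ k)) :
    σ.outcome h ≠ v₁ k := by
  obtain ⟨n1, n2, n3, n4, n5, n6⟩ := ne_cands k
  refine hσ.ne_of_sincere hε hl hx n1.symm (by rw [out_ww]; simp) ?_
  refine ne_v₁_at_v₁ hσ hε hn (hl.append_of_eq hx (Network.legal_out_approval _ _))
    (by simp [hx, v₁, ww]) ?_
  simpa only [Network.potential_append_out _ hx] using hp

/-- An agent confirming `ww` and `v₂` prevents the election of `v₁` as soon as some ballot of his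
leads to a history where neither `v₁` nor `v₃` nor `ww` is elected. -/
theorem ne_v₁_of_ballot (hσ : (net k).IsSPE .approval ε σ) (hε : 0 < ε)
    (hn : ε < 1 / (2 * ((8 * k + 46 : ℕ) : ℝ)))
    (hl : VotingRule.approval.LegalHistory h) (hx : h.length < 2 * k)
    (hx2 : h.length % 2 = 1) {B : Ballot (8 * k + 46)} (hB : ∀ x ∈ B, 2 * k ≤ (x : ℕ))
    (h1 : σ.outcome (h ++ [B]) ≠ v₁ k)
    (h3 : σ.outcome (h ++ [B]) ≠ v₃ k)
    (h0 : (net k).potential (h ++ [B]) (ww k) < score (h ++ [B]) (v₁ k) + (2 * k + 12)) :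
    σ.outcome h ≠ v₁ k := by
  obtain ⟨n1, n2, n3, n4, n5, n6⟩ := ne_cands k
  have hB' : VotingRule.approval.Legal ⟨h.length, by omega⟩ B := fun hm => by
    have := hB _ hm
    simp at this
    omega
  have hl' := hl.append_of_eq rfl hB'
  have key : σ.outcome (h ++ [B]) = v₂ k := by
    rcases outcome_cases hσ hε hl' (by simp; omega) with e | e | e | e
    · exact absurd e (outcome_ne_ww_of_score hσ hε hl' (by simp; omega) h0)
    · exact absurd e h1
    · exact e
    · exact absurd e h3
  have ho := out_odd (x := ⟨h.length, by omega⟩) hx hx2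
  rcases hσ.outcome_mem hε hn hl rfl hB' (by rw [key, ho]; simp) with e | e
  · rw [e]
    intro e
    rw [Fin.ext_iff] at e
    simp [v₁] at e
    omega
  · rw [ho] at e
    simp only [Finset.mem_insert, Finset.mem_singleton] at e
    rcases e with e | e <;> rw [e]
    · exact n1
    · exact n4.symm

theorem ne_v₁_at_pairs (hσ : (net k).IsSPE .approval ε σ) (hε : 0 < ε)
    (hn : ε < 1 / (2 * ((8 * k + 46 : ℕ) : ℝ))) {j : ℕ} :
    (∀ h : List (Ballot (8 * k + 46)), VotingRule.approval.LegalHistory h →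
      h.length + 2 * j = 2 * k →
      (net k).potential h (ww k) < score h (v₁ k) + (2 * k + 12) →
      (((net k).potential h (v₂ k) + 1 = (net k).potential h (v₁ k) ∧
        (net k).potential h (v₁ k) ≤ (net k).potential h (v₃ k) + j) ∨
       ((net k).potential h (v₁ k) ≤ (net k).potential h (v₂ k) ∧
        (net k).potential h (v₁ k) + 1 ≤ (net k).potential h (v₃ k) + j)) →
      σ.outcome h ≠ v₁ k) ∧
    (∀ h : List (Ballot (8 * k + 46)), VotingRule.approval.LegalHistory h →
      h.length + 2 * j + 1 = 2 * k →
      (net k).potential h (ww k) < score h (v₁ k) + (2 * k + 12) →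
      (((net k).potential h (v₂ k) ≤ (net k).potential h (v₁ k) ∧
        (net k).potential h (v₁ k) ≤ (net k).potential h (v₂ k) + 1 ∧
        (net k).potential h (v₁ k) ≤ (net k).potential h (v₃ k) + j + 1) ∨
       ((net k).potential h (v₁ k) + 1 ≤ (net k).potential h (v₂ k) ∧
        (net k).potential h (v₁ k) ≤ (net k).potential h (v₃ k) + j)) →
      σ.outcome h ≠ v₁ k) := by
  obtain ⟨n1, n2, n3, n4, n5, n6⟩ := ne_cands k
  obtain ⟨w0, w1, w2, w3⟩ := vals k
  have odd_of_even : ∀ j,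
    (∀ h : List (Ballot (8 * k + 46)), VotingRule.approval.LegalHistory h →
      h.length + 2 * j = 2 * k →
      (net k).potential h (ww k) < score h (v₁ k) + (2 * k + 12) →
      (((net k).potential h (v₂ k) + 1 = (net k).potential h (v₁ k) ∧
        (net k).potential h (v₁ k) ≤ (net k).potential h (v₃ k) + j) ∨
       ((net k).potential h (v₁ k) ≤ (net k).potential h (v₂ k) ∧
        (net k).potential h (v₁ k) + 1 ≤ (net k).potential h (v₃ k) + j)) →
      σ.outcome h ≠ v₁ k) →
    (∀ h : List (Ballot (8 * k + 46)), VotingRule.approval.LegalHistory h →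
      h.length + 2 * j + 1 = 2 * k →
      (net k).potential h (ww k) < score h (v₁ k) + (2 * k + 12) →
      (((net k).potential h (v₂ k) ≤ (net k).potential h (v₁ k) ∧
        (net k).potential h (v₁ k) ≤ (net k).potential h (v₂ k) + 1 ∧
        (net k).potential h (v₁ k) ≤ (net k).potential h (v₃ k) + j + 1) ∨
       ((net k).potential h (v₁ k) + 1 ≤ (net k).potential h (v₂ k) ∧
        (net k).potential h (v₁ k) ≤ (net k).potential h (v₃ k) + j)) →
      σ.outcome h ≠ v₁ k) := by
    intro j ihE h hl hx hw hp
    have ho := out_odd (x := ⟨h.length, by omega⟩) (k := k) (by simp; omega) (by simp; omega)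
    by_cases hs : (((net k).potential h (v₂ k) + 1 = (net k).potential h (v₁ k) ∧
        (net k).potential h (v₁ k) ≤ (net k).potential h (v₃ k) + j) ∨
       ((net k).potential h (v₁ k) ≤ (net k).potential h (v₂ k) ∧
        (net k).potential h (v₁ k) + 1 ≤ (net k).potential h (v₃ k) + j))
    · refine hσ.ne_of_sincere hε hl (x := ⟨h.length, by omega⟩) rfl ?_ ?_ ?_
      · intro e; rw [Fin.ext_iff] at e; simp at e; omega
      · rw [ho]; simp [n1.symm, n4]
      · refine ihE _ (hl.append_of_eq rfl (Network.legal_out_approval _ _))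
          (by simp; omega) ?_ ?_
        · rw [Network.potential_append_out _ rfl, score_append_vote]; omega
        · simpa only [Network.potential_append_out _ (x := ⟨h.length, _⟩) rfl] using hs
    · have main : ∀ B : Ballot (8 * k + 46), (∀ x ∈ B, 2 * k ≤ (x : ℕ)) →
          ((net k).potential (h ++ [B]) (v₂ k) + 1 = (net k).potential (h ++ [B]) (v₁ k) ∧
            (net k).potential (h ++ [B]) (v₁ k) ≤ (net k).potential (h ++ [B]) (v₃ k) + j) ∨
          ((net k).potential (h ++ [B]) (v₁ k) ≤ (net k).potential (h ++ [B]) (v₂ k) ∧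
            (net k).potential (h ++ [B]) (v₁ k) + 1 ≤
              (net k).potential (h ++ [B]) (v₃ k) + j) →
          (net k).potential (h ++ [B]) (v₃ k) ≤ (net k).potential (h ++ [B]) (v₂ k) ∨
            (j = 0 ∧ (net k).potential (h ++ [B]) (v₁ k) =
              (net k).potential (h ++ [B]) (v₂ k) + 1 ∧
              (net k).potential (h ++ [B]) (v₃ k) = (net k).potential (h ++ [B]) (v₂ k) + 1) →
          ww k ∉ B → σ.outcome h ≠ v₁ k := by
        intro B hB h1 h2 hwB
        have hB' : VotingRule.approval.Legal ⟨h.length, by omega⟩ B := fun hm => by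
          have := hB _ hm
          simp at this
          omega
        have hl' := hl.append_of_eq rfl hB'
        obtain ⟨e0, e1, e2, e3⟩ := step_odd (h := h) (k := k) (by omega) (by omega) B
        have hs1 := score_append_vote h B (v₁ k)
        rw [vote_of_not_mem hwB] at e0
        refine ne_v₁_of_ballot hσ hε hn hl (by omega) (by omega) hB
          (ihE _ hl' (by simp; omega) (by omega) h1) ?_ (by omega)
        rcases h2 with h2 | ⟨rfl, h2, h3⟩
        · exact outcome_ne_v₃ hσ hε hl' h2
        · have hlen : (h ++ [B]).length = 2 * k := by simp; omega
          have hp1 : (net k).potential (h ++ [B]) (v₁ k) =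
              score (h ++ [B]) (v₁ k) + (2 * k + 12) := by
            rw [Network.potential, hlen, (likersFrom_ww k).2.1]
          exact ne_v₃_at_ww hσ hε hn hl' (hlen.trans w0.symm) h2 h3 (by omega)
      by_cases c1 : (net k).potential h (v₁ k) = (net k).potential h (v₂ k)
      · by_cases c2 : (net k).potential h (v₁ k) = (net k).potential h (v₃ k) + j
        · obtain ⟨e0, e1, e2, e3⟩ := step_odd (h := h) (k := k) (by omega) (by omega) ∅
          simp only [vote, Finset.notMem_empty, if_false] at e1 e2 e3
          refine main ∅ (by simp) (by omega) ?_ (by simp)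
          rcases Nat.eq_zero_or_pos j with rfl | hj
          · right; omega
          · left; omega
        · obtain ⟨e0, e1, e2, e3⟩ := step_odd (h := h) (k := k) (by omega) (by omega) {v₃ k}
          simp only [vote, Finset.mem_singleton, n5, n6, if_true, if_false] at e1 e2 e3
          refine main {v₃ k} (by simp [w3]) (by omega) ?_ (by simpa using n3)
          rcases Nat.eq_zero_or_pos j with rfl | hj
          · right; omega
          · left; omega
      · obtain ⟨e0, e1, e2, e3⟩ := step_odd (h := h) (k := k) (by omega) (by omega)
          {v₂ k, v₃ k}
        simp only [vote, Finset.mem_insert, Finset.mem_singleton, n5, n6, n4, or_self, or_true,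
          true_or, if_true, if_false] at e1 e2 e3
        refine main {v₂ k, v₃ k} (by simp [w2, w3]) (by omega) ?_ (by simp [n2, n3])
        rcases Nat.eq_zero_or_pos j with rfl | hj
        · omega
        · left; omega
  induction j with
  | zero =>
    have he : (∀ h : List (Ballot (8 * k + 46)), VotingRule.approval.LegalHistory h →
      h.length + 2 * 0 = 2 * k →
      (net k).potential h (ww k) < score h (v₁ k) + (2 * k + 12) →
      (((net k).potential h (v₂ k) + 1 = (net k).potential h (v₁ k) ∧
        (net k).potential h (v₁ k) ≤ (net k).potential h (v₃ k) + 0) ∨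
       ((net k).potential h (v₁ k) ≤ (net k).potential h (v₂ k) ∧
        (net k).potential h (v₁ k) + 1 ≤ (net k).potential h (v₃ k) + 0)) →
      σ.outcome h ≠ v₁ k) := fun h hl hx _ hp =>
      ne_v₁_at_ww hσ hε hn hl (by omega) (by omega)
    exact ⟨he, odd_of_even 0 he⟩
  | succ j ih =>
    suffices he : _ from ⟨he, odd_of_even (j + 1) he⟩
    intro h hl hx hw hp
    refine Network.outcome_ne_of_forall hσ hl (x := ⟨h.length, by omega⟩) rfl fun B hB => ?_
    obtain ⟨e0, e1, e2, e3⟩ := step_even (h := h) (k := k) (by omega) (by omega) B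
    have hs1 := score_append_vote h B (v₁ k)
    have := vote_le_one B (ww k)
    have := vote_le_one B (v₁ k)
    have := vote_le_one B (v₂ k)
    have := vote_le_one B (v₃ k)
    exact ih.2 _ (hl.append_of_eq rfl hB) (by simp; omega) (by omega) (by omega)

/-! #### When `v₂` is not elected -/

theorem ne_v₂_at_v₂ (hσ : (net k).IsSPE .approval ε σ) (hε : 0 < ε)
    (hl : VotingRule.approval.LegalHistory h) (hx : h.length = v₂ k)
    (hp : (net k).potential h (v₂ k) ≤ (net k).potential h (v₁ k)) : σ.outcome h ≠ v₂ k := by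
  obtain ⟨n1, n2, n3, n4, n5, n6⟩ := ne_cands k
  obtain ⟨w0, w1, w2, w3⟩ := vals k
  refine Network.outcome_ne_of_forall hσ hl hx fun B hB => ?_
  obtain ⟨e1, e2⟩ := step_v₂ hx B
  rw [vote_of_not_mem hB.not_mem] at e2
  have hl' := hl.append_of_eq hx hB
  have hx' : (h ++ [B]).length = v₃ k := by simp [hx, w2, w3]
  refine hσ.ne_of_sincere hε hl' hx' n6 (by rw [out_v₃]; simpa using n4.symm) fun e => ?_
  have := potential_le_of_dummies hσ hε
    (hl'.append_of_eq hx' (Network.legal_out_approval (net k) _)) (by simp [hx, w2]) e (by omega) n4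
  rw [if_pos (by rw [Fin.lt_def]; omega)] at this
  simp only [Network.potential_append_out _ hx'] at this
  omega

theorem eq_v₁_at_mid (hσ : (net k).IsSPE .approval ε σ) (hε : 0 < ε)
    (hn : ε < 1 / (2 * ((8 * k + 46 : ℕ) : ℝ)))
    (hl : VotingRule.approval.LegalHistory h) {j : ℕ} (hj : j ≤ 1)
    (hx : h.length + j = 2 * k + 3)
    (hp : (net k).potential h (v₂ k) ≤ (net k).potential h (v₁ k))
    (h3 : (net k).potential h (v₃ k) ≤ (net k).potential h (v₂ k))
    (h0 : (net k).potential h (ww k) < (net k).potential h (v₁ k)) : σ.outcome h = v₁ k := by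
  obtain ⟨w0, w1, w2, w3⟩ := vals k
  have ho := out_mid (x := ⟨h.length, by omega⟩) (k := k) (by simp; omega) (by simp; omega)
  have hl' := hl.append_of_eq (x := ⟨h.length, by omega⟩) rfl
    (Network.legal_out_approval (net k) _)
  have hself : σ.outcome h ≠ ⟨h.length, by omega⟩ := by
    intro e
    rcases outcome_cases hσ hε hl (by omega) with c | c | c | c <;> rw [c, Fin.ext_iff] at e <;>
      simp only at e <;> omega
  have key : σ.outcome (h ++ [(net k).out ⟨h.length, by omega⟩]) = v₁ k := by
    induction j generalizing h with
    | zero =>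
      rcases outcome_cases hσ hε hl' (by simp; omega) with e | e | e | e
      · refine absurd e (outcome_ne_ww hσ hε hl' (by simp; omega) (a := v₁ k) ?_)
        simpa only [Network.potential_append_out _ (x := ⟨h.length, _⟩) rfl] using h0
      · exact e
      · refine absurd e (ne_v₂_at_v₂ hσ hε hl' (by simp; omega) ?_)
        simpa only [Network.potential_append_out _ (x := ⟨h.length, _⟩) rfl] using hp
      · refine absurd e (outcome_ne_v₃ hσ hε hl' ?_)
        simpa only [Network.potential_append_out _ (x := ⟨h.length, _⟩) rfl] using h3
    | succ j ih =>
      set g := h ++ [(net k).out ⟨h.length, by omega⟩] with hg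
      have hlen : g.length = h.length + 1 := by simp [hg]
      have ho' := out_mid (x := ⟨g.length, by omega⟩) (k := k) (by simp; omega) (by simp; omega)
      have hl'' := hl'.append_of_eq (x := ⟨g.length, by omega⟩) rfl
        (Network.legal_out_approval (net k) _)
      have hself' : σ.outcome g ≠ ⟨g.length, by omega⟩ := by
        intro e
        rcases outcome_cases hσ hε hl' (by omega) with c | c | c | c <;>
          rw [c, Fin.ext_iff] at e <;> simp only at e <;> omega
      have pots (a) : (net k).potential g a = (net k).potential h a :=
        Network.potential_append_out _ (x := ⟨h.length, _⟩) rfl a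
      have := ih (h := g) hl' (by omega) (by omega) (by rw [pots, pots]; exact hp)
        (by rw [pots, pots]; exact h3) (by rw [pots, pots]; exact h0) ho' hl'' hself'
      rw [hσ.outcome_eq_sincere hε hn hl' rfl hself' (by rw [this, ho']; simp), this]
  rw [hσ.outcome_eq_sincere hε hn hl rfl hself (by rw [key, ho]; simp), key]

theorem ne_v₂_at_v₁ (hσ : (net k).IsSPE .approval ε σ) (hε : 0 < ε)
    (hn : ε < 1 / (2 * ((8 * k + 46 : ℕ) : ℝ)))
    (hl : VotingRule.approval.LegalHistory h) (hx : h.length = v₁ k)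
    (h0 : (net k).potential h (ww k) < (net k).potential h (v₁ k))
    (hp : (net k).potential h (v₂ k) + 2 ≤ (net k).potential h (v₁ k) ∨
      ((net k).potential h (v₂ k) + 1 = (net k).potential h (v₁ k) ∧
        (net k).potential h (v₃ k) + 1 ≤ (net k).potential h (v₁ k)) ∨
      ((net k).potential h (v₁ k) ≤ (net k).potential h (v₂ k) ∧
        (net k).potential h (v₂ k) ≤ (net k).potential h (v₁ k) + 1 ∧
        (net k).potential h (v₃ k) ≤ (net k).potential h (v₁ k))) :
    σ.outcome h ≠ v₂ k := by
  obtain ⟨n1, n2, n3, n4, n5, n6⟩ := ne_cands k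
  obtain ⟨w0, w1, w2, w3⟩ := vals k
  rcases lt_or_ge ((net k).potential h (v₂ k) + 1) ((net k).potential h (v₁ k)) with h1 | h1
  · exact outcome_ne_v₂ hσ hε hl h1
  · have : ∃ B, VotingRule.approval.Legal (v₁ k) B ∧ σ.outcome (h ++ [B]) = v₁ k := by
      rcases lt_or_ge ((net k).potential h (v₁ k)) ((net k).potential h (v₂ k)) with h2 | h2
      · obtain ⟨e0, e1, e2, e3⟩ := step_v₁ hx ∅
        simp only [vote, Finset.notMem_empty, if_false] at e0 e1 e2 e3
        exact ⟨∅, VotingRule.legal_empty _ _, eq_v₁_at_mid hσ hε hn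
          (hl.append_of_eq hx (VotingRule.legal_empty _ _)) (j := 1) le_rfl (by simp [hx, w1])
          (by omega) (by omega) (by omega)⟩
      · refine ⟨_, Network.legal_out_approval (net k) _, eq_v₁_at_mid hσ hε hn
          (hl.append_of_eq hx (Network.legal_out_approval (net k) _)) (j := 1) le_rfl
          (by simp [hx, w1]) ?_ ?_ ?_⟩ <;>
        simp only [Network.potential_append_out _ hx] <;> omega
    obtain ⟨B, hB, ho⟩ := this
    rw [hσ.outcome_eq_self hε hn hl hx hB ho]
    exact n4

theorem ne_v₂_at_ww (hσ : (net k).IsSPE .approval ε σ) (hε : 0 < ε)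
    (hn : ε < 1 / (2 * ((8 * k + 46 : ℕ) : ℝ)))
    (hl : VotingRule.approval.LegalHistory h) (hx : h.length = ww k)
    (h0 : (net k).potential h (ww k) < (net k).potential h (v₁ k))
    (hp : (net k).potential h (v₂ k) + 2 ≤ (net k).potential h (v₁ k) ∨
      ((net k).potential h (v₂ k) + 1 = (net k).potential h (v₁ k) ∧
        (net k).potential h (v₃ k) + 1 ≤ (net k).potential h (v₁ k)) ∨
      ((net k).potential h (v₁ k) ≤ (net k).potential h (v₂ k) ∧
        (net k).potential h (v₂ k) ≤ (net k).potential h (v₁ k) + 1 ∧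
        (net k).potential h (v₃ k) ≤ (net k).potential h (v₁ k))) :
    σ.outcome h ≠ v₂ k := by
  obtain ⟨n1, n2, n3, n4, n5, n6⟩ := ne_cands k
  obtain ⟨w0, w1, w2, w3⟩ := vals k
  refine hσ.ne_of_sincere hε hl hx n2.symm (by rw [out_ww]; simp) ?_
  refine ne_v₂_at_v₁ hσ hε hn (hl.append_of_eq hx (Network.legal_out_approval (net k) _))
    (by simp [hx, w0, w1]) ?_ ?_
  · simpa only [Network.potential_append_out _ hx] using h0
  · simpa only [Network.potential_append_out _ hx] using hp

theorem ne_v₂_at_pairs (hσ : (net k).IsSPE .approval ε σ) (hε : 0 < ε)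
    (hn : ε < 1 / (2 * ((8 * k + 46 : ℕ) : ℝ))) {j : ℕ} :
    ∀ h : List (Ballot (8 * k + 46)), VotingRule.approval.LegalHistory h →
      h.length + 2 * j = 2 * k →
      (net k).potential h (ww k) ≤ score h (v₁ k) + (2 * k + 12) →
      (j = 0 → (net k).potential h (ww k) < score h (v₁ k) + (2 * k + 12)) →
      ((net k).potential h (v₂ k) + 2 ≤ (net k).potential h (v₁ k) ∨
        ((net k).potential h (v₂ k) + 1 = (net k).potential h (v₁ k) ∧
          (net k).potential h (v₃ k) + j + 1 ≤ (net k).potential h (v₁ k)) ∨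
        ((net k).potential h (v₁ k) ≤ (net k).potential h (v₂ k) ∧
          (net k).potential h (v₂ k) ≤ (net k).potential h (v₁ k) + 1 ∧
          (net k).potential h (v₃ k) + j ≤ (net k).potential h (v₁ k))) →
      σ.outcome h ≠ v₂ k := by
  obtain ⟨n1, n2, n3, n4, n5, n6⟩ := ne_cands k
  obtain ⟨w0, w1, w2, w3⟩ := vals k
  induction j with
  | zero =>
    intro h hl hx h0 h0' hp
    have hp1 : (net k).potential h (v₁ k) = score h (v₁ k) + (2 * k + 12) := by
      have hlen : h.length = 2 * k := by omega
      rw [Network.potential, hlen, (likersFrom_ww k).2.1]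
    exact ne_v₂_at_ww hσ hε hn hl (by omega) (by have := h0' rfl; omega) (by omega)
  | succ j ih =>
    intro h hl hx h0 _ hp
    have odd : ∀ g : List (Ballot (8 * k + 46)), VotingRule.approval.LegalHistory g →
        g.length + 2 * j + 1 = 2 * k →
        (net k).potential g (ww k) < score g (v₁ k) + (2 * k + 12) →
        ((net k).potential g (v₂ k) + 2 ≤ (net k).potential g (v₁ k) ∨
          ((net k).potential g (v₂ k) ≤ (net k).potential g (v₁ k) ∧
            (net k).potential g (v₁ k) ≤ (net k).potential g (v₂ k) + 1 ∧
            (net k).potential g (v₃ k) + j + 2 ≤ (net k).potential g (v₁ k)) ∨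
          ((net k).potential g (v₂ k) = (net k).potential g (v₁ k) + 1 ∧
            (net k).potential g (v₃ k) + j + 1 ≤ (net k).potential g (v₁ k))) →
        σ.outcome g ≠ v₂ k := by
      intro g hg hx h0 hp
      refine Network.outcome_ne_of_forall hσ hg (x := ⟨g.length, by omega⟩) rfl fun B hB => ?_
      obtain ⟨e0, e1, e2, e3⟩ := step_odd (h := g) (k := k) (by omega) (by omega) B
      have hs1 := score_append_vote g B (v₁ k)
      have := vote_le_one B (ww k)
      have := vote_le_one B (v₁ k)
      have := vote_le_one B (v₂ k)
      have := vote_le_one B (v₃ k)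
      exact ih _ (hg.append_of_eq rfl hB) (by simp; omega) (by omega) (fun _ => by omega)
        (by omega)
    have ho := out_even (x := ⟨h.length, by omega⟩) (k := k) (by simp; omega) (by simp; omega)
    by_cases c : (net k).potential h (v₁ k) = (net k).potential h (v₂ k) ∧
        (net k).potential h (v₃ k) + j + 1 = (net k).potential h (v₁ k)
    · have hB : VotingRule.approval.Legal ⟨h.length, by omega⟩ {ww k, v₁ k, v₂ k} := fun hm => by
        simp [Fin.ext_iff] at hm; omega
      obtain ⟨e0, e1, e2, e3⟩ := step_even (h := h) (k := k) (by omega) (by omega)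
        {ww k, v₁ k, v₂ k}
      have hs1 := score_append_vote h {ww k, v₁ k, v₂ k} (v₁ k)
      simp only [vote, Finset.mem_insert, Finset.mem_singleton, n1, n2, n4, n3.symm, n5.symm,
        n6.symm, or_self, or_true, true_or, if_true, if_false] at e0 e1 e2 e3 hs1
      have hl' := hl.append_of_eq rfl hB
      have key : σ.outcome (h ++ [{ww k, v₁ k, v₂ k}]) = v₁ k := by
        rcases outcome_cases hσ hε hl' (by simp; omega) with e | e | e | e
        · exact absurd e (outcome_ne_ww_of_score hσ hε hl' (by simp; omega) (by omega))
        · exact e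
        · exact absurd e (odd _ hl' (by simp; omega) (by omega) (by omega))
        · exact absurd e (outcome_ne_v₃ hσ hε hl' (by omega))
      rcases hσ.outcome_mem hε hn hl rfl hB (by rw [key, ho]; simp) with e | e
      · rw [e, ne_eq, Fin.ext_iff]; simp only; omega
      · rw [ho] at e
        simp only [Finset.mem_insert, Finset.mem_singleton] at e
        rcases e with e | e <;> rw [e]
        · exact n2
        · exact n4
    · refine hσ.ne_of_sincere hε hl (x := ⟨h.length, by omega⟩) rfl ?_ ?_ ?_
      · intro e; rw [Fin.ext_iff] at e; simp at e; omega
      · rw [ho]; simp [n2.symm, n4.symm]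
      · have hs1 := score_append_vote h ((net k).out ⟨h.length, by omega⟩) (v₁ k)
        rw [vote_of_mem (by rw [ho]; simp)] at hs1
        refine odd _ (hl.append_of_eq rfl (Network.legal_out_approval _ _)) (by simp; omega) ?_ ?_
        · rw [Network.potential_append_out _ rfl]; omega
        · simp only [Network.potential_append_out _ (x := ⟨h.length, _⟩) rfl]
          omega

/-! #### When `ww` is not elected -/

theorem ne_ww_of_score_v₂ (hσ : (net k).IsSPE .approval ε σ) (hε : 0 < ε)
    (hn : ε < 1 / (2 * ((8 * k + 46 : ℕ) : ℝ))) (hl : VotingRule.approval.LegalHistory h) {j : ℕ}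
    (hx : h.length + j + 1 = 2 * k)
    (h0 : (net k).potential h (ww k) < score h (v₂ k) + (2 * k + 12)) : σ.outcome h ≠ ww k := by
  obtain ⟨n1, n2, n3, n4, n5, n6⟩ := ne_cands k
  obtain ⟨w0, w1, w2, w3⟩ := vals k
  induction j generalizing h with
  | zero =>
    intro hv
    obtain ⟨l0, l1, l2, l3⟩ := likersFrom_ww k
    have b1 := score_add_le_of_outcome_eq_ww hσ hε hl hv (t := 2 * k) (by omega) le_rfl n1.symm
    have b2 := score_add_le_of_outcome_eq_ww hσ hε hl hv (t := 2 * k) (by omega) le_rfl n2.symm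
    have b3 := score_add_le_of_outcome_eq_ww hσ hε hl hv (t := 2 * k) (by omega) le_rfl n3.symm
    have ho := out_odd (x := ⟨h.length, by omega⟩) (k := k) (by simp; omega) (by simp; omega)
    have hl' := hl.append_of_eq (x := ⟨h.length, by omega⟩) rfl
      (Network.legal_out_approval (net k) _)
    have p0 := Network.potential_append_out (net k) (h := h) (x := ⟨h.length, by omega⟩) rfl (ww k)
    rw [ho] at hl' p0
    have hlen : (h ++ [{ww k, v₂ k}]).length = 2 * k := by simp; omega
    have s1 := score_append_vote h {ww k, v₂ k} (v₁ k)
    have s2 := score_append_vote h {ww k, v₂ k} (v₂ k)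
    have s3 := score_append_vote h {ww k, v₂ k} (v₃ k)
    simp only [vote, Finset.mem_insert, Finset.mem_singleton, n1.symm, n2.symm, n3.symm, n4,
        n6.symm, or_self, or_true, true_or, if_true, if_false] at s1 s2 s3
    have p1 : (net k).potential (h ++ [{ww k, v₂ k}]) (v₁ k) = score h (v₁ k) + (2 * k + 12) := by
      rw [Network.potential, hlen]; omega
    have p2 : (net k).potential (h ++ [{ww k, v₂ k}]) (v₂ k) = score h (v₂ k) + (2 * k + 12) := by
      rw [Network.potential, hlen]; omega
    have p3 : (net k).potential (h ++ [{ww k, v₂ k}]) (v₃ k) = score h (v₃ k) + (2 * k + 12) := by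
      rw [Network.potential, hlen]; omega
    have key : σ.outcome (h ++ [{ww k, v₂ k}]) = v₂ k := by
      rcases outcome_cases hσ hε hl' (by omega) with e | e | e | e
      · exact absurd e (outcome_ne_ww hσ hε hl' (by omega) (a := v₂ k) (by omega))
      · exact absurd e (outcome_ne_of_le_ww hσ hε hl' (by omega) (by rw [Fin.lt_def]; omega)
          (by omega) (by omega))
      · exact e
      · exact absurd e (outcome_ne_of_le_ww hσ hε hl' (by omega) (by rw [Fin.lt_def]; omega)
          (by omega) (by omega))
    have := hσ.outcome_eq_sincere hε hn hl (x := ⟨h.length, by omega⟩) rfl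
      (by rw [hv, ne_eq, Fin.ext_iff]; simp only; omega) (by rw [ho, key]; simp)
    rw [ho, key, hv] at this
    exact n2 this
  | succ j ih =>
    refine Network.outcome_ne_of_forall hσ hl (x := ⟨h.length, by omega⟩) rfl fun B hB => ?_
    have hs2 := score_append_vote h B (v₂ k)
    have := vote_le_one B (ww k)
    refine ih (hl.append_of_eq rfl hB) (by simp; omega) ?_
    rcases Nat.mod_two_eq_zero_or_one h.length with h2 | h2
    · obtain ⟨e0, -⟩ := step_even (h := h) (k := k) (by omega) h2 B
      omega
    · obtain ⟨e0, -⟩ := step_odd (h := h) (k := k) (by omega) h2 B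
      omega

/-! #### The equilibrium path -/

theorem outcome_eq_ww_of_path (hσ : (net k).IsSPE .approval ε σ) (hε : 0 < ε)
    (hn : ε < 1 / (2 * ((8 * k + 46 : ℕ) : ℝ))) {j : ℕ} (hj : 0 < j) :
    ∀ h : List (Ballot (8 * k + 46)), VotingRule.approval.LegalHistory h →
      h.length + 2 * j = 2 * k → score h (v₁ k) = 0 → score h (v₂ k) = 0 →
      (net k).potential h (ww k) = 2 * k + 12 →
      (net k).potential h (v₁ k) = j + 2 * k + 12 →
      (net k).potential h (v₂ k) = j + 2 * k + 11 →
      (net k).potential h (v₃ k) = 2 * k + 12 → σ.outcome h = ww k := by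
  obtain ⟨n1, n2, n3, n4, n5, n6⟩ := ne_cands k
  obtain ⟨w0, w1, w2, w3⟩ := vals k
  have hε2 : ε < 1 / 2 := lt_half_of_lt hn
  have hself : ∀ g : List (Ballot (8 * k + 46)), VotingRule.approval.LegalHistory g →
      ∀ hg : g.length < 2 * k, σ.outcome g ≠ ⟨g.length, by omega⟩ := by
    intro g hgl hg e
    rcases outcome_cases hσ hε hgl (by omega) with c | c | c | c <;> rw [c, Fin.ext_iff] at e <;>
      simp only at e <;> omega
  induction j, hj using Nat.le_induction with
  | base =>
    intro h hl hx s1 s2 p0 p1 p2 p3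
    have hle : VotingRule.approval.Legal ⟨h.length, by omega⟩ {ww k} := fun hm => by
      simp [Fin.ext_iff] at hm; omega
    obtain ⟨e0, e1, e2, e3⟩ := step_even (h := h) (k := k) (by omega) (by omega) {ww k}
    simp only [vote, Finset.mem_singleton, n1.symm, n2.symm, n3.symm, if_true, if_false]
      at e0 e1 e2 e3
    have hl' := hl.append_of_eq rfl hle
    refine hσ.outcome_eq_of_cooperate hε hn hε2 hl (x := ⟨h.length, by omega⟩) rfl
      (out_even (by simp; omega) (by simp; omega)) (hself h hl (by omega)) ?_ ?_
    · have hlen : (h ++ [{ww k}]).length = h.length + 1 := by simp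
      have ho := out_odd (x := ⟨(h ++ [{ww k}]).length, by omega⟩) (k := k) (by simp; omega)
        (by simp; omega)
      set g := h ++ [{ww k}]
      have hl'' := hl'.append_of_eq (x := ⟨g.length, by omega⟩) rfl
        (Network.legal_out_approval (net k) _)
      have pots (a) := Network.potential_append_out (net k) (h := g) (x := ⟨g.length, by omega⟩)
        rfl a
      have key : σ.outcome (g ++ [(net k).out ⟨g.length, by omega⟩]) = ww k := by
        rcases outcome_cases hσ hε hl'' (by simp; omega) with e | e | e | e
        · exact e
        all_goals
          refine absurd e (outcome_ne_of_le_ww hσ hε hl'' (by simp; omega)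
            (by rw [Fin.lt_def]; omega) ?_ (by omega))
          rw [pots, pots]
          omega
      rw [hσ.outcome_eq_sincere hε hn hl' rfl (hself g hl' (by omega)) (by rw [key, ho]; simp), key]
    · intro B hB hm hsub
      obtain ⟨e0, e1, e2, e3⟩ := step_even (h := h) (k := k) (by omega) (by omega) B
      have q1 := vote_of_mem hm
      have q2 : vote B (v₂ k) = 0 := vote_of_not_mem fun hm => by
        have := hsub hm; simp [n2.symm, n4.symm] at this
      have q3 : vote B (v₃ k) = 0 := vote_of_not_mem fun hm => by
        have := hsub hm; simp [n3.symm, n5.symm] at this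
      have := vote_le_one B (ww k)
      have hs1 := score_append_vote h B (v₁ k)
      have hlB := hl.append_of_eq rfl hB
      exact ⟨outcome_ne_ww_of_score hσ hε hlB (by simp; omega) (by omega),
        (ne_v₁_at_pairs hσ hε hn (j := 0)).2 _ hlB (by simp; omega) (by omega) (by omega)⟩
  | succ j hj ih =>
    intro h hl hx s1 s2 p0 p1 p2 p3
    have hle : VotingRule.approval.Legal ⟨h.length, by omega⟩ {ww k} := fun hm => by
      simp [Fin.ext_iff] at hm; omega
    obtain ⟨e0, e1, e2, e3⟩ := step_even (h := h) (k := k) (by omega) (by omega) {ww k}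
    have t1 := score_append_vote h {ww k} (v₁ k)
    have t2 := score_append_vote h {ww k} (v₂ k)
    simp only [vote, Finset.mem_singleton, n1.symm, n2.symm, n3.symm, if_true, if_false]
      at e0 e1 e2 e3 t1 t2
    have hl' := hl.append_of_eq rfl hle
    refine hσ.outcome_eq_of_cooperate hε hn hε2 hl (x := ⟨h.length, by omega⟩) rfl
      (out_even (by simp; omega) (by simp; omega)) (hself h hl (by omega)) ?_ ?_
    · have hlen : (h ++ [{ww k}]).length = h.length + 1 := by simp
      set g := h ++ [{ww k}]
      have hle' : VotingRule.approval.Legal ⟨g.length, by omega⟩ {ww k} := fun hm => by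
        simp [Fin.ext_iff] at hm; omega
      refine hσ.outcome_eq_of_cooperate hε hn hε2 hl' (x := ⟨g.length, by omega⟩) rfl
        (out_odd (by simp; omega) (by simp; omega)) (hself g hl' (by omega)) ?_ ?_
      · obtain ⟨f0, f1, f2, f3⟩ := step_odd (h := g) (k := k) (by omega) (by omega) {ww k}
        have t1' := score_append_vote g {ww k} (v₁ k)
        have t2' := score_append_vote g {ww k} (v₂ k)
        simp only [vote, Finset.mem_singleton, n1.symm, n2.symm, n3.symm, if_true, if_false]
          at f0 f1 f2 f3 t1' t2'
        exact ih (by omega) _ (hl'.append_of_eq rfl hle') (by simp; omega) (by omega) (by omega)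
          (by omega) (by omega) (by omega) (by omega)
      · intro B hB hm hsub
        obtain ⟨f0, f1, f2, f3⟩ := step_odd (h := g) (k := k) (by omega) (by omega) B
        have q1 := vote_of_mem hm
        have q2 : vote B (v₁ k) = 0 := vote_of_not_mem fun hm => by
          have := hsub hm; simp [n1.symm, n4] at this
        have q3 : vote B (v₃ k) = 0 := vote_of_not_mem fun hm => by
          have := hsub hm; simp [n3.symm, n6.symm] at this
        have := vote_le_one B (ww k)
        have hs1 := score_append_vote g B (v₁ k)
        have hs2 := score_append_vote g B (v₂ k)
        have hlB := hl'.append_of_eq rfl hB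
        exact ⟨ne_ww_of_score_v₂ hσ hε hn hlB (j := 2 * j - 1) (by simp; omega) (by omega),
          ne_v₂_at_pairs hσ hε hn (j := j) _ hlB (by simp; omega) (by omega) (by omega) (by omega)⟩
    · intro B hB hm hsub
      obtain ⟨e0, e1, e2, e3⟩ := step_even (h := h) (k := k) (by omega) (by omega) B
      have q1 := vote_of_mem hm
      have q2 : vote B (v₂ k) = 0 := vote_of_not_mem fun hm => by
        have := hsub hm; simp [n2.symm, n4.symm] at this
      have q3 : vote B (v₃ k) = 0 := vote_of_not_mem fun hm => by
        have := hsub hm; simp [n3.symm, n5.symm] at this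
      have := vote_le_one B (ww k)
      have hs1 := score_append_vote h B (v₁ k)
      have hlB := hl.append_of_eq rfl hB
      exact ⟨outcome_ne_ww_of_score hσ hε hlB (by simp; omega) (by omega),
        (ne_v₁_at_pairs hσ hε hn (j := j)).2 _ hlB (by simp; omega) (by omega) (by omega)⟩

theorem achievable_eq (hk : 0 < k) (hε : 0 < ε) (hn : ε < 1 / (2 * ((8 * k + 46 : ℕ) : ℝ))) :
    (net k).achievable .approval ε = {ww k} := by
  refine Network.achievable_eq_singleton _ _ _ fun σ hσ => ?_
  obtain ⟨l0, l1, l2, l3⟩ := likersFrom_pairs (k := k) (j := k) (t := 0) (by omega)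
  refine outcome_eq_ww_of_path hσ hε hn hk [] (VotingRule.legalHistory_nil _) (by simp) rfl rfl
    ?_ ?_ ?_ ?_ <;> simp [Network.potential, l0, l1, l2, l3]

end ApprovalNet

/-! ### Ladder networks for plurality voting -/

/-- The first agent of the block number `i`; the block consists of `m - i + 1` agents. -/
def start (m : ℕ) : ℕ → ℕ
  | 0 => 0
  | i + 1 => start m i + (m - i + 1)

theorem start_succ (m i : ℕ) : start m (i + 1) = start m i + (m - i + 1) := rfl

theorem start_mono (m : ℕ) : Monotone (start m) :=
  monotone_nat_of_le_succ fun i => by rw [start_succ]; omega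

theorem exists_block {m j x : ℕ} (hx : x < start m j) :
    ∃ i < j, start m i ≤ x ∧ x < start m (i + 1) := by
  induction j with
  | zero => simp [start] at hx
  | succ j ih =>
    rcases lt_or_ge x (start m j) with h | h
    · obtain ⟨i, hi, h1⟩ := ih h
      exact ⟨i, by omega, h1⟩
    · exact ⟨j, by omega, h, hx⟩

/-- A network with the candidates `w, b m, …, b 0`, listed in the voting order. Before `w` there are
`m` blocks of voters, the block number `i` confirming `w` and `b i`. The agent `w` confirms `b m`,
the agent after `w` confirms `b m` as well, and `b (i + 1)` confirms `b i`. After `w`, all agents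
confirm at most one agent. -/
structure IsLadder {n : ℕ} (G : Network n) (m c : ℕ) (w : Fin n) (b : ℕ → Fin n) : Prop where
  pos : 0 < m
  large : start m m + m + 6 ≤ c
  val_w : (w : ℕ) = start m m
  val_b : ∀ i ≤ m, (b i : ℕ) = start m m + 2 + (m - i)
  out_block : ∀ i < m, ∀ x : Fin n, start m i ≤ x → x < start m (i + 1) → G.out x = {w, b i}
  out_w : G.out w = {b m}
  out_rung : ∀ i ≤ m, ∀ x : Fin n, (x : ℕ) = start m m + 1 + (m - i) → G.out x = {b i}
  out_b_zero : G.out (b 0) = ∅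
  out_single : ∀ x a : Fin n, start m m < x → a ∈ G.out x → G.out x = {a}
  mem_out : ∀ x a : Fin n, a ∈ G.out x → a = w ∨ ∃ i ≤ m, a = b i
  likers_w : G.likersFrom (start m m + 1) w + start m m = c
  likers_b : ∀ i ≤ m, G.likersFrom (start m m + 1) (b i) = c

/-- Along a path of play that elects an agent in whom the voters have no interest, potentials do
not increase, and those of agents with devoted supporters are preserved. -/
theorem Network.IsSPE.exists_sincere_path {n : ℕ} [NeZero n] {G : Network n} {ε : ℝ}
    {σ : Profile n} (hσ : G.IsSPE .plurality ε σ) (hε : 0 < ε) (hε2 : ε < 1 / 2)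
    (hcard : ∀ x, (G.out x).card ≤ 2) {h : List (Ballot n)}
    (hl : VotingRule.plurality.LegalHistory h) {v : Fin n} (hv : σ.outcome h = v) {t : ℕ}
    (ht : h.length ≤ t) (htn : t ≤ n)
    (hx : ∀ x : Fin n, h.length ≤ x → x < t → x ≠ v ∧ v ∉ G.out x) :
    ∃ e, VotingRule.plurality.LegalHistory e ∧ e.length = t ∧ σ.outcome e = v ∧
      (∀ a, G.potential e a ≤ G.potential h a) ∧
      ∀ a, (∀ x : Fin n, h.length ≤ x → x < t → a ∈ G.out x → G.out x = {a}) →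
        G.potential e a = G.potential h a := by
  obtain ⟨d, rfl⟩ := Nat.exists_eq_add_of_le ht
  induction d generalizing h with
  | zero => exact ⟨h, hl, rfl, hv, fun _ => le_rfl, fun _ _ => rfl⟩
  | succ d ih =>
    have hh : h.length < n := by omega
    obtain ⟨h1, h2⟩ := hx ⟨h.length, hh⟩ le_rfl (by simp)
    obtain ⟨h3, h4⟩ := hσ.subset_out_of_not_mem hε hε2 hl (x := ⟨h.length, hh⟩) rfl (hcard _)
      (by rw [hv]; exact h1.symm) (by rw [hv]; exact h2)
    have hlen : (h ++ [σ h]).length = h.length + 1 := by simp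
    obtain ⟨e, e1, e2, e3, e4, e5⟩ := ih (hl.append hh (hσ.1 h hh hl))
      ((outcome_step σ hh).trans hv) (by omega) (by omega)
      fun x hx1 hx2 => hx x (by omega) (by omega)
    have pot (a) := G.potential_append (x := ⟨h.length, hh⟩) rfl (σ h) a
    refine ⟨e, e1, by omega, e3, fun a => (e4 a).trans ?_, fun a ha => ?_⟩
    · have := pot a
      by_cases hm : a ∈ σ h
      · simp only [hm, h3 hm, if_true] at this; omega
      · simp only [hm, if_false] at this; omega
    · rw [e5 a fun x hx1 hx2 => ha x (by omega) (by omega)]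
      have := pot a
      have ha' := ha ⟨h.length, hh⟩ le_rfl (by simp)
      by_cases hm : a ∈ G.out ⟨h.length, hh⟩
      · have : σ h = {a} := by
          have h5 := h4 ⟨a, hm⟩
          rw [ha' hm] at h3
          exact (Finset.subset_singleton_iff.mp h3).resolve_left h5.ne_empty
        have h6 : a ∈ σ h := by simp [this]
        have := pot a
        simp only [hm, h6, if_true] at this
        omega
      · have h6 : a ∉ σ h := fun h => hm (h3 h)
        simp only [hm, h6, if_false] at this
        omega

/-- In plurality voting, two agents cannot gain more votes than there are voters. -/
theorem score_steps_add_le {n : ℕ} {σ : Profile n} (hσ : VotingRule.plurality.LegalProfile σ)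
    {h : List (Ballot n)} (hl : VotingRule.plurality.LegalHistory h) {d : ℕ}
    (hd : h.length + d ≤ n) {a a' : Fin n} (hne : a ≠ a') :
    score (σ.steps d h) a + score (σ.steps d h) a' ≤ score h a + score h a' + d := by
  induction d generalizing h with
  | zero => exact le_rfl
  | succ d ih =>
    have hh : h.length < n := by omega
    have hB := hσ h hh hl
    have := ih (hl.append hh hB) (by simp; omega)
    rw [score_append, score_append] at this
    rw [Profile.steps]
    by_cases h1 : a ∈ σ h
    · have h2 : a' ∉ σ h := fun h2 => hne (Finset.card_le_one.mp hB.2 a h1 a' h2)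
      simp only [h1, h2, if_true, if_false] at this
      omega
    · simp only [h1, if_false] at this
      split_ifs at this <;> omega

theorem score_le_steps {n : ℕ} (σ : Profile n) (h : List (Ballot n)) (d : ℕ) (a : Fin n) :
    score h a ≤ score (σ.steps d h) a := by
  induction d generalizing h with
  | zero => exact le_rfl
  | succ d ih =>
    have := ih (h ++ [σ h])
    rw [score_append] at this
    rw [Profile.steps]
    omega

namespace IsLadder

variable {n m c : ℕ} {G : Network n} {w : Fin n} {b : ℕ → Fin n}

theorem b_ne_w (hL : IsLadder G m c w b) {i : ℕ} (hi : i ≤ m) : b i ≠ w := by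
  have h1 := hL.val_b i hi
  have h2 := hL.val_w
  intro e
  rw [e] at h1
  omega

theorem b_inj (hL : IsLadder G m c w b)
    {i j : ℕ} (hi : i ≤ m) (hj : j ≤ m) (h : b i = b j) : i = j := by
  have h1 := hL.val_b i hi
  have h2 := hL.val_b j hj
  rw [h] at h1
  omega

theorem b_lt (hL : IsLadder G m c w b) {i j : ℕ} (hi : i ≤ m) (hij : j < i) : b i < b j := by
  rw [Fin.lt_def, hL.val_b i hi, hL.val_b j (by omega)]
  omega

theorem out_b_succ (hL : IsLadder G m c w b) {i : ℕ} (hi : i < m) : G.out (b (i + 1)) = {b i} :=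
  hL.out_rung i hi.le _ (by rw [hL.val_b _ (by omega)]; omega)

/-- The agent `w` is the only member of the last block. -/
theorem block_cases (hL : IsLadder G m c w b) {j : ℕ} (hj : j ≤ m) {x : Fin n} (h1 : start m j ≤ x)
    (h2 : x < start m (j + 1)) :
    (j = m ∧ x = w ∧ G.out x = {b m}) ∨ (j < m ∧ (x : ℕ) < w ∧ G.out x = {w, b j}) := by
  have hw := hL.val_w
  rcases hj.eq_or_lt with rfl | hj
  · rw [start_succ] at h2
    obtain rfl : x = w := Fin.ext (by omega)
    exact Or.inl ⟨rfl, rfl, hL.out_w⟩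
  · have := start_mono m (show j + 1 ≤ m by omega)
    exact Or.inr ⟨hj, by omega, hL.out_block j hj x h1 h2⟩

theorem mem_out_block (hL : IsLadder G m c w b)
    {j l : ℕ} (hj : j ≤ m) (hl : l ≤ m) {x : Fin n} (h1 : start m j ≤ x)
    (h2 : x < start m (j + 1)) : b l ∈ G.out x ↔ l = j := by
  rcases hL.block_cases hj h1 h2 with ⟨rfl, -, e⟩ | ⟨h3, -, e⟩
  · rw [e, Finset.mem_singleton]
    exact ⟨fun h => hL.b_inj hl le_rfl h, fun h => by rw [h]⟩
  · simp only [e, Finset.mem_insert, Finset.mem_singleton, hL.b_ne_w hl, false_or]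
    exact ⟨fun h => hL.b_inj hl hj h, fun h => by rw [h]⟩

theorem card_out_le (hL : IsLadder G m c w b) (x : Fin n) : (G.out x).card ≤ 2 := by
  rcases lt_or_ge (start m m) x with hx | hx
  · rcases (G.out x).eq_empty_or_nonempty with e | ⟨a, ha⟩
    · simp [e]
    · simp [hL.out_single x a hx ha]
  · obtain ⟨j, hj, h1, h2⟩ := exists_block (m := m) (j := m + 1) (x := x)
      (by rw [start_succ]; omega)
    rcases hL.block_cases (by omega) h1 h2 with ⟨-, -, e⟩ | ⟨-, -, e⟩
    · simp [e]
    · rw [e]; exact Finset.card_le_two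

/-! #### Numbers of supporters -/

theorem lt_size (hL : IsLadder G m c w b) : start m m + m + 2 < n := by
  have := (b 0).2
  rw [hL.val_b 0 (by omega)] at this
  omega

theorem likersFrom_b (hL : IsLadder G m c w b) {l t : ℕ} (hl : l ≤ m) (ht : t ≤ start m m + 1) :
    G.likersFrom t (b l) = c + (start m (l + 1) - max t (start m l)) := by
  have hs := start_mono m (show l + 1 ≤ m + 1 by omega)
  rw [start_succ m m] at hs
  have hn := hL.lt_size
  obtain ⟨d, hd⟩ := Nat.exists_eq_add_of_le ht
  induction d generalizing t with
  | zero =>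
    rw [show t = start m m + 1 by omega, hL.likers_b l hl]
    omega
  | succ d ih =>
    have h1 := ih (t := t + 1) (by omega) (by omega)
    have h2 := G.likersFrom_eq ⟨t, by omega⟩ (b l)
    simp only at h2
    obtain ⟨j, hj, h3, h4⟩ := exists_block (m := m) (j := m + 1) (x := t)
      (by rw [start_succ]; omega)
    have h5 := hL.mem_out_block (x := ⟨t, by omega⟩) (show j ≤ m by omega) hl h3 h4
    rw [h2, h1]
    simp only [h5]
    split_ifs with e
    · subst e; omega
    · rcases lt_or_gt_of_ne e with e | e
      · have := start_mono m (show l + 1 ≤ j by omega)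
        omega
      · have := start_mono m (show j + 1 ≤ l by omega)
        omega

theorem likersFrom_b_of_le (hL : IsLadder G m c w b) {l t : ℕ} (hl : l ≤ m) (ht : t ≤ start m l) :
    G.likersFrom t (b l) = c + (m - l + 1) := by
  have := start_mono m hl
  rw [hL.likersFrom_b hl (by omega), start_succ]
  omega

theorem likersFrom_b_of_ge (hL : IsLadder G m c w b)
    {l t : ℕ} (hl : l ≤ m) (ht : start m (l + 1) ≤ t)
    (ht' : t ≤ start m m + 1) : G.likersFrom t (b l) = c := by
  have := start_mono m (show l ≤ l + 1 by omega)
  rw [hL.likersFrom_b hl ht']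
  omega

theorem likersFrom_w (hL : IsLadder G m c w b)
    {t : ℕ} (ht : t ≤ start m m) : G.likersFrom t w + t = c := by
  have hn := hL.lt_size
  have hw := hL.val_w
  obtain ⟨d, hd⟩ := Nat.exists_eq_add_of_le ht
  induction d generalizing t with
  | zero =>
    have h1 := hL.likers_w
    have h2 := G.likersFrom_eq w w
    simp only [G.not_mem_self, if_false, hw] at h2
    rw [show t = start m m by omega]
    omega
  | succ d ih =>
    have h1 := ih (t := t + 1) (by omega) (by omega)
    have h2 := G.likersFrom_eq ⟨t, by omega⟩ w
    obtain ⟨j, hj, h3, h4⟩ := exists_block (m := m) (j := m) (x := t) (by omega)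
    rw [hL.out_block j hj ⟨t, by omega⟩ h3 h4] at h2
    simp at h2
    omega

theorem potential_w_le (hL : IsLadder G m c w b) {h : List (Ballot n)} (hh : h.length ≤ start m m) :
    G.potential h w ≤ c := by
  have h1 := score_le_length h w
  have h2 := hL.likersFrom_w hh
  rw [Network.potential]
  omega

theorem popularity_b (hL : IsLadder G m c w b)
    {l : ℕ} (hl : l ≤ m) : G.popularity (b l) = c + (m - l + 1) := by
  rw [← G.likersFrom_zero, hL.likersFrom_b_of_le hl (by omega)]

theorem popularity_w (hL : IsLadder G m c w b) : G.popularity w = c := by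
  rw [← G.likersFrom_zero]
  exact hL.likersFrom_w (t := 0) (by omega)

theorem popularity_eq_zero (hL : IsLadder G m c w b)
    {a : Fin n} (h1 : a ≠ w) (h2 : ∀ i ≤ m, a ≠ b i) :
    G.popularity a = 0 := by
  rw [Network.popularity, Finset.card_eq_zero, Finset.filter_eq_empty_iff]
  intro x _ hx
  rcases hL.mem_out x a hx with e | ⟨i, hi, e⟩
  · exact h1 e
  · exact h2 i hi e

theorem popularity_le (hL : IsLadder G m c w b) (a : Fin n) : G.popularity a ≤ c + (m + 1) := by
  by_cases h1 : a = w
  · rw [h1, hL.popularity_w]; omega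
  by_cases h2 : ∃ i ≤ m, a = b i
  · obtain ⟨i, hi, rfl⟩ := h2
    rw [hL.popularity_b hi]; omega
  · push Not at h2
    rw [hL.popularity_eq_zero h1 h2]; omega

theorem maxIn_eq (hL : IsLadder G m c w b) : G.maxIn = c + (m + 1) := by
  refine le_antisymm (Finset.sup_le fun a _ => hL.popularity_le a) ?_
  have := hL.popularity_b (l := 0) (by omega)
  rw [← Nat.sub_zero m, ← this]
  exact Finset.le_sup (f := G.popularity) (Finset.mem_univ (b 0))

theorem agentGap_w (hL : IsLadder G m c w b) : G.agentGap w = m + 1 := by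
  have h1 : ∀ a, (G.removeOut w).popularity a ≤ G.popularity a := fun a => by
    refine Finset.card_le_card fun x hx => ?_
    rw [Finset.mem_filter] at hx ⊢
    simp only [Network.removeOut] at hx
    split_ifs at hx
    · simp at hx
    · exact hx
  have h2 : (G.removeOut w).popularity (b 0) = G.popularity (b 0) := by
    unfold Network.popularity
    congr 1
    ext x
    rw [Finset.mem_filter, Finset.mem_filter]
    simp only [Network.removeOut]
    split_ifs with e
    · have : b 0 ∉ G.out w := by
        rw [hL.out_w, Finset.mem_singleton]
        intro e
        have := hL.b_inj (by omega) le_rfl e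
        have := hL.pos
        omega
      simp [e, this]
    · rfl
  have h3 : (G.removeOut w).maxIn = c + (m + 1) := by
    refine le_antisymm (Finset.sup_le fun a _ => (h1 a).trans (hL.popularity_le a)) ?_
    have := hL.popularity_b (l := 0) (by omega)
    rw [← Nat.sub_zero m, ← this, ← h2]
    exact Finset.le_sup (f := (G.removeOut w).popularity) (Finset.mem_univ (b 0))
  rw [Network.agentGap, h3, hL.popularity_w]
  push_cast
  ring

theorem maxOut_eq (hL : IsLadder G m c w b) : G.maxOut = 2 := by
  refine le_antisymm (Finset.sup_le fun x _ => hL.card_out_le x) ?_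
  have hn := hL.lt_size
  have h : G.out ⟨0, by omega⟩ = {w, b 0} :=
    hL.out_block 0 hL.pos _ (by simp [start]) (by simp [start])
  have hc : (G.out ⟨0, by omega⟩).card = 2 := by
    rw [h, Finset.card_pair (hL.b_ne_w (by omega)).symm]
  rw [← hc]
  exact Finset.le_sup (f := fun x => (G.out x).card) (Finset.mem_univ _)

variable [NeZero n] {ε : ℝ} {σ : Profile n} {h : List (Ballot n)}

/-! #### Comparison of candidates -/

/-- A candidate whose supporters are devoted is ahead of those who are not candidates. -/
theorem le_of_outcome_not_candidate (hL : IsLadder G m c w b) (hσ : G.IsSPE .plurality ε σ)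
    (hε : 0 < ε) (hε2 : ε < 1 / 2) (hl : VotingRule.plurality.LegalHistory h) {a : Fin n} {t : ℕ}
    (ht : h.length ≤ t) (ht' : start m m < t) (ha : a = w ∨ ∃ i ≤ m, a = b i)
    (h1 : σ.outcome h ≠ w) (h2 : ∀ i ≤ m, σ.outcome h ≠ b i) :
    score h a + G.likersFrom t a ≤ h.length + 1 := by
  have hne : a ≠ σ.outcome h := by
    rcases ha with rfl | ⟨i, hi, rfl⟩
    · exact h1.symm
    · exact (h2 i hi).symm
  have h3 := hσ.score_add_le_plurality hε hε2 hL.card_out_le hl rfl hne ht {σ.outcome h}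
    fun x hx hm hxs => ⟨hL.out_single x a (by omega) hm, by simpa using hxs⟩
  have h4 : G.likersFrom h.length (σ.outcome h) = 0 := by
    rw [Network.likersFrom, Finset.card_eq_zero, Finset.filter_eq_empty_iff]
    rintro x - ⟨-, hx⟩
    rcases hL.mem_out x _ hx with e | ⟨i, hi, e⟩
    · exact h1 e
    · exact h2 i hi e
  have h5 := score_le_length h (σ.outcome h)
  rw [Network.potential, h4, Finset.card_singleton] at h3
  omega

theorem outcome_cases (hL : IsLadder G m c w b) (hσ : G.IsSPE .plurality ε σ) (hε : 0 < ε)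
    (hε2 : ε < 1 / 2) (hl : VotingRule.plurality.LegalHistory h)
    (hh : h.length ≤ start m m + 1) : σ.outcome h = w ∨ ∃ i ≤ m, σ.outcome h = b i := by
  by_contra hc
  push Not at hc
  have h1 := hL.le_of_outcome_not_candidate hσ hε hε2 hl hh (by omega)
    (Or.inr ⟨0, by omega, rfl⟩) hc.1 hc.2
  have h2 := hL.likers_b 0 (by omega)
  have h3 := hL.large
  omega

theorem score_add_le (hL : IsLadder G m c w b) (hσ : G.IsSPE .plurality ε σ) (hε : 0 < ε)
    (hε2 : ε < 1 / 2) (hl : VotingRule.plurality.LegalHistory h) (hh : h.length ≤ start m m + 1)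
    {i : ℕ} (hi : i ≤ m) {v : Fin n} (hv : σ.outcome h = v) (hne : b i ≠ v)
    (hne' : i < m → b (i + 1) ≠ v) :
    score h (b i) + c + (if b i < v then 1 else 0) ≤ G.potential h v := by
  have h1 := hσ.score_add_le_plurality hε hε2 hL.card_out_le hl hv hne hh ∅ fun x hx hm _ => by
    refine ⟨hL.out_single x _ (by omega) hm, ?_⟩
    rintro rfl
    rcases hL.outcome_cases hσ hε hε2 hl hh with e | ⟨j, hj, e⟩
    · rw [hv] at e
      have := hL.val_w
      rw [e] at hx
      omega
    · rw [hv] at e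
      rw [e] at hm
      rcases j with _ | j
      · simp [hL.out_b_zero] at hm
      · rw [hL.out_b_succ (i := j) (by omega), Finset.mem_singleton] at hm
        obtain rfl := hL.b_inj hi (by omega) hm
        exact hne' (by omega) e.symm
  rw [hL.likers_b i hi, Finset.card_empty] at h1
  omega

theorem potential_add_le (hL : IsLadder G m c w b) (hσ : G.IsSPE .plurality ε σ) (hε : 0 < ε)
    (hε2 : ε < 1 / 2) (hl : VotingRule.plurality.LegalHistory h)
    (hh : h.length ≤ start m m + 1) {i : ℕ} (hi : i ≤ m) (hs : start m (i + 1) ≤ h.length)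
    {v : Fin n} (hv : σ.outcome h = v) (hne : b i ≠ v) (hne' : i < m → b (i + 1) ≠ v) :
    G.potential h (b i) + (if b i < v then 1 else 0) ≤ G.potential h v := by
  have := hL.score_add_le hσ hε hε2 hl hh hi hv hne hne'
  rw [Network.potential, hL.likersFrom_b_of_ge hi hs hh]
  exact this

/-! #### Coalitions of a block -/

/-- The members of the block number `j` can enforce that `w` or `b j` is elected if their joint
support for `b j` has this effect. -/
theorem exists_coalition (hL : IsLadder G m c w b) (hσ : G.IsSPE .plurality ε σ) (hε : 0 < ε)
    (hn : ε < 1 / (2 * (n : ℝ))) (hε2 : ε < 1 / 2)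
    (hl : VotingRule.plurality.LegalHistory h) {j : ℕ} (hj : j ≤ m)
    (h1 : start m j ≤ h.length) (h2 : h.length ≤ start m (j + 1)) :
    ∃ g, VotingRule.plurality.LegalHistory g ∧ g.length = start m (j + 1) ∧
      (∀ l ≤ m, G.potential g (b l) = G.potential h (b l)) ∧
      G.potential g w ≤ G.potential h w ∧
      (σ.outcome g = w ∨ σ.outcome g = b j → σ.outcome h = w ∨ σ.outcome h = b j) := by
  have hs := start_mono m (show j + 1 ≤ m + 1 by omega)
  rw [start_succ m m] at hs
  have hlt := hL.lt_size
  obtain ⟨d, hd⟩ := Nat.exists_eq_add_of_le h2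
  induction d generalizing h with
  | zero => exact ⟨h, hl, hd.symm, fun _ _ => rfl, le_rfl, id⟩
  | succ d ih =>
    have hh : h.length < n := by omega
    have hx := hL.block_cases hj (x := ⟨h.length, hh⟩) h1 (by simp only; omega)
    have hm (l) (hl : l ≤ m) := hL.mem_out_block hj hl (x := ⟨h.length, hh⟩) h1
      (by simp only; omega)
    have hB : VotingRule.plurality.Legal ⟨h.length, hh⟩ {b j} := by
      refine ⟨?_, by simp⟩
      intro e
      rw [Finset.mem_singleton] at e
      have := hL.val_b j hj
      rw [← e] at this
      simp only at this
      omega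
    have hlen : (h ++ [{b j}]).length = h.length + 1 := by simp
    obtain ⟨g, g1, g2, g3, g4, g5⟩ := ih (hl.append hh hB) (by omega) (by omega) (by omega)
    have pot (a) := G.potential_append (x := ⟨h.length, hh⟩) rfl {b j} a
    refine ⟨g, g1, g2, fun l hl => ?_, ?_, fun ho => ?_⟩
    · rw [g3 l hl]
      have := pot (b l)
      simp only [hm l hl, Finset.mem_singleton] at this
      by_cases e : l = j
      · simp only [e, if_true] at this ⊢; omega
      · have e' : b l ≠ b j := fun e' => e (hL.b_inj hl hj e')
        simp only [e, e', if_false] at this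
        omega
    · have := pot w
      simp only [Finset.mem_singleton, (hL.b_ne_w hj).symm, if_false] at this
      omega
    · rcases hx with ⟨rfl, hxw, hout⟩ | ⟨hjm, hlt, hout⟩
      · rcases g5 ho with e | e
        · exact Or.inl ((hσ.outcome_eq_self hε hn hl (x := ⟨h.length, hh⟩) rfl hB
            (e.trans hxw.symm)).trans hxw)
        · have := hσ.outcome_mem hε hn hl (x := ⟨h.length, hh⟩) rfl hB (by rw [e, hout]; simp)
          rwa [hout, Finset.mem_singleton, hxw] at this
      · have := hσ.outcome_mem hε hn hl (x := ⟨h.length, hh⟩) rfl hB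
          (by rcases g5 ho with e | e <;> rw [e, hout] <;> simp)
        rw [hout, Finset.mem_insert, Finset.mem_singleton] at this
        refine this.resolve_left fun e => ?_
        have hw := hL.val_w
        simp only at hlt
        rcases hL.outcome_cases hσ hε hε2 hl (by omega) with e' | ⟨i, hi, e'⟩
        · rw [e'] at e
          have := congrArg Fin.val e
          simp only at this
          omega
        · have := hL.val_b i hi
          rw [← e', e] at this
          simp only at this
          omega

/-! #### Popular candidates high on the ladder prevent the election of the lower ones -/

/-- If `b l₀` is going to be elected, the members of a later block vote without affecting the
potentials of the other candidates `b l`. -/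
theorem exists_path_block (hL : IsLadder G m c w b) (hσ : G.IsSPE .plurality ε σ) (hε : 0 < ε)
    (hε2 : ε < 1 / 2) (hl : VotingRule.plurality.LegalHistory h) {j l₀ : ℕ} (hj : j ≤ m)
    (hl₀ : l₀ < j) (hh : h.length = start m j) (hv : σ.outcome h = b l₀) :
    ∃ e, VotingRule.plurality.LegalHistory e ∧ e.length = start m (j + 1) ∧
      σ.outcome e = b l₀ ∧ ∀ l ≤ m, l ≠ j → G.potential e (b l) = G.potential h (b l) := by
  have hs := start_mono m (show j + 1 ≤ m + 1 by omega)
  rw [start_succ m m] at hs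
  have hs' := start_mono m (show j ≤ j + 1 by omega)
  have hlt := hL.lt_size
  obtain ⟨e, e1, e2, e3, -, e5⟩ := hσ.exists_sincere_path hε hε2 hL.card_out_le hl hv
    (t := start m (j + 1)) (by omega) (by omega) fun x hx1 hx2 => by
      refine ⟨?_, ?_⟩
      · rintro rfl
        have := hL.val_b l₀ (by omega)
        omega
      · rw [hL.mem_out_block hj (by omega) (by omega) hx2]
        omega
  refine ⟨e, e1, e2, e3, fun l hl hne => e5 _ fun x hx1 hx2 hm => ?_⟩
  rw [hL.mem_out_block hj hl (by omega) hx2] at hm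
  exact absurd hm hne

/-- If some `b l` with `l > i` has at least the potential of each of `b 0, …, b i`, then none of
these is elected. -/
theorem outcome_ne_of_potential_le (hL : IsLadder G m c w b) (hσ : G.IsSPE .plurality ε σ)
    (hε : 0 < ε) (hn : ε < 1 / (2 * (n : ℝ))) (hε2 : ε < 1 / 2)
    {i j : ℕ} (hij : i < j) (hj : j ≤ m + 1)
    (hl : VotingRule.plurality.LegalHistory h) (hh : h.length = start m j) {p l : ℕ} (hp : p ≤ i)
    (hmax : ∀ l' ≤ i, G.potential h (b l') ≤ G.potential h (b p)) (hil : i < l) (hlm : l ≤ m)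
    (hle : G.potential h (b p) ≤ G.potential h (b l)) {l₀ : ℕ} (hl₀ : l₀ ≤ i) :
    σ.outcome h ≠ b l₀ := by
  obtain ⟨d, hd⟩ := Nat.exists_eq_add_of_le hj
  induction d generalizing h j l l₀ with
  | zero =>
    intro hv
    obtain rfl : j = m + 1 := by omega
    have hs := start_mono m (show l + 1 ≤ m + 1 by omega)
    have hs' := start_succ m m
    have := hL.potential_add_le hσ hε hε2 hl (by omega) hlm (by omega) hv
      (fun e => by have := hL.b_inj hlm (by omega) e; omega)
      (fun hlm' e => by have := hL.b_inj (by omega) (by omega) e; omega)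
    rw [if_pos (hL.b_lt hlm (by omega))] at this
    have := hmax l₀ hl₀
    omega
  | succ d ih =>
    intro hv
    have hjm : j ≤ m := by omega
    obtain ⟨e, e1, e2, e3, e4⟩ := hL.exists_path_block hσ hε hε2 hl hjm (by omega) hh hv
    by_cases hw : ∃ l ≤ m, l ≠ j ∧ i < l ∧ G.potential h (b p) ≤ G.potential h (b l)
    · obtain ⟨l, hlm, hlj, hil, hle⟩ := hw
      refine ih (by omega) (by omega) e1 e2 (fun l' hl' => ?_) hil hlm ?_ hl₀ (by omega) e3
      · rw [e4 l' (by omega) (by omega), e4 p (by omega) (by omega)]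
        exact hmax l' hl'
      · rw [e4 l hlm hlj, e4 p (by omega) (by omega)]
        exact hle
    · push Not at hw
      obtain rfl : l = j := by
        by_contra hlj
        exact absurd hle (not_le.mpr (hw l hlm hlj hil))
      have hs := start_mono m (show l + 1 ≤ m + 1 by omega)
      have hs' := start_succ m m
      obtain ⟨g, g1, g2, g3, -, g5⟩ := hL.exists_coalition hσ hε hn hε2 hl hjm hh.ge
        (by rw [hh]; exact start_mono m (by omega))
      have hg : ∀ l' ≤ i, σ.outcome g ≠ b l' := fun l' hl' => by
        refine ih (l := l) (by omega) (by omega) g1 g2 (fun l'' hl'' => ?_) hil hlm ?_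
          hl' (by omega)
        · rw [g3 l'' (by omega), g3 p (by omega)]
          exact hmax l'' hl''
        · rw [g3 l hlm, g3 p (by omega)]
          exact hle
      have hgl : σ.outcome g = w ∨ σ.outcome g = b l := by
        rcases hL.outcome_cases hσ hε hε2 g1 (by omega) with e | ⟨l', hl', e⟩
        · exact Or.inl e
        rcases le_or_gt l' i with hl'i | hl'i
        · exact absurd e (hg l' hl'i)
        by_cases hne : l' = l
        · exact Or.inr (hne ▸ e)
        have h1 := hw l' hl' hne hl'i
        rw [← g3 l' hl', ← g3 p (by omega)] at h1
        rw [← g3 p (by omega), ← g3 l hlm] at hle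
        by_cases hne' : l' = l + 1
        · have := hL.potential_add_le hσ hε hε2 g1 (by omega) (i := p) (by omega)
            (by rw [g2]; exact start_mono m (by omega)) e
            (fun e => by have := hL.b_inj (by omega) hl' e; omega)
            (fun _ e => by have := hL.b_inj (by omega) hl' e; omega)
          omega
        · have := hL.potential_add_le hσ hε hε2 g1 (by omega) (i := l) (by omega) g2.ge e
            (fun e => by have := hL.b_inj (by omega) hl' e; omega)
            (fun _ e => by have := hL.b_inj (by omega) hl' e; omega)
          omega
      rcases g5 hgl with e | e
      · exact hL.b_ne_w (by omega) (hv.symm.trans e)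
      · have := hL.b_inj (by omega) hlm (hv.symm.trans e)
        omega

/-! #### Defection from the support of `w` -/

/-- The agent `b (i + 1)` prevents the election of `b i` if he is behind by only one vote and the
others are further behind. -/
theorem outcome_ne_of_potential_succ (hL : IsLadder G m c w b) (hσ : G.IsSPE .plurality ε σ)
    (hε : 0 < ε) (hn : ε < 1 / (2 * (n : ℝ))) (hε2 : ε < 1 / 2) {i : ℕ} (him : i < m)
    (hl : VotingRule.plurality.LegalHistory h) (hh : h.length = start m (i + 2))
    (h1 : G.potential h (b i) ≤ G.potential h (b (i + 1)) + 1)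
    (h2 : c + 2 ≤ G.potential h (b i)) (h3 : G.potential h w ≤ c)
    (h4 : ∀ l ≤ m, l ≠ i → l ≠ i + 1 → G.potential h (b l) + 1 < G.potential h (b i)) :
    σ.outcome h ≠ b i := by
  intro hv
  have hlt := hL.lt_size
  have hb := hL.val_b (i + 1) (by omega)
  have hb' := hL.val_b i (by omega)
  have hs := start_mono m (show i + 2 ≤ m + 1 by omega)
  have hs' := start_succ m m
  have hbefore : ∀ x : Fin n, h.length ≤ x → x < b (i + 1) → ∀ l ≤ m, l ≤ i + 1 →
      b l ∈ G.out x → i < l ∧ G.out x = {b l} := by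
    intro x hx1 hx2 l hlm hli hm
    rw [Fin.lt_def] at hx2
    rcases lt_or_ge (start m m) x with hx | hx
    · obtain ⟨p, hp⟩ : ∃ p, (x : ℕ) = start m m + 1 + (m - p) ∧ i < p ∧ p ≤ m :=
        ⟨start m m + 1 + m - x, by omega, by omega, by omega⟩
      have hout := hL.out_rung p hp.2.2 x hp.1
      rw [hout, Finset.mem_singleton] at hm
      obtain rfl := hL.b_inj hlm hp.2.2 hm
      exact ⟨hp.2.1, hout⟩
    · obtain ⟨j, hj, h3, h4⟩ := exists_block (m := m) (j := m + 1) (x := x) (by omega)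
      rw [hL.mem_out_block (by omega) hlm h3 h4] at hm
      have := start_mono m (show j + 1 ≤ i + 2 by omega)
      omega
  obtain ⟨e, e1, e2, e3, e4, e5⟩ := hσ.exists_sincere_path hε hε2 hL.card_out_le hl hv
    (t := b (i + 1)) (by omega) (b (i + 1)).2.le fun x hx1 hx2 => by
      exact ⟨by rintro rfl; omega, fun hm => by
        have := (hbefore x hx1 hx2 i (by omega) (by omega) hm).1; omega⟩
  have e6 : G.potential e (b (i + 1)) = G.potential h (b (i + 1)) := e5 _ fun x hx1 hx2 hm =>
    (hbefore x hx1 hx2 (i + 1) (by omega) le_rfl hm).2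
  have hne := hL.b_inj (i := i) (j := i + 1) (by omega) (by omega)
  have hself : σ.outcome e = b (i + 1) := by
    refine hσ.outcome_eq_self hε hn e1 e2 (VotingRule.legal_empty _ _) ?_
    have f1 := e1.append_of_eq e2 (VotingRule.legal_empty _ _)
    have flen : (e ++ [∅]).length = start m m + 2 + (m - (i + 1)) + 1 := by simp; omega
    have pot (a) := G.potential_append e2 ∅ a
    rw [hL.out_b_succ him] at pot
    simp only [Finset.mem_singleton, Finset.notMem_empty, if_false, add_zero] at pot
    have p1 := pot (b (i + 1))
    rw [if_neg (fun e => by have := hne e.symm; omega)] at p1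
    have p2 := pot (b i)
    rw [if_pos rfl] at p2
    have pw := pot w
    rw [if_neg (hL.b_ne_w (by omega)).symm] at pw
    have q2 := e4 (b i)
    have qw := e4 w
    set f := e ++ [∅]
    by_contra hc
    have hlarge := hL.large
    have hcand : ∃ l ≤ m, σ.outcome f = b l ∨ σ.outcome f = w := by
      by_contra hcand
      push Not at hcand
      have := hL.le_of_outcome_not_candidate hσ hε hε2 f1 le_rfl (by omega)
        (Or.inr ⟨i + 1, by omega, rfl⟩) (hcand 0 (by omega)).2 fun l hl => (hcand l hl).1
      rw [Network.potential] at p1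
      omega
    obtain ⟨l, hl, hcand⟩ := hcand
    have key := hσ.score_add_le_plurality hε hε2 hL.card_out_le f1 rfl (Ne.symm hc) le_rfl ∅
      fun x hx1 hm hx2 => by
        refine ⟨hL.out_single x _ (by omega) hm, ?_⟩
        rintro rfl
        have hvb := hL.val_b l hl
        have hvw := hL.val_w
        rcases hcand with e' | e'
        · rw [e'] at hm hx1
          rcases l with _ | l
          · simp [hL.out_b_zero] at hm
          · rw [hL.out_b_succ (by omega), Finset.mem_singleton] at hm
            have := hL.b_inj (by omega) (by omega) hm
            omega
        · rw [e'] at hx1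
          omega
    rw [Finset.card_empty] at key
    change G.potential f (b (i + 1)) + _ ≤ _ at key
    rcases hcand with e' | e'
    · rw [e'] at key hc
      by_cases hli : l = i
      · subst hli
        rw [if_pos (hL.b_lt (by omega) (by omega))] at key
        omega
      · have hli' : l ≠ i + 1 := fun e => hc (by rw [e])
        have := h4 l hl hli hli'
        have := e4 (b l)
        have := pot (b l)
        omega
    · rw [e'] at key
      omega
  rw [e3] at hself
  have := hne hself
  omega

theorem outcome_ne_of_defection (hL : IsLadder G m c w b) (hσ : G.IsSPE .plurality ε σ) (hε : 0 < ε)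
    (hn : ε < 1 / (2 * (n : ℝ))) (hε2 : ε < 1 / 2) {i : ℕ} (him : i < m)
    (h1 : start m i ≤ h.length) (h2 : h.length < start m (i + 1))
    (h3 : ∀ l ≤ m, score h (b l) = 0) (h4 : VotingRule.plurality.LegalHistory (h ++ [{b i}])) :
    σ.outcome (h ++ [{b i}]) ≠ w ∧ σ.outcome (h ++ [{b i}]) ≠ b i := by
  have hlt := hL.lt_size
  have hs := start_mono m (show i + 1 ≤ m by omega)
  have hlen : (h ++ [{b i}]).length = h.length + 1 := by simp
  have sc : ∀ l ≤ m, score (h ++ [{b i}]) (b l) = if l = i then 1 else 0 := fun l hl => by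
    rw [score_append, h3 l hl, zero_add]
    exact if_congr (Finset.mem_singleton.trans ⟨hL.b_inj hl (by omega), fun e => by rw [e]⟩) rfl rfl
  have sci := sc i (by omega)
  rw [if_pos rfl] at sci
  refine ⟨fun e => ?_, fun e => ?_⟩
  · have := hL.score_add_le hσ hε hε2 h4 (by omega) (i := i) (by omega) e (hL.b_ne_w (by omega))
      fun _ => hL.b_ne_w (by omega)
    have := hL.potential_w_le (h := h ++ [{b i}]) (by omega)
    omega
  obtain ⟨d, hd⟩ := Nat.exists_eq_add_of_le (show (h ++ [{b i}]).length ≤ start m (i + 1) by omega)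
  have hstart := start_succ m i
  have hstart' := start_succ m (i + 1)
  have g1 := h4.steps hσ.1 (m := d) (by omega)
  have g2 := Profile.length_steps σ d (h ++ [{b i}])
  have g3 := Network.outcome_steps σ (h := h ++ [{b i}]) (m := d) (by omega)
  have g4 : ∀ l ≤ m, l ≠ i → score (σ.steps d (h ++ [{b i}])) (b i) +
      score (σ.steps d (h ++ [{b i}])) (b l) ≤ d + 1 := fun l hl hli => by
    have := score_steps_add_le hσ.1 h4 (d := d) (by omega)
      (a := b i) (a' := b l) (fun e => hli (hL.b_inj (by omega) hl e).symm)
    rw [sc l hl, if_neg hli] at this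
    omega
  have g5 := score_le_steps σ (h ++ [{b i}]) d (b i)
  rw [e] at g3
  rw [← hd] at g2
  generalize σ.steps d (h ++ [{b i}]) = g at g1 g2 g3 g4 g5
  have pot_le : ∀ l ≤ i, G.potential g (b l) = score g (b l) + c := fun l hl => by
    rw [Network.potential, hL.likersFrom_b_of_ge (by omega)
      (by rw [g2]; exact start_mono m (by omega)) (by omega)]
  have pot_gt : ∀ l ≤ m, i < l → G.potential g (b l) = score g (b l) + c + (m - l + 1) :=
    fun l hl hil => by
      rw [Network.potential, hL.likersFrom_b_of_le (by omega)
        (by rw [g2]; exact start_mono m (by omega))]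
      omega
  by_cases hcase : ∀ l ≤ i, score g (b l) ≤ m - i
  · obtain ⟨p, hp, hmax⟩ := Finset.exists_max_image (Finset.range (i + 1))
      (fun l => G.potential g (b l)) ⟨0, by simp⟩
    simp only [Finset.mem_range] at hp hmax
    refine hL.outcome_ne_of_potential_le hσ hε hn hε2 (i := i) (j := i + 1) (by omega) (by omega)
      g1 g2 (p := p) (l := i + 1) (by omega) (fun l hl => hmax l (by omega)) (by omega) (by omega)
      ?_ le_rfl g3
    rw [pot_le p (by omega), pot_gt (i + 1) (by omega) (by omega)]
    have := hcase p (by omega)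
    omega
  · push Not at hcase
    obtain ⟨p, hp, hp'⟩ := hcase
    obtain rfl : p = i := by
      by_contra hne
      have := g4 p (by omega) hne
      omega
    have hs' := start_mono m (show p + 1 + 1 ≤ m + 1 by omega)
    have hsm := start_succ m m
    have hzero : ∀ l ≤ m, l ≠ p → score g (b l) = 0 := fun l hl hne => by
      have := g4 l hl hne
      omega
    have hval : score g (b p) = m - p + 1 := by
      have := g4 (p + 1) (by omega) (by omega)
      omega
    obtain ⟨f, f1, f2, f3, f4, f5⟩ := hL.exists_coalition hσ hε hn hε2 g1 (j := p + 1) (by omega)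
      g2.ge (by rw [g2]; exact start_mono m (by omega))
    have fp : ∀ l ≤ m, l ≠ p → l ≠ p + 1 →
        G.potential f (b l) + 1 < G.potential f (b p) := fun l hl h1 h2 => by
      rw [f3 l hl, f3 p (by omega), pot_le p le_rfl]
      rcases lt_or_gt_of_ne h1 with h | h
      · rw [pot_le l h.le, hzero l hl h1]; omega
      · rw [pot_gt l hl h, hzero l hl h1]; omega
    have fne : σ.outcome f ≠ b p := by
      refine hL.outcome_ne_of_potential_succ hσ hε hn hε2 him f1 f2 ?_ ?_ ?_ fp
      · rw [f3 p (by omega), f3 (p + 1) (by omega), pot_le p le_rfl,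
          pot_gt (p + 1) (by omega) (by omega)]
        omega
      · rw [f3 p (by omega), pot_le p le_rfl]
        omega
      · exact f4.trans (hL.potential_w_le (by omega))
    have : σ.outcome g = w ∨ σ.outcome g = b (p + 1) := by
      refine f5 ?_
      rcases hL.outcome_cases hσ hε hε2 f1 (by omega) with e' | ⟨l, hl, e'⟩
      · exact Or.inl e'
      by_cases h1 : l = p
      · exact absurd (h1 ▸ e') fne
      by_cases h2 : l = p + 1
      · exact Or.inr (h2 ▸ e')
      have h5 := hL.potential_add_le hσ hε hε2 f1 (by omega) (i := p) (by omega)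
        (by rw [f2]; exact start_mono m (by omega)) e'
        (fun e => h1 (hL.b_inj (by omega) hl e).symm)
        (fun _ e => h2 (hL.b_inj (by omega) hl e).symm)
      have := fp l hl h1 h2
      omega
    rw [g3] at this
    rcases this with e' | e'
    · exact hL.b_ne_w (by omega) e'
    · have := hL.b_inj (by omega) (by omega) e'
      omega

/-! #### The equilibrium path -/

/-- If all agents before `w` have voted for `w` so far, then `w` is elected. -/
theorem outcome_eq_w_of_path (hL : IsLadder G m c w b) (hσ : G.IsSPE .plurality ε σ) (hε : 0 < ε)
    (hn : ε < 1 / (2 * (n : ℝ))) (hε2 : ε < 1 / 2) (hl : VotingRule.plurality.LegalHistory h)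
    (hh : h.length ≤ start m m) (hw : score h w = h.length) (hb : ∀ l ≤ m, score h (b l) = 0) :
    σ.outcome h = w := by
  have hlt := hL.lt_size
  obtain ⟨d, hd⟩ := Nat.exists_eq_add_of_le hh
  induction d generalizing h with
  | zero =>
    have hx : h.length = w := by rw [hL.val_w]; omega
    refine hσ.outcome_eq_self hε hn hl hx (VotingRule.legal_empty _ _) ?_
    have hl' := hl.append_of_eq hx (VotingRule.legal_empty _ _)
    have hlen : (h ++ [∅]).length = start m m + 1 := by simp; omega
    have sc (a) := score_append h ∅ a
    simp only [Finset.notMem_empty, if_false, add_zero] at sc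
    rcases hL.outcome_cases hσ hε hε2 hl' (by omega) with e | ⟨l, hl, e⟩
    · exact e
    have h1 := hσ.score_add_le_plurality hε hε2 hL.card_out_le hl' e (hL.b_ne_w hl).symm hlen.le ∅
      fun x hx hm _ => by
        refine ⟨hL.out_single x _ (by omega) hm, ?_⟩
        rintro rfl
        rcases l with _ | l
        · simp [hL.out_b_zero] at hm
        · rw [hL.out_b_succ (by omega), Finset.mem_singleton] at hm
          exact hL.b_ne_w (by omega) hm.symm
    have h2 := hL.likers_w
    have h3 := hL.likers_b l hl
    have h4 := hL.val_b l hl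
    have h5 := hL.val_w
    rw [sc, hw, Network.potential, sc, hb l hl, hlen, h3,
      if_pos (by rw [Fin.lt_def]; omega), Finset.card_empty] at h1
    omega
  | succ d ih =>
    have hvw := hL.val_w
    obtain ⟨i, him, h1, h2⟩ := exists_block (m := m) (j := m) (x := h.length) (by omega)
    have hout := hL.out_block i him ⟨h.length, by omega⟩ h1 h2
    refine hσ.outcome_eq_of_cooperate hε hn hε2 hl (x := ⟨h.length, by omega⟩) rfl hout ?_ ?_ ?_
    · intro e
      rcases hL.outcome_cases hσ hε hε2 hl (by omega) with e' | ⟨l, hl, e'⟩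
      · rw [e', Fin.ext_iff] at e
        simp only at e
        omega
      · rw [e', Fin.ext_iff] at e
        have := hL.val_b l hl
        simp only at e
        omega
    · have hB : VotingRule.plurality.Legal ⟨h.length, by omega⟩ {w} := by
        refine ⟨fun e => ?_, by simp⟩
        rw [Finset.mem_singleton, Fin.ext_iff] at e
        simp only at e
        omega
      refine ih (hl.append_of_eq rfl hB) (by simp; omega) (by simp [score_append, hw])
        (fun l hl => ?_) (by simp; omega)
      simp [score_append, hb l hl, hL.b_ne_w hl]
    · intro B hB hm _
      obtain rfl : B = {b i} :=
        Finset.eq_singleton_iff_unique_mem.mpr ⟨hm, fun y hy =>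
          Finset.card_le_one.mp hB.2 y hy _ hm⟩
      exact hL.outcome_ne_of_defection hσ hε hn hε2 him h1 h2 hb (hl.append_of_eq rfl hB)

end IsLadder

/-- In a ladder network, plurality voting always elects `w`. -/
theorem IsLadder.achievable_eq {n m c : ℕ} [NeZero n] {G : Network n} {w : Fin n} {b : ℕ → Fin n}
    {ε : ℝ} (hL : IsLadder G m c w b) (hε : 0 < ε) (hn : ε < 1 / (2 * (n : ℝ))) :
    G.achievable .plurality ε = {w} :=
  Network.achievable_eq_singleton _ _ _ fun _ hσ =>
    hL.outcome_eq_w_of_path hσ hε hn (lt_half_of_lt hn) (VotingRule.legalHistory_nil _)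
      (by simp) rfl fun _ _ => rfl

/-! ### The network for plurality voting -/

namespace PluralityNet

/-- The number of agents up to the last candidate. -/
def base (m : ℕ) : ℕ := start m m + m + 3

/-- The number of agents. -/
def size (m : ℕ) : ℕ := base m + (m + 1) * (base m + 2) + (m + 6)

instance (m : ℕ) : NeZero (size m) := ⟨by unfold size; omega⟩

/-- Agent `x` confirms agent `a`. The candidates are `start m m` and the agents from `start m m + 2`
to `base m - 1`; from `base m` on, the agents confirm one candidate each, in groups of
`base m + 2`, and are confirmed by nobody. -/
def Likes (m x a : ℕ) : Prop :=
  (x < start m m ∧ a = start m m) ∨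
  (∃ i < m, start m i ≤ x ∧ x < start m (i + 1) ∧ a = start m m + 2 + (m - i)) ∨
  (x = start m m ∧ a = start m m + 2) ∨
  (start m m < x ∧ x + 1 < base m ∧ a = x + 1) ∨
  (base m ≤ x ∧ x < base m + (m + 1) * (base m + 2) ∧
    a = start m m + 2 + (m - (x - base m) / (base m + 2))) ∨
  (base m + (m + 1) * (base m + 2) ≤ x ∧ a = start m m)

theorem base_lt_size (m : ℕ) : base m < size m := by unfold size; omega

theorem likes_block {m i x a : ℕ} (hi : i < m) (h1 : start m i ≤ x) (h2 : x < start m (i + 1)) :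
    Likes m x a ↔ a = start m m ∨ a = start m m + 2 + (m - i) := by
  have h3 := start_mono m (show i + 1 ≤ m by omega)
  have h4 : base m = start m m + m + 3 := rfl
  constructor
  · rintro (h | ⟨j, hj, h5, h6, h7⟩ | h | h | h | h)
    · exact Or.inl h.2
    · rcases lt_trichotomy i j with h | rfl | h
      · have := start_mono m (show i + 1 ≤ j by omega); omega
      · exact Or.inr h7
      · have := start_mono m (show j + 1 ≤ i by omega); omega
    all_goals omega
  · rintro (h | h)
    · exact Or.inl ⟨by omega, h⟩
    · exact Or.inr (Or.inl ⟨i, hi, h1, h2, h⟩)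

theorem not_block {m x : ℕ} (h : start m m ≤ x) {P : ℕ → Prop} :
    ¬ ∃ i < m, start m i ≤ x ∧ x < start m (i + 1) ∧ P i := by
  rintro ⟨i, hi, h1, h2, -⟩
  have := start_mono m (show i + 1 ≤ m by omega)
  omega

theorem likes_w {m a : ℕ} : Likes m (start m m) a ↔ a = start m m + 2 := by
  have h4 : base m = start m m + m + 3 := rfl
  rw [Likes, eq_false (not_block le_rfl), false_or]
  omega

theorem likes_rung {m x a : ℕ} (h1 : start m m < x) (h2 : x + 1 < base m) :
    Likes m x a ↔ a = x + 1 := by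
  rw [Likes, eq_false (not_block h1.le), false_or]
  omega

theorem not_likes_last {m x a : ℕ} (h2 : x + 1 = base m) : ¬ Likes m x a := by
  have h4 : base m = start m m + m + 3 := rfl
  rw [Likes, eq_false (not_block (by omega)), false_or]
  omega

theorem likes_dummy {m x a : ℕ} (h1 : base m ≤ x) (h2 : x < base m + (m + 1) * (base m + 2)) :
    Likes m x a ↔ a = start m m + 2 + (m - (x - base m) / (base m + 2)) := by
  have h4 : base m = start m m + m + 3 := rfl
  rw [Likes, eq_false (not_block (by omega)), false_or]
  generalize (x - base m) / (base m + 2) = q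
  generalize (m + 1) * (base m + 2) = s at *
  omega

theorem likes_dummy_w {m x a : ℕ} (h2 : base m + (m + 1) * (base m + 2) ≤ x) :
    Likes m x a ↔ a = start m m := by
  have h4 : base m = start m m + m + 3 := rfl
  rw [Likes, eq_false (not_block (by omega)), false_or]
  generalize (x - base m) / (base m + 2) = q
  generalize (m + 1) * (base m + 2) = s at *
  omega

theorem region_cases (m x : ℕ) : (∃ i < m, start m i ≤ x ∧ x < start m (i + 1)) ∨
    x = start m m ∨ (start m m < x ∧ x + 1 < base m) ∨ x + 1 = base m ∨
    (base m ≤ x ∧ x < base m + (m + 1) * (base m + 2)) ∨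
    base m + (m + 1) * (base m + 2) ≤ x := by
  have h4 : base m = start m m + m + 3 := rfl
  rcases lt_or_ge x (start m m) with h | h
  · exact Or.inl (exists_block h)
  · generalize (m + 1) * (base m + 2) = s at *
    omega

open Classical in
/-- The ladder network with `m` blocks of voters. -/
noncomputable def net (m : ℕ) : Network (size m) where
  out x := Finset.univ.filter fun a => Likes m x a
  not_mem_self x := by
    intro hx
    have h := (Finset.mem_filter.mp hx).2
    have h4 : base m = start m m + m + 3 := rfl
    rcases region_cases m x with ⟨i, hi, h1, h2⟩ | h1 | ⟨h1, h2⟩ | h1 | ⟨h1, h2⟩ | h1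
    · have := start_mono m (show i + 1 ≤ m by omega)
      rw [likes_block hi h1 h2] at h
      omega
    · rw [h1, likes_w] at h
      omega
    · rw [likes_rung h1 h2] at h
      omega
    · exact not_likes_last h1 h
    · rw [likes_dummy h1 h2] at h
      generalize ((x : ℕ) - base m) / (base m + 2) = q at *
      omega
    · rw [likes_dummy_w h1] at h
      omega

theorem mem_out {m : ℕ} {x a : Fin (size m)} : a ∈ (net m).out x ↔ Likes m x a := by
  simp [net]

/-- The agent that is going to be elected. -/
def ww (m : ℕ) : Fin (size m) :=
  ⟨start m m, by have := base_lt_size m; unfold base at this; omega⟩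

/-- The other candidates. -/
def bb (m i : ℕ) : Fin (size m) :=
  ⟨start m m + 2 + (m - i), by have := base_lt_size m; unfold base at this; omega⟩

theorem likersFrom_ww (m : ℕ) : (net m).likersFrom (start m m + 1) (ww m) = m + 6 := by
  have h4 : base m = start m m + m + 3 := rfl
  rw [Network.likersFrom, Network.card_filter_of_iff (lo := base m + (m + 1) * (base m + 2))
    (hi := size m) le_rfl, size]
  · omega
  · intro x
    rw [mem_out]
    simp only [x.2, and_true, ww]
    rcases region_cases m x with ⟨i, hi, h1, h2⟩ | h1 | ⟨h1, h2⟩ | h1 | ⟨h1, h2⟩ | h1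
    · have := start_mono m (show i + 1 ≤ m by omega)
      omega
    · omega
    · rw [likes_rung h1 h2]
      omega
    · simp only [not_likes_last h1, and_false, false_iff]
      omega
    · rw [likes_dummy h1 h2]
      generalize ((x : ℕ) - base m) / (base m + 2) = q at *
      omega
    · rw [likes_dummy_w h1]
      omega

theorem likersFrom_base_bb {m l : ℕ} (hl : l ≤ m) :
    (net m).likersFrom (base m) (bb m l) = base m + 2 := by
  have h4 : base m = start m m + m + 3 := rfl
  have hmul : (l + 1) * (base m + 2) ≤ (m + 1) * (base m + 2) := Nat.mul_le_mul_right _ (by omega)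
  rw [Network.likersFrom, Network.card_filter_of_iff (lo := base m + l * (base m + 2))
    (hi := base m + (l + 1) * (base m + 2)) (by unfold size; omega)]
  · rw [Nat.succ_mul]; omega
  · intro x
    rw [mem_out]
    simp only [bb]
    have hlo : base m ≤ base m + l * (base m + 2) := by omega
    rcases lt_or_ge (x : ℕ) (base m) with h0 | h0
    · omega
    rcases lt_or_ge (x : ℕ) (base m + (m + 1) * (base m + 2)) with h2 | h2
    · rw [likes_dummy h0 h2]
      obtain ⟨y, hy⟩ := Nat.exists_eq_add_of_le h0
      rw [hy] at h2 ⊢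
      have hq : y / (base m + 2) < m + 1 := (Nat.div_lt_iff_lt_mul (by omega)).mpr (by omega)
      have e : y / (base m + 2) = l ↔ l * (base m + 2) ≤ y ∧ y < (l + 1) * (base m + 2) := by
        rw [← Nat.div_lt_iff_lt_mul (by omega), ← Nat.le_div_iff_mul_le (by omega)]
        omega
      rw [Nat.add_sub_cancel_left]
      constructor
      · rintro ⟨-, h⟩
        have := e.mp (by omega)
        omega
      · rintro ⟨h5, h6⟩
        have := e.mpr ⟨by omega, by omega⟩
        exact ⟨by omega, by omega⟩
    · rw [likes_dummy_w h2]
      omega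

theorem likersFrom_bb {m l : ℕ} (hl : l ≤ m) :
    (net m).likersFrom (start m m + 1) (bb m l) = base m + 3 := by
  have h4 : base m = start m m + m + 3 := rfl
  have hs := base_lt_size m
  have key : ∀ d ≤ m + 2, (net m).likersFrom (base m - d) (bb m l) =
      base m + 2 + if l + 2 ≤ d then 1 else 0 := by
    intro d hd
    induction d with
    | zero => simpa using likersFrom_base_bb hl
    | succ d ih =>
      have h1 := ih (by omega)
      have h2 := (net m).likersFrom_eq ⟨base m - (d + 1), by omega⟩ (bb m l)
      simp only at h2
      rw [show base m - (d + 1) + 1 = base m - d by omega] at h2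
      have h3 : bb m l ∈ (net m).out ⟨base m - (d + 1), by omega⟩ ↔ d = l + 1 := by
        rw [mem_out]
        simp only [bb]
        rcases Nat.eq_zero_or_pos d with rfl | hd0
        · simp only [not_likes_last (show base m - (0 + 1) + 1 = base m by omega), false_iff]
          omega
        · rw [likes_rung (by omega) (by omega)]
          omega
      simp only [h3] at h2
      rw [h2, h1]
      split_ifs <;> omega
  have := key (m + 2) le_rfl
  rw [if_pos (by omega)] at this
  rwa [show base m - (m + 2) = start m m + 1 by omega] at this

theorem isLadder {m : ℕ} (hm : 0 < m) :
    IsLadder (net m) m (base m + 3) (ww m) (bb m) := by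
  have h4 : base m = start m m + m + 3 := rfl
  refine ⟨hm, by omega, rfl, fun _ _ => rfl, fun i hi x h1 h2 => ?_, ?_, fun i hi x hx => ?_, ?_,
    fun x a hx ha => ?_, fun x a ha => ?_, ?_, fun l hl => ?_⟩
  · ext a
    rw [mem_out, likes_block hi h1 h2]
    simp [ww, bb, Fin.ext_iff]
  · ext a
    rw [mem_out]
    simp only [ww, bb, Finset.mem_singleton, Fin.ext_iff, likes_w]
    omega
  · ext a
    rw [mem_out, hx, likes_rung (by omega) (by omega)]
    simp only [bb, Finset.mem_singleton, Fin.ext_iff]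
    omega
  · ext a
    rw [mem_out]
    simp only [bb, Finset.notMem_empty, iff_false]
    exact not_likes_last (by omega)
  · ext a'
    rw [mem_out] at ha ⊢
    rw [Finset.mem_singleton, Fin.ext_iff]
    rcases region_cases m x with ⟨i, hi, h1, h2⟩ | h1 | ⟨h1, h2⟩ | h1 | ⟨h1, h2⟩ | h1
    · have := start_mono m (show i + 1 ≤ m by omega)
      omega
    · omega
    · rw [likes_rung h1 h2] at ha ⊢
      omega
    · exact absurd ha (not_likes_last h1)
    · rw [likes_dummy h1 h2] at ha ⊢
      rw [ha]
    · rw [likes_dummy_w h1] at ha ⊢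
      omega
  · rw [mem_out] at ha
    simp only [ww, bb, Fin.ext_iff]
    rcases region_cases m x with ⟨i, hi, h1, h2⟩ | h1 | ⟨h1, h2⟩ | h1 | ⟨h1, h2⟩ | h1
    · rw [likes_block hi h1 h2] at ha
      exact ha.imp_right fun h => ⟨i, hi.le, h⟩
    · rw [h1, likes_w] at ha
      exact Or.inr ⟨m, le_rfl, by omega⟩
    · rw [likes_rung h1 h2] at ha
      exact Or.inr ⟨m - (x - (start m m + 1)), by omega, by omega⟩
    · exact absurd ha (not_likes_last h1)
    · rw [likes_dummy h1 h2] at ha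
      refine Or.inr ⟨_, ?_, ha⟩
      have := (Nat.div_lt_iff_lt_mul (show 0 < base m + 2 by omega)).mpr
        (show (x : ℕ) - base m < (m + 1) * (base m + 2) by omega)
      omega
    · rw [likes_dummy_w h1] at ha
      exact Or.inl ha
  · rw [likersFrom_ww]
    omega
  · exact likersFrom_bb hl

end PluralityNet

end SeqVoting

open SeqVoting in
/-- For both voting rules there are networks with maximum out-degree two in which the only
achievable agent is less popular than the most popular agent by a given number. -/
theorem SeqVoting.exists_network_gap (rule : VotingRule) {k : ℕ} (hk : 2 ≤ k) :
    ∃ (n : ℕ) (G : Network n) (w : Fin n),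
      G.maxOut = 2 ∧ (G.popularity w : ℤ) = (G.maxIn : ℤ) - (k : ℤ) ∧
      ∀ ε : ℝ, 0 < ε → ε < 1 / (2 * (n : ℝ)) →
        G.achievable rule ε = {w} ∧ G.additiveGap rule ε = (k : ℤ) := by
  cases rule with
  | plurality =>
    obtain ⟨m, rfl⟩ : ∃ m, k = m + 1 := ⟨k - 1, by omega⟩
    have hL := PluralityNet.isLadder (m := m) (by omega)
    refine ⟨_, PluralityNet.net m, PluralityNet.ww m, hL.maxOut_eq, ?_, fun ε h1 h2 => ?_⟩
    · rw [hL.popularity_w, hL.maxIn_eq]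
      push_cast
      ring
    · have h3 := hL.achievable_eq h1 h2
      refine ⟨h3, ?_⟩
      rw [Network.additiveGap_of_achievable _ _ _ h3, hL.agentGap_w]
      push_cast
      ring
  | approval =>
    refine ⟨_, ApprovalNet.net k, ApprovalNet.ww k, ApprovalNet.maxOut_eq k, ?_,
      fun ε h1 h2 => ?_⟩
    · rw [(ApprovalNet.popularity_eq k).1, ApprovalNet.maxIn_eq]
      push_cast
      ring
    · have h3 := ApprovalNet.achievable_eq (by omega) h1 h2
      exact ⟨h3, by rw [Network.additiveGap_of_achievable _ _ _ h3, ApprovalNet.agentGap_ww]⟩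

theorem mainTheorem2 (rule : SeqVoting.VotingRule) :
    (∀ ε : ℕ → ℝ, (∀ n : ℕ, 0 < n → 0 < ε n ∧ ε n < 1 / (2 * (n : ℝ))) →
      SeqVoting.supAdditiveGap rule ε (fun _ => {G | G.maxOut = 2}) = ⊤) ∧
    ∀ k : ℕ, 2 ≤ k →
      ∃ (n : ℕ) (G : SeqVoting.Network n) (w : Fin n),
        G.maxOut = 2 ∧
        (G.popularity w : ℤ) = (G.maxIn : ℤ) - (k : ℤ) ∧
        ∀ ε : ℝ, 0 < ε → ε < 1 / (2 * (n : ℝ)) →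
          G.achievable rule ε = {w} ∧ G.additiveGap rule ε = (k : ℤ) := by
  refine ⟨fun ε hε => ?_, fun k hk => SeqVoting.exists_network_gap rule hk⟩
  rw [EReal.eq_top_iff_forall_lt]
  intro y
  obtain ⟨k, hk⟩ := exists_nat_gt y
  obtain ⟨n, G, w, h1, -, h2⟩ := SeqVoting.exists_network_gap rule (show 2 ≤ k + 2 by omega)
  obtain ⟨h3, h4⟩ := hε n w.pos
  have h5 := (h2 (ε n) h3 h4).2
  have h6 : (((G.additiveGap rule (ε n) : ℤ) : ℝ) : EReal) ≤
      SeqVoting.supAdditiveGap rule ε (fun _ => {G | G.maxOut = 2}) :=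
    le_iSup_of_le n (le_iSup_of_le G (le_iSup_of_le h1 le_rfl))
  refine lt_of_lt_of_le ?_ h6
  rw [h5, EReal.coe_lt_coe_iff]
  push_cast
  linarith
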